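/- Let $\rho,\sigma>0$. Consider Brownian point particles on the line with hard-core repulsion in the annealed setting, as follows. At time $0$ the particles, indexed by $i\in\mathbb Z$, have positions $\cdots<Y_{-1}<Y_0=0<Y_1<\cdots$, where $(Y_i)_{i\neq0}$ is a Poisson point process on $\mathbb R$ of intensity $\rho$ (the equilibrium state of density $\rho$ with the tagged particle at the origin). Let $(B_j)_{j\in\mathbb Z}$ be independent standard Brownian motions, independent of the initial positions, and let $Z_j(t)=Y_j+\frac{\sigma}{\sqrt2}B_j(t)$ be free particles, of variance $\sigma^2/2$ per unit time. The hard-core particles $X_i(t)$ are the continuous trajectories with $X_i(0)=Y_i$ and $X_i(t)\le X_{i+1}(t)$ for all $i$ and $t$ (no overtaking) which at each time are a relabelling of the free particles $Z_j(t)$ (particles that meet exchange their roles). The tracer is $x(t)=X_0(t)$, and probabilities and averages are taken over both the initial state and the evolution. Put $$\phi_a(\xi)=\frac{\rho}{2}\left[\sqrt{\int_{\xi}^{\infty}\operatorname{erfc}(\eta/\sigma)\,d\eta}-\sqrt{\int_{-\xi}^{\infty}\operatorname{erfc}(\eta/\sigma)\,d\eta}\,\right]^2,\qquad \operatorname{erfc}(x)=\frac{2}{\sqrt\pi}\int_x^\infty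 e^{-u^2}\,du ,$$ and write $A_t\asymp B_t$ if $\ln A_t/\ln B_t\to1$ as $t\to\infty$. Then the following hold. 1. For every $t>0$ the law of $x(t)$ has a continuous, everywhere positive density $P_t$ with respect to Lebesgue measure. For every $\xi\in\mathbb R$, $\lim_{t\to\infty}t^{-1/2}\ln P_t(\xi\sqrt t)=-\phi_a(\xi)$, and for every $\xi\ne0$, $P_t(\xi\sqrt t)\asymp e^{-\sqrt t\,\phi_a(\xi)}$. Also $\mathbb P(x(t)>\xi\sqrt t)\asymp e^{-\sqrt t\,\phi_a(\xi)}$ for every $\xi>0$, and $\mathbb P(x(t)<\xi\sqrt t)\asymp e^{-\sqrt t\,\phi_a(\xi)}$ for every $\xi<0$. 2. $\phi_a(\xi)/(\rho|\xi|)\to1$ as $|\xi|\to\infty$. 3. All exponential moments of $x(t)$ are finite. Let $\kappa_n(t)=\frac{d^n}{d\lambda^n}\ln\langle e^{\lambda x(t)}\rangle\big|_{\lambda=0}$ be the cumulants of $x(t)$. The odd cumulants vanish, and as $t\to\infty$ $$\frac{\kappa_2(t)}{\sqrt t}\to\frac{\sigma}{\rho\sqrt\pi},\qquad \frac{\kappa_4(t)}{\sqrt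 t}\to\frac{\sigma}{\rho^3}\Big[\frac4\pi-1\Big]\frac{3}{\sqrt\pi},\qquad \frac{\kappa_6(t)}{\sqrt t}\to\frac{\sigma}{\rho^5}\Big[\frac{68}{\pi^2}-\frac{30}{\pi}+3\Big]\frac{15}{\sqrt\pi}.$$ -/

import Mathlib

open MeasureTheory ProbabilityTheory Filter Topology Asymptotics
open scoped NNReal ENNReal

noncomputable section

namespace SingleFile

/-- The complementary error function `erfc x = (2 / √π) ∫_x^∞ exp (-u²) du`. -/
def erfc (x : ℝ) : ℝ :=
  2 / √Real.pi * ∫ u in Set.Ioi x, Real.exp (-u ^ 2)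

/-- The annealed large deviation function of the tracer. -/
def phiA (ρ σ ξ : ℝ) : ℝ :=
  ρ / 2 * (√(∫ η in Set.Ioi ξ, erfc (η / σ)) - √(∫ η in Set.Ioi (-ξ), erfc (η / σ))) ^ 2

/-- Logarithmic equivalence `A ≍ B` at large time: `ln A / ln B → 1`. -/
def LogEquiv (A B : ℝ≥0 → ℝ) : Prop :=
  Tendsto (fun t => Real.log (A t) / Real.log (B t)) atTop (𝓝 1)

/-- The `n`-th cumulant of `Z`: the `n`-th derivative at `0` of `l ↦ ln E[exp (l Z)]`. -/
def cumulant {Ω : Type*} [MeasurableSpace Ω] (n : ℕ) (Z : Ω → ℝ) (P : Measure Ω) : ℝ :=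
  iteratedDeriv n (cgf Z P) 0

/-- The random points `Y i` form a Poisson point process on the line with intensity measure `Λ`:
the numbers of points in finitely many disjoint Borel sets of finite intensity are independent
Poisson variables whose parameters are the intensities of the sets. -/
def IsPoissonPointProcess {ι Ω : Type*} [MeasurableSpace Ω]
    (Y : ι → Ω → ℝ) (Λ : Measure ℝ) (P : Measure Ω) : Prop :=
  ∀ (k : ℕ) (A : Fin k → Set ℝ) (n : Fin k → ℕ),
    (∀ j, MeasurableSet (A j)) → (∀ j, Λ (A j) ≠ ∞) → Pairwise (Function.onFun Disjoint A) →
    P {ω | ∀ j, {i | Y i ω ∈ A j}.encard = (n j : ℕ∞)} =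
      ∏ j, poissonMeasure (Λ (A j)).toNNReal {n j}

/-- The equilibrium (Poisson) initial state of density `ρ`, seen from the tracer: the particles are
ranked by position, the particle of rank `0` sits at the origin, and the other particles form a
Poisson point process of intensity `ρ`. -/
structure IsEquilibriumState {Ω : Type*} [MeasurableSpace Ω]
    (ρ : ℝ) (Y : ℤ → Ω → ℝ) (P : Measure Ω) : Prop where
  measurable : ∀ i, Measurable (Y i)
  ranked : ∀ᵐ ω ∂P, StrictMono fun i => Y i ω
  tracer : ∀ᵐ ω ∂P, Y 0 ω = 0
  poisson : IsPoissonPointProcess (fun i : {i : ℤ // i ≠ 0} => Y i)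
    (ENNReal.ofReal ρ • (volume : Measure ℝ)) P

/-- Given free trajectories `z j` (which may cross), `x i` are the trajectories of the same
identical point particles with hard-core repulsion: they are continuous and start at the same
points, no particle ever overtakes another one, and two particles that meet only exchange their
roles, so that at each time the hard-core particles occupy exactly the positions of the free ones
(with multiplicity). -/
structure IsHardCoreMotion (z x : ℤ → ℝ≥0 → ℝ) : Prop where
  continuous : ∀ i, Continuous (x i)
  start : ∀ i, x i 0 = z i 0
  ordered : ∀ t, Monotone fun i => x i t
  relabel : ∀ t, ∃ π : Equiv.Perm ℤ, ∀ i, x i t = z (π i) t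

/-- The single-file system of Brownian point particles with hard-core repulsion in the annealed
setting. Each free particle starts at `Y j` and diffuses with variance `σ² / 2` per unit time; the
driving Brownian motions `B j` are independent of each other and of the initial state. The `X i`
are the positions of the hard-core particles; the tracer is `X 0`. The measure `P` averages over
the initial state and the evolution together. -/
structure IsAnnealedSingleFile {Ω : Type*} [MeasurableSpace Ω] (ρ σ : ℝ)
    (Y : ℤ → Ω → ℝ) (B X : ℤ → ℝ≥0 → Ω → ℝ) (P : Measure Ω) : Prop where
  initial : IsEquilibriumState ρ Y P
  measurable_noise : ∀ j t, Measurable (B j t)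
  brownian : ∀ j, IsBrownianReal (B j) P
  indep_noise : iIndepFun (fun (j : ℤ) (ω : Ω) (t : ℝ≥0) => B j t ω) P
  indep_initial : IndepFun (fun (ω : Ω) (j : ℤ) => Y j ω)
    (fun (ω : Ω) (j : ℤ) (t : ℝ≥0) => B j t ω) P
  measurable : ∀ i t, Measurable (X i t)
  hardCore : ∀ᵐ ω ∂P, IsHardCoreMotion (fun j t => Y j ω + σ / √2 * B j t ω)
    (fun i t => X i t ω)

end SingleFile

end

/-! The tracer is located by counting. The hard-core particles are the free ones ranked again, so `X
0 t > r` exactly when the net number of free particles crossing from the tracer's side to the right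
of `r` is at least one (`IsHardCoreMotion.lt_tracer_iff`). What has to be excluded is a drift of the
labels. The index shift between two enumerations of the same points does not depend on the level at
which it is read, is locally constant in time, and vanishes at time 0. This argument needs the free
system to be locally finite uniformly on `[0, t]`, which follows from Doob's inequality, Campbell's
formula and Borel-Cantelli (`IsAnnealedSingleFile.ae_properUpTo`).

Put `s = σ √t`, `A = tailInt s x`, `B = tailInt s (-x)`, `q = gaussTail s x`. Given the initial
positions the displacements are independent, and the generating functional of the Poisson process
then yields the generating function of the crossing number, `exp (ρ A (z - 1) + ρ B (z⁻¹ - 1)) * (1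
+ (z - 1) q)`: a difference of two Poisson variables plus an independent Bernoulli term due to the
tracer (`IsAnnealedSingleFile.integral_exp_crossing`). Fourier inversion writes `P (X 0 t > x)` as a
contour integral against `(z - 1)⁻¹`. Differentiating in `x` cancels the pole, and on the circle of
radius `√(B / A)` the integral becomes a combination of scaled Bessel functions times `exp (-ρ (√A -
√B) ^ 2)`. This is the exact density `tracerDens`, even in `x`. By Brownian scaling its exponent at
`x = ξ √t` is `-√t φ_a(ξ)`, while the remaining factor lies between powers of `t`; this is the large
deviation statement. For the tails, the event that the crossing number equals 1 gives the lower
bound and the same contour integral, bounded in absolute value, the upper one.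

The cumulants need more than the large deviation principle: they need control of the moment
generating function in a complex neighbourhood of 0. Let `φ` be the analytic continuation of `φ_a`
and `T = √t`. At the dual point `l = φ' ζ`, a contour shift through the saddle `ζ` shows that the
generating function divided by `exp (T (φ' ζ * ζ - φ ζ))` is bounded on a fixed disc, uniformly in
`T` (`exists_norm_complexMGF_le`). An upper bound is enough: the quotient equals 1 at the origin, so
Schwarz's lemma keeps it near 1 on a smaller disc and Cauchy's estimates bound all derivatives of
its logarithm (`exists_norm_iteratedDeriv_log_sub_le`). Hence each cumulant is `T` times a
derivative at 0 of the Legendre transform of `φ`, up to a bounded error. The identity `B - A = x`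
makes `f = A + B - 2 √(A B)` a root of `2 (A + B) f = x ^ 2 + f ^ 2`, from which its Taylor
coefficients are read off. -/

noncomputable section

namespace SingleFile

/-! ### Hard-core trajectories from free trajectories -/

/-- The indicator of `y ≤ r`, as an integer. -/
def belowInd (r y : ℝ) : ℤ := if y ≤ r then 1 else 0

lemma belowInd_of_le {r y : ℝ} (h : y ≤ r) : belowInd r y = 1 := if_pos h

lemma belowInd_of_lt {r y : ℝ} (h : r < y) : belowInd r y = 0 := if_neg h.not_ge

/-- A bi-infinite sequence which tends to `±∞` at `±∞`, in quantitative form. -/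
def ProperSeq (f : ℤ → ℝ) : Prop :=
  ∀ r : ℝ, ∃ N : ℤ, ∀ j, (N ≤ j → r < f j) ∧ (j ≤ -N → f j < r)

/-- Trajectories which tend to `±∞` at `±∞`, uniformly on `[0, t]`. -/
def ProperUpTo (z : ℤ → ℝ≥0 → ℝ) (t : ℝ≥0) : Prop :=
  ∀ r : ℝ, ∃ N : ℤ, ∀ s ≤ t, ∀ j, (N ≤ j → r < z j s) ∧ (j ≤ -N → z j s < r)

lemma ProperUpTo.properSeq {z : ℤ → ℝ≥0 → ℝ} {t s : ℝ≥0} (h : ProperUpTo z t) (hs : s ≤ t) :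
    ProperSeq fun j => z j s := fun r => by
  obtain ⟨N, hN⟩ := h r
  exact ⟨N, hN s hs⟩

lemma ProperSeq.finite_Icc {f : ℤ → ℝ} (hf : ProperSeq f) (a b : ℝ) :
    {j | a ≤ f j ∧ f j ≤ b}.Finite := by
  obtain ⟨N, hN⟩ := hf a
  obtain ⟨M, hM⟩ := hf b
  refine (Set.finite_Icc (-N) M).subset fun j hj => ⟨?_, ?_⟩
  · by_contra! h
    exact absurd ((hN j).2 h.le) (not_lt.2 hj.1)
  · by_contra! h
    exact absurd ((hM j).1 h.le) (not_lt.2 hj.2)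

/-- Bounded windows contain finitely many points of `f`, hence of `g`. If the monotone `g` stayed
bounded on one side, a whole half-line of indices would fall into a single window. -/
lemma ProperSeq.of_monotone_perm {f g : ℤ → ℝ} (hf : ProperSeq f) (hg : Monotone g)
    (π : Equiv.Perm ℤ) (hπ : ∀ i, g i = f (π i)) : ProperSeq g := by
  have hfin : ∀ a b, {j | a ≤ g j ∧ g j ≤ b}.Finite := fun a b => by
    have := (hf.finite_Icc a b).preimage π.injective.injOn
    refine this.subset fun j hj => ?_
    simpa [hπ] using hj
  intro r
  have h1 : ∃ N : ℤ, ∀ j, N ≤ j → r < g j := by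
    by_contra! h
    refine (Set.Ici_infinite (0 : ℤ)) ((hfin (g 0) r).subset fun i hi => ⟨hg hi, ?_⟩)
    obtain ⟨j, hj, hj'⟩ := h i
    exact (hg hj).trans hj'
  have h2 : ∃ N : ℤ, ∀ j, j ≤ N → g j < r := by
    by_contra! h
    refine (Set.Iic_infinite (0 : ℤ)) ((hfin r (g 0)).subset fun i hi => ⟨?_, hg hi⟩)
    obtain ⟨j, hj, hj'⟩ := h i
    exact hj'.trans (hg hj)
  obtain ⟨N, hN⟩ := h1
  obtain ⟨M, hM⟩ := h2
  exact ⟨max N (-M), fun j => ⟨fun hj => hN j ((le_max_left _ _).trans hj),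
    fun hj => hM j (by have := le_max_right N (-M); omega)⟩⟩

lemma ProperSeq.finite_support {f g : ℤ → ℝ} (hf : ProperSeq f) (hg : ProperSeq g) (r : ℝ) :
    (Function.support fun i => belowInd r (f i) - belowInd r (g i)).Finite := by
  obtain ⟨N, hN⟩ := hf r
  obtain ⟨M, hM⟩ := hg r
  refine (Set.finite_Icc (-max N M) (max N M)).subset fun j hj => ?_
  by_contra h
  rw [Set.mem_Icc, not_and_or, not_le, not_le] at h
  apply hj
  have hN' := le_max_left N M
  have hM' := le_max_right N M
  rcases h with h | h
  · have h1 := (hN j).2 (by omega)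
    have h2 := (hM j).2 (by omega)
    simp [belowInd_of_le h1.le, belowInd_of_le h2.le]
  · have h1 := (hN j).1 (by omega)
    have h2 := (hM j).1 (by omega)
    simp [belowInd_of_lt h1, belowInd_of_lt h2]

/-- For two proper enumerations of the same points, the index shift does not depend on the level
at which it is measured. -/
lemma ProperSeq.finsum_belowInd_sub_eq {f g : ℤ → ℝ} (hf : ProperSeq f) (hg : ProperSeq g)
    (π : Equiv.Perm ℤ) (hπ : ∀ i, g i = f (π i)) (r r' : ℝ) :
    ∑ᶠ i, (belowInd r (g i) - belowInd r (f i)) =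
      ∑ᶠ i, (belowInd r' (g i) - belowInd r' (f i)) := by
  have key : ∀ h : ℤ → ℝ, ProperSeq h →
      (Function.support fun i => belowInd r (h i) - belowInd r' (h i)).Finite := fun h hh => by
    obtain ⟨N, hN⟩ := hh r
    obtain ⟨M, hM⟩ := hh r'
    refine (Set.finite_Icc (-max N M) (max N M)).subset fun j hj => ?_
    by_contra h
    rw [Set.mem_Icc, not_and_or, not_le, not_le] at h
    apply hj
    have hN' := le_max_left N M
    have hM' := le_max_right N M
    rcases h with h | h
    · have h1 := (hN j).2 (by omega)
      have h2 := (hM j).2 (by omega)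
      simp [belowInd_of_le h1.le, belowInd_of_le h2.le]
    · have h1 := (hN j).1 (by omega)
      have h2 := (hM j).1 (by omega)
      simp [belowInd_of_lt h1, belowInd_of_lt h2]
  -- The difference of the two shifts is regrouped as a count of the points of `g` between the two
  -- levels minus the same count for `f`. Each is a finite sum, and the permutation carries one to
  -- the other.
  rw [← sub_eq_zero, ← finsum_sub_distrib (hg.finite_support hf r) (hg.finite_support hf r')]
  have h1 : ∀ i, belowInd r (g i) - belowInd r (f i) - (belowInd r' (g i) - belowInd r' (f i))
      = (belowInd r (g i) - belowInd r' (g i)) - (belowInd r (f i) - belowInd r' (f i)) :=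
    fun i => by ring
  simp_rw [h1]
  rw [finsum_sub_distrib (key g hg) (key f hf), sub_eq_zero]
  simp_rw [hπ]
  exact finsum_comp_equiv π (f := fun i => belowInd r (f i) - belowInd r' (f i))

lemma eventually_belowInd_eq {X : Type*} [TopologicalSpace X] {f : X → ℝ} {s : X} {r : ℝ}
    (hf : ContinuousAt f s) (h : f s ≠ r) : ∀ᶠ u in 𝓝 s, belowInd r (f u) = belowInd r (f s) := by
  rcases lt_or_gt_of_ne h with h | h
  · filter_upwards [hf.eventually (gt_mem_nhds h)] with u hu
    simp [belowInd, hu.le, h.le]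
  · filter_upwards [hf.eventually (lt_mem_nhds h)] with u hu
    rw [belowInd_of_lt hu, belowInd_of_lt h]

/-- Properness freezes the indicators of all indices outside `[-N, N]`, so continuity is only used
for finitely many trajectories. -/
lemma eventually_forall_belowInd_eq {X : Type*} [TopologicalSpace X] {f : ℤ → X → ℝ} {s : X}
    {r : ℝ} (hf : ∀ i, ContinuousAt (f i) s) (h : ∀ i, f i s ≠ r) (N : ℤ)
    (hN : ∀ᶠ u in 𝓝 s, ∀ j, (N ≤ j → r < f j u) ∧ (j ≤ -N → f j u < r)) :
    ∀ᶠ u in 𝓝 s, ∀ i, belowInd r (f i u) = belowInd r (f i s) := by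
  have h1 : ∀ᶠ u in 𝓝 s, ∀ i ∈ Set.Icc (-N) N, belowInd r (f i u) = belowInd r (f i s) :=
    (Set.finite_Icc _ _).eventually_all.2 fun i _ => eventually_belowInd_eq (hf i) (h i)
  filter_upwards [h1, hN] with u hu1 hu2 i
  have hs := hN.self_of_nhds
  rcases lt_or_ge i (-N) with hi | hi
  · simp [belowInd, ((hu2 i).2 hi.le).le, ((hs i).2 hi.le).le]
  rcases le_or_gt i N with hi' | hi'
  · exact hu1 i ⟨hi, hi'⟩
  · rw [belowInd_of_lt ((hu2 i).1 hi'.le), belowInd_of_lt ((hs i).1 hi'.le)]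

/-- The hard-core particles are the free ones ranked with the initial labels: no index shift
appears between them. -/
lemma IsHardCoreMotion.finsum_belowInd_sub_eq_zero {z x : ℤ → ℝ≥0 → ℝ} (h : IsHardCoreMotion z x)
    (hz : ∀ j, Continuous (z j)) {t : ℝ≥0} (hp : ProperUpTo z t) (r : ℝ) :
    ∑ᶠ i, (belowInd r (x i t) - belowInd r (z i t)) = 0 := by
  have hzs : ∀ s ≤ t, ProperSeq fun j => z j s := fun s hs => hp.properSeq hs
  have hxs : ∀ s ≤ t, ProperSeq fun j => x j s := fun s hs => by
    obtain ⟨π, hπ⟩ := h.relabel s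
    exact (hzs s hs).of_monotone_perm (h.ordered s) π hπ
  let c : Set.Icc 0 t → ℤ := fun s => ∑ᶠ i, (belowInd r (x i s) - belowInd r (z i s))
  have hc : IsLocallyConstant c := by
    rw [IsLocallyConstant.iff_eventually_eq]
    rintro ⟨s, hs⟩
    -- At the given level `r` a particle may sit exactly at time `s`, and its indicator could jump.
    -- Only countably many levels are occupied at time `s`, so the shift is read at a free one
    -- instead.
    obtain ⟨r', hr'⟩ : ∃ r', r' ∉ Set.range fun j => z j s := by
      by_contra! hcon
      have : Set.range (fun j => z j s) = Set.univ := Set.eq_univ_of_forall hcon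
      exact Set.not_countable_univ (α := ℝ) (this ▸ Set.countable_range _)
    obtain ⟨π, hπ⟩ := h.relabel s
    have hz' : ∀ i, z i s ≠ r' := fun i hi => hr' ⟨i, hi⟩
    have hx' : ∀ i, x i s ≠ r' := fun i => by rw [hπ]; exact hz' _
    obtain ⟨N, hN⟩ := hp r'
    obtain ⟨M, hM⟩ := hxs s hs.2 r'
    have e1 : ∀ᶠ u : Set.Icc 0 t in 𝓝 ⟨s, hs⟩, ∀ i,
        belowInd r' (z i u) = belowInd r' (z i s) :=
      eventually_forall_belowInd_eq (f := fun i (u : Set.Icc 0 t) => z i u) (s := ⟨s, hs⟩)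
        (fun i => ((hz i).comp continuous_subtype_val).continuousAt) hz' N
        (Eventually.of_forall fun u => hN u u.2.2)
    have e2 : ∀ᶠ u : Set.Icc 0 t in 𝓝 ⟨s, hs⟩, ∀ i,
        belowInd r' (x i u) = belowInd r' (x i s) := by
      have cx : ∀ i, ContinuousAt (fun u : Set.Icc 0 t => x i u) ⟨s, hs⟩ :=
        fun i => ((h.continuous i).comp continuous_subtype_val).continuousAt
      refine eventually_forall_belowInd_eq (f := fun i (u : Set.Icc 0 t) => x i u)
        (s := ⟨s, hs⟩) cx hx' M ?_
      -- By the ordering, the two trajectories `x M` and `x (-M)` control all those beyond them; no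
      -- uniform properness of `x` in time is needed.
      filter_upwards [(cx M).eventually (lt_mem_nhds ((hM M).1 le_rfl)),
        (cx (-M)).eventually (gt_mem_nhds ((hM (-M)).2 le_rfl))] with u h1 h2 j
      exact ⟨fun hj => h1.trans_le (h.ordered u hj), fun hj => (h.ordered u hj).trans_lt h2⟩
    filter_upwards [e1, e2] with u h1 h2
    obtain ⟨π', hπ'⟩ := h.relabel u
    have a1 := (hzs u u.2.2).finsum_belowInd_sub_eq (hxs u u.2.2) π' hπ' r r'
    have a2 := (hzs s hs.2).finsum_belowInd_sub_eq (hxs s hs.2) π hπ r r'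
    simp only [c]
    rw [a1, a2]
    simp_rw [h1, h2]
  -- A locally constant integer on the connected interval `[0, t]` equals its value at time 0, where
  -- both families start at the same points.
  have : PreconnectedSpace (Set.Icc 0 t) := by
    rw [← isPreconnected_iff_preconnectedSpace]
    exact isPreconnected_Icc
  have := hc.apply_eq_of_isPreconnected (isPreconnected_univ) (Set.mem_univ ⟨t, zero_le, le_rfl⟩)
    (Set.mem_univ ⟨0, le_rfl, zero_le⟩)
  simp only [c] at this
  rw [this]
  simp [h.start]

/-- The number of free particles which start at or to the left of the tracer and end to the right
of `r`, minus the number of those which start to the right of the tracer and end at or to the left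
of `r`. -/
def crossing (z : ℤ → ℝ) (r : ℝ) : ℤ :=
  ∑ᶠ j : ℤ, ((if j ≤ 0 then 1 else 0) - belowInd r (z j))

lemma ProperSeq.finite_support_crossing {z : ℤ → ℝ} (hz : ProperSeq z) (r : ℝ) :
    (Function.support fun j : ℤ => ((if j ≤ 0 then 1 else 0) - belowInd r (z j) : ℤ)).Finite := by
  obtain ⟨N, hN⟩ := hz r
  refine (Set.finite_Icc (-max N 0) (max N 0)).subset fun j hj => ?_
  by_contra h
  rw [Set.mem_Icc, not_and_or, not_le, not_le] at h
  apply hj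
  have hN' := le_max_left N 0
  have hM' := le_max_right N 0
  rcases h with h | h
  · have h1 := (hN j).2 (by omega)
    simp [belowInd, h1.le, show j ≤ 0 by omega]
  · have h1 := (hN j).1 (by omega)
    simp [belowInd_of_lt h1, show ¬ j ≤ 0 by omega]

/-- Since the index shift vanishes, the crossing number may be computed with the ordered
trajectories `x`. There all summands have one sign: if `r < x 0 t` they are nonnegative and the term
`j = 0` is 1; otherwise they are all nonpositive. -/
theorem IsHardCoreMotion.lt_tracer_iff {z x : ℤ → ℝ≥0 → ℝ} (h : IsHardCoreMotion z x)
    (hz : ∀ j, Continuous (z j)) {t : ℝ≥0} (hp : ProperUpTo z t) (r : ℝ) :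
    r < x 0 t ↔ 1 ≤ crossing (fun j => z j t) r := by
  have hzs := hp.properSeq le_rfl
  have hxs : ProperSeq fun j => x j t := by
    obtain ⟨π, hπ⟩ := h.relabel t
    exact hzs.of_monotone_perm (h.ordered t) π hπ
  have h0 := h.finsum_belowInd_sub_eq_zero hz hp r
  have h1 : crossing (fun j => z j t) r = crossing (fun j => x j t) r := by
    rw [← sub_eq_zero, crossing, crossing, ← finsum_sub_distrib
      (hzs.finite_support_crossing r) (hxs.finite_support_crossing r), ← h0]
    congr 1; ext j; ring
  rw [h1, crossing]
  constructor
  · intro hr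
    rw [finsum_eq_sum _ (hxs.finite_support_crossing r)]
    have hb : ∀ j : ℤ, 0 ≤ j → belowInd r (x j t) = 0 := fun j hj => by
      exact belowInd_of_lt (hr.trans_le (h.ordered t hj))
    have hmem : (0 : ℤ) ∈ (hxs.finite_support_crossing r).toFinset := by
      simp [hb 0 le_rfl]
    refine le_trans ?_ (Finset.single_le_sum (f := fun j : ℤ =>
      ((if j ≤ 0 then 1 else 0) - belowInd r (x j t) : ℤ)) (fun j _ => ?_) hmem)
    · simp [hb 0 le_rfl]
    · rcases le_or_gt j 0 with hj | hj
      · simp only [hj, if_true, belowInd]; split_ifs <;> simp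
      · simp [hb j hj.le, not_le.2 hj]
  · intro hr
    by_contra! hcon
    have : ∑ᶠ j : ℤ, ((if j ≤ 0 then 1 else 0) - belowInd r (x j t) : ℤ) ≤ 0 := by
      rw [finsum_eq_sum _ (hxs.finite_support_crossing r)]
      refine Finset.sum_nonpos fun j _ => ?_
      rcases le_or_gt j 0 with hj | hj
      · simp [hj, belowInd, (h.ordered t hj).trans hcon]
      · simp only [not_le.2 hj, if_false, belowInd]; split_ifs <;> simp
    omega

/-! ### Poisson point processes: intensity and generating functional -/

/-- Telescoping. With Campbell's formula it makes the generating functional Lipschitz for the `L¹`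
norm of the intensity. -/
lemma norm_prod_sub_prod_le {ι : Type*} (s : Finset ι) (f g : ι → ℂ) (hf : ∀ i, ‖f i‖ ≤ 1)
    (hg : ∀ i, ‖g i‖ ≤ 1) : ‖∏ i ∈ s, f i - ∏ i ∈ s, g i‖ ≤ ∑ i ∈ s, ‖f i - g i‖ := by
  classical
  induction s using Finset.induction_on with
  | empty => simp
  | insert a s ha ih =>
    rw [Finset.prod_insert ha, Finset.prod_insert ha, Finset.sum_insert ha]
    have h1 : ‖∏ i ∈ s, g i‖ ≤ 1 := by
      rw [norm_prod]
      exact Finset.prod_le_one (fun _ _ => norm_nonneg _) fun i _ => hg i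
    calc ‖f a * ∏ i ∈ s, f i - g a * ∏ i ∈ s, g i‖
        = ‖f a * (∏ i ∈ s, f i - ∏ i ∈ s, g i) + (f a - g a) * ∏ i ∈ s, g i‖ := by ring_nf
      _ ≤ ‖f a‖ * ‖∏ i ∈ s, f i - ∏ i ∈ s, g i‖ + ‖f a - g a‖ * ‖∏ i ∈ s, g i‖ := by
          refine (norm_add_le _ _).trans ?_
          rw [norm_mul, norm_mul]
      _ ≤ 1 * (∑ i ∈ s, ‖f i - g i‖) + ‖f a - g a‖ * 1 := by
          gcongr
          exact hf a
      _ = _ := by ring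

lemma tsum_indicator_eq_encard {ι Ω : Type*} (Y : ι → Ω → ℝ) (A : Set ℝ) (ω : Ω) :
    ∑' i, A.indicator (1 : ℝ → ℝ≥0∞) (Y i ω) = ({i | Y i ω ∈ A}.encard : ℝ≥0∞) := by
  rw [← ENNReal.tsum_set_one, tsum_subtype {i | Y i ω ∈ A} fun _ => (1 : ℝ≥0∞)]
  rfl

section Poisson

variable {ι Ω : Type*} [Countable ι] [MeasurableSpace Ω] {Y : ι → Ω → ℝ} {Λ : Measure ℝ}
  {P : Measure Ω}

/-- The number of points in `A`. -/
def pointCount (Y : ι → Ω → ℝ) (A : Set ℝ) (ω : Ω) : ℕ := {i | Y i ω ∈ A}.ncard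

lemma measurableSet_encard_eq (hY : ∀ i, Measurable (Y i)) {A : Set ℝ} (hA : MeasurableSet A)
    (n : ℕ∞) : MeasurableSet {ω | {i | Y i ω ∈ A}.encard = n} := by
  have h : Measurable fun ω => ∑' i, A.indicator (1 : ℝ → ℝ≥0∞) (Y i ω) :=
    Measurable.tsum fun i => (measurable_one.indicator hA).comp (hY i)
  convert h (measurableSet_singleton (n : ℝ≥0∞)) using 1
  ext ω
  simp [tsum_indicator_eq_encard]

lemma measurable_pointCount (hY : ∀ i, Measurable (Y i)) {A : Set ℝ} (hA : MeasurableSet A) :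
    Measurable (pointCount Y A) := by
  refine measurable_to_countable' fun n => ?_
  -- `ncard` is 0 on infinite sets, so the fibre over 0 also contains the outcomes with infinitely
  -- many points.
  have : pointCount Y A ⁻¹' {n} = {ω | {i | Y i ω ∈ A}.encard = n} ∪
      {ω | {i | Y i ω ∈ A}.encard = ⊤ ∧ n = 0} := by
    ext ω
    simp only [pointCount, Set.ncard, Set.mem_preimage, Set.mem_singleton_iff, Set.mem_union,
      Set.mem_ofPred_eq]
    induction {i | Y i ω ∈ A}.encard using ENat.recTopCoe with
    | top => simp [eq_comm]
    | coe m => simp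
  rw [this]
  refine (measurableSet_encard_eq hY hA n).union ?_
  by_cases hn : n = 0
  · simpa [hn] using measurableSet_encard_eq hY hA ⊤
  · simp [hn]

lemma IsPoissonPointProcess.measure_encard_eq (h : IsPoissonPointProcess Y Λ P) {A : Set ℝ}
    (hA : MeasurableSet A) (hΛ : Λ A ≠ ∞) (n : ℕ) :
    P {ω | {i | Y i ω ∈ A}.encard = (n : ℕ∞)} = poissonMeasure (Λ A).toNNReal {n} := by
  have := h 1 (fun _ => A) (fun _ => n) (fun _ => hA) (fun _ => hΛ)
    (fun i j hij => absurd (Subsingleton.elim i j) hij)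
  simpa using this

/-- The probabilities of the finite values of the count already sum to 1, so nothing is left for the
value `⊤`. -/
lemma IsPoissonPointProcess.ae_finite [IsProbabilityMeasure P] (h : IsPoissonPointProcess Y Λ P)
    (hY : ∀ i, Measurable (Y i)) {A : Set ℝ} (hA : MeasurableSet A) (hΛ : Λ A ≠ ∞) :
    ∀ᵐ ω ∂P, {i | Y i ω ∈ A}.Finite := by
  have h1 : P (⋃ n : ℕ, {ω | {i | Y i ω ∈ A}.encard = (n : ℕ∞)}) = 1 := by
    rw [measure_iUnion]
    · simp_rw [h.measure_encard_eq hA hΛ]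
      rw [← measure_iUnion, Set.iUnion_of_singleton]
      · exact measure_univ
      · intro i j hij
        simpa using hij
      · exact fun i => measurableSet_singleton i
    · intro i j hij
      refine Set.disjoint_left.2 fun ω h1 h2 => hij ?_
      simp only [Set.mem_ofPred_eq] at h1 h2
      exact_mod_cast h1.symm.trans h2
    · exact fun n => measurableSet_encard_eq hY hA n
  have h2 := (prob_compl_eq_zero_iff
    (MeasurableSet.iUnion fun n : ℕ => measurableSet_encard_eq hY hA n)).2 h1
  filter_upwards [compl_mem_ae_iff.2 h2] with ω hω
  simp only [compl_compl, Set.mem_iUnion, Set.mem_ofPred_eq] at hω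
  obtain ⟨n, hn⟩ := hω
  exact Set.finite_of_encard_eq_coe hn

lemma lintegral_natCast_poissonMeasure (r : ℝ≥0) :
    ∫⁻ n, (n : ℝ≥0∞) ∂(poissonMeasure r) = r := by
  rw [lintegral_countable']
  rw [tsum_eq_zero_add' ENNReal.summable]
  simp only [Nat.cast_zero, zero_mul, zero_add]
  have : ∀ n : ℕ, ((n + 1 : ℕ) : ℝ≥0∞) * poissonMeasure r {n + 1} = r * poissonMeasure r {n} := by
    intro n
    rw [poissonMeasure_singleton, poissonMeasure_singleton, ← ENNReal.ofReal_natCast,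
      ← ENNReal.ofReal_coe_nnreal, ← ENNReal.ofReal_mul (by positivity),
      ← ENNReal.ofReal_mul (by positivity)]
    congr 1
    rw [Nat.factorial_succ]
    push_cast
    field_simp
    ring
  simp_rw [this]
  rw [ENNReal.tsum_mul_left]
  have h1 : ∑' n, poissonMeasure r {n} = 1 := by
    have := lintegral_countable' (μ := poissonMeasure r) (fun _ => 1)
    simpa using this.symm
  rw [h1, mul_one]

/-- The intensity measure of a Poisson point process is the mean number of its points. -/
lemma IsPoissonPointProcess.sum_map_eq [IsProbabilityMeasure P] [SigmaFinite Λ]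
    (h : IsPoissonPointProcess Y Λ P) (hY : ∀ i, Measurable (Y i)) :
    Measure.sum (fun i => P.map (Y i)) = Λ := by
  have key : ∀ A, MeasurableSet A → Λ A ≠ ∞ → Measure.sum (fun i => P.map (Y i)) A = Λ A := by
    intro A hA hΛ
    rw [Measure.sum_apply _ hA]
    have h1 : ∀ i, P.map (Y i) A = ∫⁻ ω, A.indicator (1 : ℝ → ℝ≥0∞) (Y i ω) ∂P := fun i => by
      rw [← lintegral_map (measurable_one.indicator hA) (hY i), lintegral_indicator_one hA]
    simp_rw [h1]
    rw [← lintegral_tsum (f := fun i ω => A.indicator (1 : ℝ → ℝ≥0∞) (Y i ω))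
      fun i => ((measurable_one.indicator hA).comp (hY i)).aemeasurable]
    have h2 : ∫⁻ ω, ∑' i, A.indicator (1 : ℝ → ℝ≥0∞) (Y i ω) ∂P =
        ∫⁻ ω, (pointCount Y A ω : ℝ≥0∞) ∂P := by
      refine lintegral_congr_ae ?_
      filter_upwards [h.ae_finite hY hA hΛ] with ω hω
      rw [tsum_indicator_eq_encard, pointCount, ← hω.cast_ncard_eq]
      rfl
    have h3 : P.map (pointCount Y A) = poissonMeasure (Λ A).toNNReal := by
      refine Measure.ext_of_singleton fun n => ?_
      rw [Measure.map_apply (measurable_pointCount hY hA) (measurableSet_singleton n),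
        ← h.measure_encard_eq hA hΛ]
      refine measure_congr ?_
      filter_upwards [h.ae_finite hY hA hΛ] with ω hω
      refine propext (?_ : pointCount Y A ω = n ↔ {i | Y i ω ∈ A}.encard = n)
      rw [pointCount, ← hω.cast_ncard_eq]
      norm_cast
    rw [h2, ← lintegral_map (f := fun n : ℕ => (n : ℝ≥0∞)) .of_discrete
      (measurable_pointCount hY hA), h3, lintegral_natCast_poissonMeasure,
      ENNReal.coe_toNNReal hΛ]
  ext B hB
  have hU : B = ⋃ n, B ∩ spanningSets Λ n := by
    rw [← Set.inter_iUnion, iUnion_spanningSets, Set.inter_univ]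
  have hm : Monotone fun n => B ∩ spanningSets Λ n := fun m n hmn =>
    Set.inter_subset_inter_right _ (monotone_spanningSets Λ hmn)
  rw [hU, hm.measure_iUnion, hm.measure_iUnion]
  congr 1
  ext n
  refine key _ (hB.inter (measurableSet_spanningSets Λ n)) ?_
  exact ((measure_mono Set.inter_subset_right).trans_lt (measure_spanningSets_lt_top Λ n)).ne

/-- Campbell's formula. -/
lemma IsPoissonPointProcess.tsum_lintegral [IsProbabilityMeasure P] [SigmaFinite Λ]
    (h : IsPoissonPointProcess Y Λ P) (hY : ∀ i, Measurable (Y i)) {g : ℝ → ℝ≥0∞}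
    (hg : Measurable g) : ∑' i, ∫⁻ ω, g (Y i ω) ∂P = ∫⁻ y, g y ∂Λ := by
  rw [← h.sum_map_eq hY, lintegral_sum_measure]
  congr 1
  ext i
  rw [lintegral_map hg (hY i)]

lemma IsPoissonPointProcess.map_pointCount [IsProbabilityMeasure P]
    (h : IsPoissonPointProcess Y Λ P) (hY : ∀ i, Measurable (Y i)) {k : ℕ} {A : Fin k → Set ℝ}
    (hA : ∀ j, MeasurableSet (A j)) (hΛ : ∀ j, Λ (A j) ≠ ∞)
    (hd : Pairwise (Function.onFun Disjoint A)) :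
    P.map (fun ω j => pointCount Y (A j) ω) =
      Measure.pi fun j => poissonMeasure (Λ (A j)).toNNReal := by
  refine Measure.ext_of_singleton fun n => ?_
  rw [Measure.map_apply (measurable_pi_lambda _ fun j => measurable_pointCount hY (hA j))
    (measurableSet_singleton n), Measure.pi_singleton, ← h k A n hA hΛ hd]
  refine measure_congr ?_
  have := ae_all_iff.2 fun j => h.ae_finite hY (hA j) (hΛ j)
  filter_upwards [this] with ω hω
  refine propext (?_ : (fun j => pointCount Y (A j) ω) = n ↔
    ∀ j, {i | Y i ω ∈ A j}.encard = (n j : ℕ∞))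
  rw [funext_iff]
  refine forall_congr' fun j => ?_
  rw [pointCount, ← (hω j).cast_ncard_eq]
  norm_cast

lemma integral_pow_poissonMeasure (r : ℝ≥0) (v : ℂ) :
    ∫ n, v ^ n ∂(poissonMeasure r) = Complex.exp (r * (v - 1)) := by
  rw [integral_poissonMeasure]
  calc ∑' n : ℕ, (Real.exp (-r) * r ^ n / n.factorial) • v ^ n
      = ∑' n : ℕ, (Real.exp (-r) : ℂ) * ((r * v) ^ n / n.factorial) := by
        congr with n
        rw [Complex.real_smul]
        push_cast
        ring
    _ = (Real.exp (-r) : ℂ) * Complex.exp (r * v) := by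
        rw [tsum_mul_left, (NormedSpace.expSeries_div_hasSum_exp (r * v : ℂ)).tsum_eq,
          Complex.exp_eq_exp_ℂ]
    _ = _ := by
        rw [Complex.ofReal_exp, ← Complex.exp_add]
        push_cast
        ring_nf

/-- Almost surely only finitely many points lie where `u ≠ 0`, so the partial products are
eventually `∏ (1 + v) ^ N_v`, where `N_v` counts the points with value `v`. These counts are
independent Poisson variables. The bound `‖1 + u‖ ≤ 1` dominates the limit over finite index sets.
-/
lemma IsPoissonPointProcess.tendsto_integral_prod_simpleFunc [IsProbabilityMeasure P]
    (h : IsPoissonPointProcess Y Λ P) (hY : ∀ i, Measurable (Y i)) (u : SimpleFunc ℝ ℂ)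
    (hu : Integrable u Λ) (hu1 : ∀ y, ‖1 + u y‖ ≤ 1) :
    Tendsto (fun s : Finset ι => ∫ ω, ∏ i ∈ s, (1 + u (Y i ω)) ∂P) atTop
      (𝓝 (Complex.exp (∫ y, u y ∂Λ))) := by
  classical
  set V : Finset ℂ := u.range.erase 0 with hV
  let e : Fin V.card ≃ V := V.equivFin.symm
  let A : Fin V.card → Set ℝ := fun j => u ⁻¹' {(e j : ℂ)}
  have hA : ∀ j, MeasurableSet (A j) := fun j => u.measurableSet_fiber _
  have hne : ∀ j, (e j : ℂ) ≠ 0 := fun j => (Finset.mem_erase.1 (e j).2).1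
  have hΛ : ∀ j, Λ (A j) ≠ ∞ := fun j =>
    (SimpleFunc.measure_preimage_lt_top_of_integrable u hu (hne j)).ne
  have hd : Pairwise (Function.onFun Disjoint A) := fun i j hij => by
    refine Set.disjoint_left.2 fun y h1 h2 => hij (e.injective (Subtype.ext ?_))
    simp only [A, Set.mem_preimage, Set.mem_singleton_iff] at h1 h2
    exact h1.symm.trans h2
  have hlim : ∀ᵐ ω ∂P, Tendsto (fun s : Finset ι => ∏ i ∈ s, (1 + u (Y i ω))) atTop
      (𝓝 (∏ j, (1 + (e j : ℂ)) ^ pointCount Y (A j) ω)) := by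
    filter_upwards [ae_all_iff.2 fun j => h.ae_finite hY (hA j) (hΛ j)] with ω hω
    have hfin : {i | u (Y i ω) ≠ 0}.Finite := by
      refine (Set.finite_iUnion hω).subset fun i hi => ?_
      have hm : u (Y i ω) ∈ V := Finset.mem_erase.2 ⟨hi, u.mem_range_self _⟩
      refine Set.mem_iUnion.2 ⟨e.symm ⟨_, hm⟩, ?_⟩
      simp [A]
    refine tendsto_const_nhds.congr' ?_
    filter_upwards [eventually_ge_atTop hfin.toFinset] with s hs
    have h1 : ∏ i ∈ s, (1 + u (Y i ω)) = ∏ i ∈ hfin.toFinset, (1 + u (Y i ω)) := by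
      refine (Finset.prod_subset hs fun i _ hi => ?_).symm
      simp only [Set.Finite.mem_toFinset, Set.mem_ofPred_eq, not_not] at hi
      simp [hi]
    rw [h1, ← Finset.prod_fiberwise_of_maps_to (t := V) (g := fun i => u (Y i ω))
      (fun i hi => Finset.mem_erase.2 ⟨by simpa using hi, u.mem_range_self _⟩),
      ← Finset.prod_coe_sort V, ← e.prod_comp]
    refine Finset.prod_congr rfl fun j _ => ?_
    rw [Finset.prod_congr rfl (g := fun _ => 1 + (e j : ℂ))
      (fun i hi => by rw [(Finset.mem_filter.1 hi).2]), Finset.prod_const]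
    congr 1
    rw [pointCount, ← Set.ncard_coe_finset]
    congr 1
    ext i
    simp only [A, Set.mem_ofPred_eq, Set.mem_preimage, Set.mem_singleton_iff, Finset.coe_filter,
      Set.Finite.mem_toFinset]
    exact ⟨fun h => ⟨by rw [h]; exact hne j, h⟩, fun h => h.2⟩
  have hint : ∫ ω, ∏ j, (1 + (e j : ℂ)) ^ pointCount Y (A j) ω ∂P =
      Complex.exp (∫ y, u y ∂Λ) := by
    rw [← integral_map (f := fun n : Fin V.card → ℕ => ∏ j, (1 + (e j : ℂ)) ^ n j)
      (φ := fun ω j => pointCount Y (A j) ω)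
      (measurable_pi_lambda _ fun j => measurable_pointCount hY (hA j)).aemeasurable
      (Measurable.of_discrete.aestronglyMeasurable),
      h.map_pointCount hY hA hΛ hd, integral_fintype_prod_eq_prod
      (f := fun (j : Fin V.card) (n : ℕ) => (1 + (e j : ℂ)) ^ n)]
    simp_rw [integral_pow_poissonMeasure]
    rw [← Complex.exp_sum, SimpleFunc.integral_eq_sum u hu]
    congr 1
    have h0 : ∑ x ∈ u.range, Λ.real (u ⁻¹' {x}) • x = ∑ x ∈ V, Λ.real (u ⁻¹' {x}) • x := by
      refine (Finset.sum_subset (Finset.erase_subset _ _) fun x hx hx' => ?_).symm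
      have : x = 0 := by
        by_contra h0
        exact hx' (Finset.mem_erase.2 ⟨h0, hx⟩)
      simp [this]
    rw [h0, ← Finset.sum_coe_sort V, ← e.sum_comp]
    refine Finset.sum_congr rfl fun j _ => ?_
    rw [Complex.real_smul]
    simp only [add_sub_cancel_left]
    rfl
  rw [← hint]
  refine tendsto_integral_filter_of_dominated_convergence (fun _ => 1) ?_ ?_
    (integrable_const _) hlim
  · refine Eventually.of_forall fun s => Measurable.aestronglyMeasurable ?_
    exact Finset.measurable_fun_prod _ fun i _ =>
      measurable_const.add (u.measurable.comp (hY i))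
  · refine Eventually.of_forall fun s => Eventually.of_forall fun ω => ?_
    rw [norm_prod]
    exact Finset.prod_le_one (fun _ _ => norm_nonneg _) fun i _ => hu1 _

/-- The generating functional of a Poisson point process. -/
theorem IsPoissonPointProcess.tendsto_integral_prod [IsProbabilityMeasure P] [SigmaFinite Λ]
    (h : IsPoissonPointProcess Y Λ P) (hY : ∀ i, Measurable (Y i)) {u : ℝ → ℂ}
    (hum : Measurable u) (hu : Integrable u Λ) (hu1 : ∀ y, ‖1 + u y‖ ≤ 1) :
    Tendsto (fun s : Finset ι => ∫ ω, ∏ i ∈ s, (1 + u (Y i ω)) ∂P) atTop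
      (𝓝 (Complex.exp (∫ y, u y ∂Λ))) := by
  -- The simple approximations take their values in `D`, so all products stay in the unit disc and
  -- no bound is lost.
  set D : Set ℂ := {w | ‖1 + w‖ ≤ 1}
  have h0 : (0 : ℂ) ∈ D := by simp [D]
  let U : ℕ → SimpleFunc ℝ ℂ := SimpleFunc.approxOn u hum D 0 h0
  have hU1 : ∀ n y, ‖1 + U n y‖ ≤ 1 := fun n y => SimpleFunc.approxOn_mem hum h0 n y
  have hUi : ∀ n, Integrable (U n) Λ := fun n =>
    SimpleFunc.integrable_approxOn hum hu h0 (integrable_zero _ _ _) n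
  have hL1 : Tendsto (fun n => ∫⁻ y, ‖U n y - u y‖ₑ ∂Λ) atTop (𝓝 0) :=
    SimpleFunc.tendsto_approxOn_L1_enorm hum h0
      (Eventually.of_forall fun y => subset_closure (hu1 y)) (by simpa using hu.2)
  have hlim : Tendsto (fun n => Complex.exp (∫ y, U n y ∂Λ)) atTop
      (𝓝 (Complex.exp (∫ y, u y ∂Λ))) :=
    (Complex.continuous_exp.tendsto _).comp
      (tendsto_integral_of_L1 _ hum.aestronglyMeasurable (Eventually.of_forall hUi) hL1)
  have hbd : ∀ {v : ℝ → ℂ}, (∀ y, ‖1 + v y‖ ≤ 1) → Measurable v → ∀ s : Finset ι,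
      Integrable (fun ω => ∏ i ∈ s, (1 + v (Y i ω))) P := fun {v} hv hvm s => by
    refine Integrable.of_bound (C := 1) (Measurable.aestronglyMeasurable ?_)
      (Eventually.of_forall fun ω => ?_)
    · exact Finset.measurable_fun_prod _ fun i _ => measurable_const.add (hvm.comp (hY i))
    · rw [norm_prod]
      exact Finset.prod_le_one (fun _ _ => norm_nonneg _) fun i _ => hv _
  have hdiff : ∀ n, ∀ s : Finset ι, ENNReal.ofReal ‖∫ ω, ∏ i ∈ s, (1 + u (Y i ω)) ∂P -
      ∫ ω, ∏ i ∈ s, (1 + U n (Y i ω)) ∂P‖ ≤ ∫⁻ y, ‖U n y - u y‖ₑ ∂Λ := fun n s => by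
    rw [← integral_sub (hbd hu1 hum s) (hbd (hU1 n) (U n).measurable s), ofReal_norm]
    have hm : Measurable fun y => ‖U n y - u y‖ₑ := ((U n).measurable.sub hum).enorm
    calc ‖∫ ω, (∏ i ∈ s, (1 + u (Y i ω)) - ∏ i ∈ s, (1 + U n (Y i ω))) ∂P‖ₑ
        ≤ ∫⁻ ω, ‖∏ i ∈ s, (1 + u (Y i ω)) - ∏ i ∈ s, (1 + U n (Y i ω))‖ₑ ∂P :=
          enorm_integral_le_lintegral_enorm _
      _ ≤ ∫⁻ ω, ∑ i ∈ s, ‖U n (Y i ω) - u (Y i ω)‖ₑ ∂P := by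
          refine lintegral_mono fun ω => ?_
          rw [← ofReal_norm]
          simp_rw [← ofReal_norm]
          rw [← ENNReal.ofReal_sum_of_nonneg fun _ _ => norm_nonneg _]
          refine ENNReal.ofReal_le_ofReal
            ((norm_prod_sub_prod_le s _ _ (fun i => hu1 _) fun i => hU1 n _).trans_eq ?_)
          refine Finset.sum_congr rfl fun i _ => ?_
          rw [add_sub_add_left_eq_sub, norm_sub_rev]
      _ = ∑ i ∈ s, ∫⁻ ω, ‖U n (Y i ω) - u (Y i ω)‖ₑ ∂P :=
          lintegral_finsetSum _ fun i _ => hm.comp (hY i)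
      _ ≤ ∑' i, ∫⁻ ω, ‖U n (Y i ω) - u (Y i ω)‖ₑ ∂P := ENNReal.sum_le_tsum _
      _ = _ := h.tsum_lintegral hY hm
  -- The estimate `hdiff` does not depend on the finite set `s`; this uniformity permits exchanging
  -- the limit in `n` with the limit over `s`.
  have hunif : TendstoUniformly (fun n (s : Finset ι) => ∫ ω, ∏ i ∈ s, (1 + U n (Y i ω)) ∂P)
      (fun s => ∫ ω, ∏ i ∈ s, (1 + u (Y i ω)) ∂P) atTop := by
    rw [Metric.tendstoUniformly_iff]
    intro ε hε
    filter_upwards [hL1.eventually (gt_mem_nhds (ENNReal.ofReal_pos.2 hε))] with n hn s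
    rw [dist_eq_norm]
    exact (ENNReal.ofReal_lt_ofReal_iff hε).1 ((hdiff n s).trans_lt hn)
  exact hunif.tendsto_of_eventually_tendsto
    (Eventually.of_forall fun n => h.tendsto_integral_prod_simpleFunc hY (U n) (hUi n) (hU1 n))
    hlim

end Poisson

/-! ### The maximal inequality for Brownian motion -/

section Maximal

variable {Ω : Type*} [MeasurableSpace Ω] {P : Measure Ω} {B : ℝ≥0 → Ω → ℝ}

/-- The filtration generated by `B` along the times `τ 0 ≤ τ 1 ≤ ⋯`. -/
def sampledFiltration (hBm : ∀ t, Measurable (B t)) {τ : ℕ → ℝ≥0} (hτ : Monotone τ) :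
    Filtration ℕ (inferInstance : MeasurableSpace Ω) where
  seq k := MeasurableSpace.comap (fun ω (s : Set.Iic (τ k)) => B s ω) MeasurableSpace.pi
  mono' i j hij := by
    have h : Measurable fun (x : Set.Iic (τ j) → ℝ) (s : Set.Iic (τ i)) =>
        x ⟨s, s.2.trans (hτ hij)⟩ := measurable_pi_lambda _ fun s => measurable_pi_apply _
    intro s hs
    obtain ⟨S, hS, rfl⟩ := hs
    exact ⟨_, h hS, rfl⟩
  le' k := (measurable_pi_lambda _ fun s : Set.Iic (τ k) => hBm s).comap_le

/-- The next square is the present one plus a cross term plus the square of the increment. The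
increment is centred and independent of the whole past, so the cross term integrates to zero over
every past event. -/
lemma submartingale_sq [IsProbabilityMeasure P] (hB : IsPreBrownianReal B P)
    (hBm : ∀ t, Measurable (B t)) {τ : ℕ → ℝ≥0} (hτ : Monotone τ) :
    Submartingale (fun k ω => B (τ k) ω ^ 2) (sampledFiltration hBm hτ) P := by
  have hL2 : ∀ t, MemLp (B t) 2 P := fun t =>
    (hB.isGaussianProcess.hasGaussianLaw_eval t).memLp_two
  refine submartingale_of_setIntegral_le_succ (fun k => ?_) (fun k => (hL2 _).integrable_sq) ?_
  · refine Measurable.stronglyMeasurable (Measurable.pow_const ?_ 2)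
    have h : Measurable fun x : Set.Iic (τ k) → ℝ => x ⟨τ k, le_refl (τ k)⟩ :=
      measurable_pi_apply (⟨τ k, le_refl (τ k)⟩ : Set.Iic (τ k))
    exact h.comp (comap_measurable _)
  · rintro k s ⟨S, hS, rfl⟩
    set D : Ω → ℝ := fun ω => B (τ k + (τ (k + 1) - τ k)) ω - B (τ k) ω with hD
    set F : Ω → Set.Iic (τ k) → ℝ := fun ω s => B s ω with hF
    have hFm : Measurable F := measurable_pi_lambda _ fun s => hBm s
    have hadd : τ k + (τ (k + 1) - τ k) = τ (k + 1) := add_tsub_cancel_of_le (hτ k.le_succ)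
    have hDL : MemLp D 2 P := (hL2 _).sub (hL2 _)
    have hind : IndepFun D (fun ω => (F ⁻¹' S).indicator (B (τ k)) ω) P := by
      have hφ : Measurable fun x : ℝ≥0 → ℝ => x (τ (k + 1) - τ k) := measurable_pi_apply _
      have hψ : Measurable fun x : Set.Iic (τ k) → ℝ => x ⟨τ k, le_refl (τ k)⟩ :=
        measurable_pi_apply _
      exact (hB.indepFun_shift (τ k)).comp hφ (hψ.indicator hS)
    have hI : Integrable ((F ⁻¹' S).indicator (B (τ k))) P :=
      ((hL2 _).integrable one_le_two).indicator (hFm hS)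
    have hprod : ∫ ω in F ⁻¹' S, B (τ k) ω * D ω ∂P = 0 := by
      rw [← integral_indicator (hFm hS)]
      have h2 := hind.integral_fun_mul_eq_mul_integral hDL.1 hI.1
      have h3 : ∫ ω, D ω ∂P = 0 := by
        simp only [hD]
        rw [integral_sub (hB.integrable_eval _) (hB.integrable_eval _), hB.integral_eval,
          hB.integral_eval, sub_zero]
      rw [h3, zero_mul] at h2
      rw [← h2]
      congr with ω
      by_cases hω : ω ∈ F ⁻¹' S <;> simp [hω, mul_comm]
    have hexp : ∀ ω, B (τ (k + 1)) ω ^ 2 = B (τ k) ω ^ 2 + (2 * (B (τ k) ω * D ω) + D ω ^ 2) := by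
      intro ω
      simp only [hD, hadd]
      ring
    simp_rw [hexp]
    have i1 : Integrable (fun ω => B (τ k) ω ^ 2) P := (hL2 _).integrable_sq
    have i2 : Integrable (fun ω => B (τ k) ω * D ω) P := (hL2 _).integrable_mul hDL
    have i3 : Integrable (fun ω => D ω ^ 2) P := hDL.integrable_sq
    have i4 : Integrable (fun ω => 2 * (B (τ k) ω * D ω) + D ω ^ 2) P := (i2.const_mul 2).add i3
    rw [integral_add i1.integrableOn i4.integrableOn,
      integral_add (i2.const_mul 2).integrableOn i3.integrableOn, integral_const_mul, hprod]
    have : 0 ≤ ∫ ω in F ⁻¹' S, D ω ^ 2 ∂P := integral_nonneg fun ω => sq_nonneg _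
    linarith

/-- Doob's maximal inequality for `B ^ 2`, with `E[B (τ n) ^ 2] = τ n`. The quadratic decay in `a`
suffices, being integrable at infinity in one dimension. -/
lemma measure_exists_le_abs_le [IsProbabilityMeasure P] (hB : IsPreBrownianReal B P)
    (hBm : ∀ t, Measurable (B t)) {τ : ℕ → ℝ≥0} (hτ : Monotone τ) (n : ℕ) {a : ℝ} (ha : 0 < a) :
    P {ω | ∃ k ≤ n, a < |B (τ k) ω|} ≤ ENNReal.ofReal (τ n / a ^ 2) := by
  have h1 := maximal_ineq (submartingale_sq hB hBm hτ) (fun k ω => sq_nonneg _)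
    (ε := (⟨a ^ 2, sq_nonneg a⟩ : ℝ≥0)) n
  set S := {ω | ((⟨a ^ 2, sq_nonneg a⟩ : ℝ≥0) : ℝ) ≤
    (Finset.range (n + 1)).sup' Finset.nonempty_range_add_one fun k => B (τ k) ω ^ 2} with hS
  have hsub : {ω | ∃ k ≤ n, a < |B (τ k) ω|} ⊆ S := by
    rintro ω ⟨k, hk, hka⟩
    have h2 : a ^ 2 ≤ B (τ k) ω ^ 2 := by
      rw [← sq_abs (B (τ k) ω)]
      exact pow_le_pow_left₀ ha.le hka.le 2
    exact h2.trans (Finset.le_sup' (fun k => B (τ k) ω ^ 2) (Finset.mem_range.2 (by omega)))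
  have hL2 : MemLp (B (τ n)) 2 P := (hB.isGaussianProcess.hasGaussianLaw_eval _).memLp_two
  have hint : ∫ ω in S, B (τ n) ω ^ 2 ∂P ≤ τ n := by
    refine (setIntegral_le_integral hL2.integrable_sq
      (Eventually.of_forall fun ω => sq_nonneg _)).trans_eq ?_
    have h3 := hB.covariance_eval (τ n) (τ n)
    rw [covariance_self (hB.aemeasurable _), variance_eq_sub hL2, hB.integral_eval] at h3
    simpa using h3
  have ha2 : (0 : ℝ) < a ^ 2 := by positivity
  have h4 : ENNReal.ofReal (a ^ 2) * P S ≤ ENNReal.ofReal (τ n) := by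
    refine le_trans ?_ (h1.trans (ENNReal.ofReal_le_ofReal hint))
    rw [ENNReal.ofReal_eq_coe_nnreal (sq_nonneg a)]
    exact le_rfl
  calc P {ω | ∃ k ≤ n, a < |B (τ k) ω|} ≤ P S := measure_mono hsub
    _ ≤ ENNReal.ofReal (τ n) / ENNReal.ofReal (a ^ 2) := by
        rw [ENNReal.le_div_iff_mul_le (Or.inl (by simpa using ha.ne')) (Or.inl (by simp)),
          mul_comm]
        exact h4
    _ = _ := (ENNReal.ofReal_div_of_pos ha2).symm

/-- The supremum of `|B|` over the dyadic times of `[0, t]`. -/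
def dyadicSup (B : ℝ≥0 → Ω → ℝ) (t : ℝ≥0) (ω : Ω) : ℝ≥0∞ :=
  ⨆ n : ℕ, ⨆ k : ℕ, ⨆ _ : k ≤ 2 ^ n, ‖B (k * (t / 2 ^ n)) ω‖ₑ

lemma measurable_dyadicSup (hBm : ∀ t, Measurable (B t)) (t : ℝ≥0) :
    Measurable (dyadicSup B t) :=
  Measurable.iSup fun _ => Measurable.iSup fun _ => Measurable.iSup fun _ => (hBm _).enorm

/-- The bound on each dyadic grid depends only on its last time `t`, and the events increase as the
grids refine, so it passes to their union. -/
lemma measure_lt_dyadicSup_le [IsProbabilityMeasure P] (hB : IsPreBrownianReal B P)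
    (hBm : ∀ t, Measurable (B t)) (t : ℝ≥0) {a : ℝ} (ha : 0 < a) :
    P {ω | ENNReal.ofReal a < dyadicSup B t ω} ≤ ENNReal.ofReal (t / a ^ 2) := by
  have h1 : {ω | ENNReal.ofReal a < dyadicSup B t ω} =
      ⋃ n : ℕ, {ω | ∃ k : ℕ, k ≤ 2 ^ n ∧ a < |B (k * (t / 2 ^ n)) ω|} := by
    ext ω
    simp only [dyadicSup, lt_iSup_iff, Set.mem_ofPred_eq, Set.mem_iUnion, exists_prop,
      Real.enorm_eq_ofReal_abs, ENNReal.ofReal_lt_ofReal_iff']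
    refine exists_congr fun n => exists_congr fun k => and_congr_right fun _ =>
      ⟨fun h => h.1, fun h => ⟨h, ha.trans h⟩⟩
  have hmono : Monotone fun n : ℕ => {ω | ∃ k : ℕ, k ≤ 2 ^ n ∧ a < |B (k * (t / 2 ^ n)) ω|} := by
    refine monotone_nat_of_le_succ fun n ω => ?_
    rintro ⟨k, hk, hka⟩
    refine ⟨2 * k, by rw [pow_succ]; omega, ?_⟩
    have h2 : ((2 * k : ℕ) : ℝ≥0) * (t / 2 ^ (n + 1)) = k * (t / 2 ^ n) := by
      push_cast
      rw [pow_succ]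
      field_simp
    rwa [h2]
  rw [h1, hmono.measure_iUnion]
  refine iSup_le fun n => ?_
  have hτ : Monotone fun k : ℕ => (k : ℝ≥0) * (t / 2 ^ n) := fun i j hij => by
    have : (i : ℝ≥0) ≤ j := by exact_mod_cast hij
    exact mul_le_mul_left this _
  refine (measure_exists_le_abs_le hB hBm hτ (2 ^ n) ha).trans_eq ?_
  congr 2
  push_cast
  field_simp

/-- The grid points `⌊2 ^ n s / t⌋ t / 2 ^ n` converge to `s`, and the path is continuous.
Continuity enters only here, so the measurability of `dyadicSup` does not depend on it. -/
lemma enorm_le_dyadicSup {ω : Ω} (hc : Continuous fun s => B s ω) {s t : ℝ≥0} (hs : s ≤ t) :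
    ‖B s ω‖ₑ ≤ dyadicSup B t ω := by
  rcases eq_or_ne t 0 with rfl | ht
  · obtain rfl : s = 0 := le_antisymm hs zero_le
    refine le_trans ?_ (le_iSup _ 0)
    refine le_trans ?_ (le_iSup₂ (f := fun (k : ℕ) (_ : k ≤ 2 ^ 0) =>
      ‖B (k * (0 / 2 ^ 0)) ω‖ₑ) 0 (by simp))
    simp
  have ht' : 0 < t := pos_of_ne_zero ht
  have hlim : Tendsto (fun n : ℕ => ((⌊s / t * 2 ^ n⌋₊ : ℕ) : ℝ≥0) * (t / 2 ^ n)) atTop (𝓝 s) := by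
    have h2 : Tendsto (fun n : ℕ => (2 : ℝ) ^ n) atTop atTop :=
      tendsto_pow_atTop_atTop_of_one_lt one_lt_two
    have h3 := (tendsto_nat_floor_mul_div_atTop (R := ℝ) (a := ((s / t : ℝ≥0) : ℝ))
      (NNReal.coe_nonneg _)).comp h2
    have h4 := h3.mul_const (t : ℝ)
    rw [← NNReal.coe_mul, div_mul_cancel₀ _ ht] at h4
    rw [← NNReal.tendsto_coe]
    refine h4.congr fun n => ?_
    have h5 : ⌊s / t * 2 ^ n⌋₊ = ⌊((s / t : ℝ≥0) : ℝ) * 2 ^ n⌋₊ := by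
      refine (Nat.floor_eq_iff zero_le).2 ⟨?_, ?_⟩
      · rw [← NNReal.coe_le_coe]
        push_cast
        exact Nat.floor_le (by positivity)
      · rw [← NNReal.coe_lt_coe]
        push_cast
        exact Nat.lt_floor_add_one _
    rw [h5]
    simp only [Function.comp_apply]
    push_cast
    ring
  refine le_of_tendsto ((hc.tendsto s).comp hlim).enorm (Eventually.of_forall fun n => ?_)
  refine le_trans ?_ (le_iSup _ n)
  refine le_iSup₂ (f := fun (k : ℕ) (_ : k ≤ 2 ^ n) => ‖B (k * (t / 2 ^ n)) ω‖ₑ)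
    ⌊s / t * 2 ^ n⌋₊ ?_
  have : s / t * 2 ^ n ≤ ((2 ^ n : ℕ) : ℝ≥0) := by
    push_cast
    exact mul_le_of_le_one_left zero_le ((div_le_one₀ ht').2 hs)
  exact Nat.floor_le_of_le this

end Maximal

/-! ### The free system is locally finite, uniformly on bounded time intervals -/

section Proper

variable {Ω : Type*} [MeasurableSpace Ω] {P : Measure Ω} {ρ σ : ℝ} {Y : ℤ → Ω → ℝ}
  {B X : ℤ → ℝ≥0 → Ω → ℝ}

/-- Countably many bounded windows each contain finitely many points almost surely; the ranking then
converts finiteness into divergence to `±∞` in the right directions. -/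
lemma IsEquilibriumState.ae_properSeq [IsProbabilityMeasure P] (h : IsEquilibriumState ρ Y P) :
    ∀ᵐ ω ∂P, ProperSeq fun j => Y j ω := by
  have hf : ∀ᵐ ω ∂P, ∀ n : ℕ, {i : {i : ℤ // i ≠ 0} | Y i ω ∈ Set.Icc (-n : ℝ) n}.Finite :=
    ae_all_iff.2 fun n => h.poisson.ae_finite (fun i => h.measurable i) measurableSet_Icc
      (by simp only [Measure.smul_apply, Real.volume_Icc, smul_eq_mul]
          exact ENNReal.mul_ne_top ENNReal.ofReal_ne_top ENNReal.ofReal_ne_top)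
  filter_upwards [hf, h.ranked] with ω h1 h2
  have hfin : ∀ n : ℕ, {j : ℤ | Y j ω ∈ Set.Icc (-n : ℝ) n}.Finite := fun n => by
    refine (((h1 n).image Subtype.val).union (Set.finite_singleton (0 : ℤ))).subset fun j hj => ?_
    rcases eq_or_ne j 0 with rfl | hj0
    · exact Or.inr rfl
    · exact Or.inl ⟨⟨j, hj0⟩, hj, rfl⟩
  intro r
  obtain ⟨n, hn⟩ := exists_nat_gt (max |r| |Y 0 ω|)
  have hr := abs_lt.1 ((le_max_left _ _).trans_lt hn)
  have hY := abs_lt.1 ((le_max_right _ _).trans_lt hn)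
  obtain ⟨N, hN⟩ : ∃ N : ℤ, ∀ j ∈ {j : ℤ | Y j ω ∈ Set.Icc (-n : ℝ) n}, |j| < N := by
    obtain ⟨N, hN⟩ := ((hfin n).image fun j : ℤ => |j|).bddAbove
    exact ⟨N + 1, fun j hj => Int.lt_add_one_of_le (hN ⟨j, hj, rfl⟩)⟩
  have hN0 : 0 < N := by
    have := hN 0 ⟨hY.1.le, hY.2.le⟩
    simpa using this
  refine ⟨N, fun j => ⟨fun hj => ?_, fun hj => ?_⟩⟩
  · by_contra! hc
    have h0 : Y 0 ω ≤ Y j ω := h2.monotone (by omega : (0 : ℤ) ≤ j)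
    have := hN j ⟨by linarith, by linarith⟩
    rw [abs_of_nonneg (by omega)] at this
    omega
  · by_contra! hc
    have h0 : Y j ω ≤ Y 0 ω := h2.monotone (by omega : j ≤ (0 : ℤ))
    have := hN j ⟨by linarith, by linarith⟩
    rw [abs_of_nonpos (by omega)] at this
    omega

lemma lintegral_min_one_div_sq_lt_top (C : ℝ) {g : ℝ → ℝ≥0∞} (h1 : ∀ y, g y ≤ 1)
    (h2 : ∀ y, y ≠ 0 → g y ≤ ENNReal.ofReal (C / y ^ 2)) : ∫⁻ y, g y < ∞ := by
  have hi : Integrable fun y : ℝ => (2 * (1 + |C|)) * (1 + y ^ 2)⁻¹ :=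
    integrable_inv_one_add_sq.const_mul _
  refine lt_of_le_of_lt (lintegral_mono fun y => ?_) hi.lintegral_lt_top
  have hC := abs_nonneg C
  have hp : 0 < 1 + y ^ 2 := by positivity
  rcases le_or_gt (y ^ 2) 1 with hy | hy
  · refine (h1 y).trans ?_
    rw [← ENNReal.ofReal_one]
    refine ENNReal.ofReal_le_ofReal ?_
    rw [← div_eq_mul_inv, le_div_iff₀ hp]
    nlinarith
  · have hy0 : y ≠ 0 := by rintro rfl; norm_num at hy
    refine (h2 y hy0).trans (ENNReal.ofReal_le_ofReal ?_)
    rw [← div_eq_mul_inv, div_le_div_iff₀ (by positivity) hp]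
    nlinarith [le_abs_self C, mul_nonneg hC (sq_nonneg y)]

/-- Borel-Cantelli. By the maximal inequality a particle starting at `y` travels a distance
comparable to `|y|` with probability `O(y⁻²)`, and Campbell's formula turns the sum of these
probabilities into a finite integral. The particle of index 0 is not part of the Poisson process and
is added by hand. -/
lemma IsAnnealedSingleFile.ae_finite_lt_dyadicSup [IsProbabilityMeasure P]
    (h : IsAnnealedSingleFile ρ σ Y B X P) (t : ℝ≥0) (c : ℝ) :
    ∀ᵐ ω ∂P, {j : ℤ | ENNReal.ofReal |Y j ω| < ENNReal.ofReal c * dyadicSup (B j) t ω}.Finite := by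
  let S : ℤ → Set Ω := fun j =>
    {ω | ENNReal.ofReal |Y j ω| < ENNReal.ofReal c * dyadicSup (B j) t ω}
  let g : ℤ → ℝ → ℝ≥0∞ := fun j y =>
    P {ω | ENNReal.ofReal |y| < ENNReal.ofReal c * dyadicSup (B j) t ω}
  have hM : ∀ j, Measurable (dyadicSup (B j) t) := fun j =>
    measurable_dyadicSup (h.measurable_noise j) t
  have hg1 : ∀ j y, g j y ≤ 1 := fun j y => prob_le_one
  have hg2 : ∀ j y, y ≠ 0 → g j y ≤ ENNReal.ofReal (t * c ^ 2 / y ^ 2) := by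
    intro j y hy
    rcases le_or_gt c 0 with hc | hc
    · simp [g, ENNReal.ofReal_of_nonpos hc]
    have := measure_lt_dyadicSup_le (h.brownian j).toIsPreBrownianReal (h.measurable_noise j) t
      (a := |y| / c) (by positivity)
    convert this using 2
    · ext ω
      simp only [Set.mem_ofPred_eq]
      rw [ENNReal.ofReal_div_of_pos hc, ENNReal.div_lt_iff (Or.inl (by simpa using hc))
        (Or.inl (by simp)), mul_comm]
    · rw [div_pow, sq_abs]
      field_simp
  have hjm : MeasurableSet {p : ℝ × ℝ≥0∞ | ENNReal.ofReal |p.1| < ENNReal.ofReal c * p.2} :=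
    measurableSet_lt (by fun_prop) (by fun_prop)
  have hS : ∀ j, P (S j) = ∫⁻ ω, g j (Y j ω) ∂P := by
    intro j
    have hind : IndepFun (Y j) (dyadicSup (B j) t) P := by
      have hφ : Measurable fun y : ℤ → ℝ => y j := measurable_pi_apply j
      have hψ : Measurable fun b : ℤ → ℝ≥0 → ℝ =>
          dyadicSup (fun s (b : ℤ → ℝ≥0 → ℝ) => b j s) t b :=
        measurable_dyadicSup (fun s => (measurable_pi_apply s).comp (measurable_pi_apply j)) t
      exact h.indep_initial.comp hφ hψ
    have h2 := (indepFun_iff_map_prod_eq_prod_map_map (h.initial.measurable j).aemeasurable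
      (hM j).aemeasurable).1 hind
    have h3 : P (S j) = P.map (fun ω => (Y j ω, dyadicSup (B j) t ω))
        {p : ℝ × ℝ≥0∞ | ENNReal.ofReal |p.1| < ENNReal.ofReal c * p.2} := by
      rw [Measure.map_apply ((h.initial.measurable j).prodMk (hM j)) hjm]
      rfl
    rw [h3, h2, Measure.prod_apply hjm, lintegral_map (measurable_measure_prodMk_left hjm)
      (h.initial.measurable j)]
    refine lintegral_congr fun ω => ?_
    rw [Measure.map_apply (hM j) (measurable_prodMk_left hjm)]
    rfl
  -- A majorant common to all indices, as Campbell's formula requires a single function. At `y = 0`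
  -- the quotient is 0 by convention and would not majorize, hence the value 1.
  let G : ℝ → ℝ≥0∞ := fun y => min 1 (if y = 0 then 1 else ENNReal.ofReal (t * c ^ 2 / y ^ 2))
  have hGm : Measurable G := by
    refine measurable_const.min (Measurable.ite (measurableSet_singleton 0) measurable_const ?_)
    fun_prop
  have hgG : ∀ j y, g j y ≤ G y := fun j y => by
    refine le_min (hg1 j y) ?_
    split_ifs with hy
    · exact hg1 j y
    · exact hg2 j y hy
  have hGfin : ∫⁻ y, G y < ∞ := lintegral_min_one_div_sq_lt_top (t * c ^ 2)
    (fun y => min_le_left _ _) fun y hy => (min_le_right _ _).trans (by simp [hy])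
  have hsum : ∑' i : {i : ℤ // i ≠ 0}, P (S i) ≠ ∞ := by
    refine ne_of_lt (lt_of_le_of_lt (ENNReal.tsum_le_tsum fun i : {i : ℤ // i ≠ 0} =>
      (hS i).le.trans (lintegral_mono fun ω => hgG i (Y i ω))) ?_)
    have : SigmaFinite (ENNReal.ofReal ρ • (volume : Measure ℝ)) :=
      inferInstanceAs (SigmaFinite (ρ.toNNReal • (volume : Measure ℝ)))
    rw [h.initial.poisson.tsum_lintegral (fun i => h.initial.measurable i) hGm,
      lintegral_smul_measure]
    exact ENNReal.mul_lt_top ENNReal.ofReal_lt_top hGfin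
  filter_upwards [ae_finite_setOfPred_mem hsum] with ω hω
  refine ((hω.image Subtype.val).union (Set.finite_singleton (0 : ℤ))).subset fun j hj => ?_
  rcases eq_or_ne j 0 with rfl | hj0
  · exact Or.inr rfl
  · exact Or.inl ⟨⟨j, hj0⟩, hj, rfl⟩

lemma IsAnnealedSingleFile.ae_continuous [IsProbabilityMeasure P]
    (h : IsAnnealedSingleFile ρ σ Y B X P) :
    ∀ᵐ ω ∂P, ∀ j, Continuous fun s => B j s ω :=
  ae_all_iff.2 fun j => (h.brownian j).cont

lemma IsAnnealedSingleFile.ae_properUpTo [IsProbabilityMeasure P]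
    (h : IsAnnealedSingleFile ρ σ Y B X P) (t : ℝ≥0) :
    ∀ᵐ ω ∂P, ProperUpTo (fun j s => Y j ω + σ / √2 * B j s ω) t := by
  set c : ℝ := |σ / √2| with hc
  have hc0 : 0 ≤ c := abs_nonneg _
  -- The factor 2 ensures that all but finitely many particles move by at most half of their initial
  -- distance to the origin, so they remain far away and on their side.
  filter_upwards [h.ae_continuous, h.ae_finite_lt_dyadicSup t (2 * c),
    h.initial.ae_properSeq] with ω h1 h2 h3 r
  obtain ⟨N, hN⟩ : ∃ N : ℤ, ∀ j : ℤ,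
      ENNReal.ofReal |Y j ω| < ENNReal.ofReal (2 * c) * dyadicSup (B j) t ω → |j| < N := by
    obtain ⟨N, hN⟩ := (h2.image fun j : ℤ => |j|).bddAbove
    exact ⟨N + 1, fun j hj => Int.lt_add_one_of_le (hN ⟨j, hj, rfl⟩)⟩
  have hhalf : ∀ j : ℤ, N ≤ |j| → ∀ s ≤ t, |σ / √2 * B j s ω| ≤ |Y j ω| / 2 := by
    intro j hj s hs
    have h4 : ENNReal.ofReal (2 * c) * dyadicSup (B j) t ω ≤ ENNReal.ofReal |Y j ω| := by
      by_contra! hcon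
      exact absurd (hN j hcon) (not_lt.2 hj)
    have h5 : ENNReal.ofReal (2 * c * |B j s ω|) ≤ ENNReal.ofReal |Y j ω| := by
      rw [ENNReal.ofReal_mul (by positivity), ← Real.enorm_eq_ofReal_abs]
      exact le_trans (by gcongr; exact enorm_le_dyadicSup (h1 j) hs) h4
    have h6 := (ENNReal.ofReal_le_ofReal_iff (abs_nonneg _)).1 h5
    rw [abs_mul]
    linarith
  obtain ⟨M, hM⟩ := h3 (2 * |r|)
  obtain ⟨M', hM'⟩ := h3 (-(2 * |r|))
  refine ⟨max (max N 0) (max M M'), fun s hs j => ⟨fun hj => ?_, fun hj => ?_⟩⟩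
  · have hj' := max_le_iff.1 hj
    have hj1 := max_le_iff.1 hj'.1
    have hj2 := max_le_iff.1 hj'.2
    have h7 := (hM j).1 hj2.1
    have h8 := hhalf j (by rw [abs_of_nonneg hj1.2]; exact hj1.1) s hs
    rw [abs_of_pos (a := Y j ω) (by linarith [abs_nonneg r])] at h8
    have := (abs_le.1 h8).1
    show r < Y j ω + σ / √2 * B j s ω
    linarith [le_abs_self r]
  · have hj' := max_le_iff.1 (le_neg.1 hj)
    have hj1 := max_le_iff.1 hj'.1
    have hj2 := max_le_iff.1 hj'.2
    have h7 := (hM' j).2 (by omega)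
    have h8 := hhalf j (by rw [abs_of_nonpos (by omega)]; exact hj1.1) s hs
    rw [abs_of_neg (a := Y j ω) (by linarith [abs_nonneg r])] at h8
    have := (abs_le.1 h8).2
    show Y j ω + σ / √2 * B j s ω < r
    linarith [neg_abs_le r]

/-- Almost surely, the tracer is to the right of `r` if and only if the free particles cross `r`
from left to right more often than from right to left. -/
theorem IsAnnealedSingleFile.ae_lt_tracer_iff [IsProbabilityMeasure P]
    (h : IsAnnealedSingleFile ρ σ Y B X P) (t : ℝ≥0) :
    ∀ᵐ ω ∂P, ∀ r, r < X 0 t ω ↔ 1 ≤ crossing (fun j => Y j ω + σ / √2 * B j t ω) r := by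
  filter_upwards [h.hardCore, h.ae_properUpTo t, h.ae_continuous] with ω h1 h2 h3 r
  exact h1.lt_tracer_iff (fun j => continuous_const.add (continuous_const.mul (h3 j))) h2 r

end Proper

/-! ### Gaussian tails -/

/-- The density at unit time of a free particle. -/
def gaussDens (σ ξ : ℝ) : ℝ := Real.exp (-(ξ / σ) ^ 2) / (σ * √Real.pi)

/-- The probability that a free particle moves by more than `ξ` in unit time. -/
def gaussTail (σ ξ : ℝ) : ℝ := erfc (ξ / σ) / 2

/-- The integrated Gaussian tail. -/
def tailInt (σ ξ : ℝ) : ℝ := σ ^ 2 / 2 * gaussDens σ ξ - ξ * gaussTail σ ξ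

lemma integrable_exp_neg_sq : Integrable fun u : ℝ => Real.exp (-u ^ 2) := by
  simpa using integrable_exp_neg_mul_sq one_pos

lemma hasDerivAt_erfc (x : ℝ) : HasDerivAt erfc (-(2 / √Real.pi * Real.exp (-x ^ 2))) x := by
  have h1 : ∀ y, erfc y = 2 / √Real.pi * ((∫ u in Set.Ioi 0, Real.exp (-u ^ 2)) -
      ∫ u in (0 : ℝ)..y, Real.exp (-u ^ 2)) := fun y => by
    have := intervalIntegral.integral_Ioi_sub_Ioi'
      (integrable_exp_neg_sq.integrableOn (s := Set.Ioi 0))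
      (integrable_exp_neg_sq.integrableOn (s := Set.Ioi y))
    rw [erfc, ← this]
    ring
  have h2 : HasDerivAt (fun y => ∫ u in (0 : ℝ)..y, Real.exp (-u ^ 2)) (Real.exp (-x ^ 2)) x :=
    intervalIntegral.integral_hasDerivAt_right integrable_exp_neg_sq.intervalIntegrable
      ((by fun_prop : Continuous fun u : ℝ => Real.exp (-u ^ 2)).stronglyMeasurableAtFilter _ _)
      (by fun_prop)
  have h3 := (h2.const_sub (∫ u in Set.Ioi 0, Real.exp (-u ^ 2))).const_mul (2 / √Real.pi)
  rw [funext h1]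
  exact h3.congr_deriv (by ring)

lemma erfc_zero : erfc 0 = 1 := by
  have := integral_gaussian_Ioi 1
  simp only [neg_mul, one_mul, div_one] at this
  rw [erfc, this]
  have : √Real.pi ≠ 0 := by positivity
  field_simp

lemma erfc_nonneg (x : ℝ) : 0 ≤ erfc x :=
  mul_nonneg (by positivity) (integral_nonneg fun u => (Real.exp_pos _).le)

/-- Completing the square gives `-u ^ 2 ≤ l ^ 2 / 4 - l u`. The rate `l` is left free, so that every
exponential moment can be reached. -/
lemma erfc_le (x : ℝ) {l : ℝ} (hl : 0 < l) :
    erfc x ≤ 2 / √Real.pi * (Real.exp (l ^ 2 / 4) / l) * Real.exp (-l * x) := by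
  have h1 : ∫ u in Set.Ioi x, Real.exp (-u ^ 2) ≤
      ∫ u in Set.Ioi x, Real.exp (l ^ 2 / 4) * Real.exp (-l * u) := by
    refine setIntegral_mono integrable_exp_neg_sq.integrableOn
      ((integrableOn_exp_mul_Ioi (neg_lt_zero.2 hl) x).const_mul _) fun u => ?_
    rw [← Real.exp_add]
    exact Real.exp_le_exp.2 (by nlinarith [sq_nonneg (u - l / 2)])
  rw [integral_const_mul, integral_exp_mul_Ioi (neg_lt_zero.2 hl)] at h1
  rw [erfc, mul_assoc]
  refine mul_le_mul_of_nonneg_left (h1.trans_eq ?_) (by positivity)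
  field_simp

lemma erfc_neg (x : ℝ) : erfc (-x) = 2 - erfc x := by
  have h : ∀ y, HasDerivAt (fun y => erfc (-y) + erfc y) 0 y := fun y => by
    have h1 := (hasDerivAt_erfc (-y)).comp y (hasDerivAt_neg y)
    exact (h1.add (hasDerivAt_erfc y)).congr_deriv (by simp)
  have h2 := is_const_of_deriv_eq_zero (fun y => (h y).differentiableAt) (fun y => (h y).deriv) x 0
  simp only [neg_zero, erfc_zero] at h2
  linarith

lemma erfc_strictAnti : StrictAnti erfc :=
  strictAnti_of_deriv_neg fun x => by
    rw [(hasDerivAt_erfc x).deriv]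
    have : 0 < √Real.pi := by positivity
    exact neg_lt_zero.2 (by positivity)

lemma erfc_pos (x : ℝ) : 0 < erfc x :=
  (erfc_nonneg (x + 1)).trans_lt (erfc_strictAnti (lt_add_one x))

section

variable {σ : ℝ}

lemma gaussDens_pos (hσ : 0 < σ) (ξ : ℝ) : 0 < gaussDens σ ξ := by
  have : 0 < √Real.pi := by positivity
  unfold gaussDens
  positivity

lemma gaussDens_neg (σ ξ : ℝ) : gaussDens σ (-ξ) = gaussDens σ ξ := by
  simp [gaussDens, neg_div]

lemma gaussDens_le (hσ : 0 < σ) (ξ l : ℝ) :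
    gaussDens σ ξ ≤ Real.exp ((l * σ) ^ 2 / 4) / (σ * √Real.pi) * Real.exp (-l * ξ) := by
  unfold gaussDens
  rw [div_mul_eq_mul_div, ← Real.exp_add]
  refine div_le_div_of_nonneg_right (Real.exp_le_exp.2 ?_) (by positivity)
  have h1 : -l * ξ = -(l * σ) * (ξ / σ) := by field_simp
  rw [h1]
  nlinarith [sq_nonneg (ξ / σ - l * σ / 2)]

lemma gaussTail_pos (σ ξ : ℝ) : 0 < gaussTail σ ξ := half_pos (erfc_pos _)

lemma gaussTail_neg (σ ξ : ℝ) : gaussTail σ (-ξ) = 1 - gaussTail σ ξ := by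
  rw [gaussTail, gaussTail, neg_div, erfc_neg]
  ring

lemma gaussTail_lt_one (σ ξ : ℝ) : gaussTail σ ξ < 1 := by
  linarith [gaussTail_pos σ (-ξ), gaussTail_neg σ ξ]

lemma gaussTail_zero (σ : ℝ) : gaussTail σ 0 = 1 / 2 := by
  simp [gaussTail, erfc_zero]

lemma gaussTail_le (hσ : 0 < σ) (ξ : ℝ) {l : ℝ} (hl : 0 < l) :
    gaussTail σ ξ ≤ Real.exp ((l * σ) ^ 2 / 4) / (l * σ * √Real.pi) * Real.exp (-l * ξ) := by
  have h := erfc_le (ξ / σ) (mul_pos hl hσ)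
  rw [gaussTail, div_le_iff₀ two_pos]
  refine h.trans_eq ?_
  have h1 : -(l * σ) * (ξ / σ) = -l * ξ := by field_simp
  have h2 : √Real.pi ≠ 0 := by positivity
  rw [h1]
  field_simp

lemma hasDerivAt_gaussTail (hσ : 0 < σ) (ξ : ℝ) :
    HasDerivAt (gaussTail σ) (-gaussDens σ ξ) ξ := by
  have h1 := ((hasDerivAt_erfc (ξ / σ)).comp ξ ((hasDerivAt_id ξ).div_const σ)).div_const 2
  have h2 : √Real.pi ≠ 0 := by positivity
  refine h1.congr_deriv ?_
  unfold gaussDens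
  field_simp

lemma hasDerivAt_gaussDens (hσ : 0 < σ) (ξ : ℝ) :
    HasDerivAt (gaussDens σ) (-(2 * ξ / σ ^ 2) * gaussDens σ ξ) ξ := by
  have h1 := ((((hasDerivAt_id ξ).div_const σ).pow 2).neg.exp).div_const (σ * √Real.pi)
  have h2 : √Real.pi ≠ 0 := by positivity
  refine h1.congr_deriv ?_
  simp [gaussDens]
  field_simp

lemma continuous_gaussTail (hσ : 0 < σ) : Continuous (gaussTail σ) :=
  continuous_iff_continuousAt.2 fun ξ => (hasDerivAt_gaussTail hσ ξ).continuousAt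

lemma continuous_gaussDens (hσ : 0 < σ) : Continuous (gaussDens σ) :=
  continuous_iff_continuousAt.2 fun ξ => (hasDerivAt_gaussDens hσ ξ).continuousAt

lemma hasDerivAt_tailInt (hσ : 0 < σ) (ξ : ℝ) :
    HasDerivAt (tailInt σ) (-gaussTail σ ξ) ξ := by
  have h1 := ((hasDerivAt_gaussDens hσ ξ).const_mul (σ ^ 2 / 2)).sub
    ((hasDerivAt_id ξ).mul (hasDerivAt_gaussTail hσ ξ))
  refine h1.congr_deriv ?_
  simp only [id]
  field_simp
  ring

/-- The means of the two crossing directions differ by exactly the displacement of the level. This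
identity governs the growth of the rate function, places the saddle outside the unit circle for `ξ >
0`, and gives the algebraic equation behind the Taylor coefficients. -/
lemma tailInt_neg (σ ξ : ℝ) : tailInt σ (-ξ) = tailInt σ ξ + ξ := by
  simp only [tailInt, gaussDens_neg, gaussTail_neg]
  ring

lemma tailInt_zero (hσ : 0 < σ) : tailInt σ 0 = σ / (2 * √Real.pi) := by
  have h2 : √Real.pi ≠ 0 := by positivity
  simp only [tailInt, gaussDens]
  field_simp
  simp

lemma tailInt_strictAnti (hσ : 0 < σ) : StrictAnti (tailInt σ) :=
  strictAnti_of_deriv_neg fun x => by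
    rw [(hasDerivAt_tailInt hσ x).deriv]
    exact neg_lt_zero.2 (gaussTail_pos σ x)

lemma tailInt_le (hσ : 0 < σ) {ξ : ℝ} (hξ : 0 ≤ ξ) (l : ℝ) :
    tailInt σ ξ ≤ σ ^ 2 / 2 * (Real.exp ((l * σ) ^ 2 / 4) / (σ * √Real.pi)) *
      Real.exp (-l * ξ) := by
  have h1 := gaussDens_le hσ ξ l
  have h2 := mul_nonneg hξ (gaussTail_pos σ ξ).le
  have h3 := mul_le_mul_of_nonneg_left h1 (by positivity : 0 ≤ σ ^ 2 / 2)
  rw [tailInt, mul_assoc]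
  linarith

lemma tendsto_exp_neg_atTop {l : ℝ} (hl : 0 < l) (C : ℝ) :
    Tendsto (fun x => C * Real.exp (-l * x)) atTop (𝓝 0) := by
  have h1 : Tendsto (fun x : ℝ => l * x) atTop atTop := tendsto_id.const_mul_atTop hl
  have h2 := (Real.tendsto_exp_neg_atTop_nhds_zero.comp h1).const_mul C
  simpa using h2

lemma tendsto_gaussTail (hσ : 0 < σ) : Tendsto (gaussTail σ) atTop (𝓝 0) :=
  squeeze_zero (fun ξ => (gaussTail_pos σ ξ).le) (fun ξ => gaussTail_le hσ ξ one_pos)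
    (tendsto_exp_neg_atTop one_pos _)

lemma tendsto_tailInt (hσ : 0 < σ) : Tendsto (tailInt σ) atTop (𝓝 0) := by
  have h1 : Tendsto (gaussDens σ) atTop (𝓝 0) :=
    squeeze_zero (fun ξ => (gaussDens_pos hσ ξ).le) (fun ξ => gaussDens_le hσ ξ 1)
      (tendsto_exp_neg_atTop one_pos _)
  have h2 : Tendsto (fun ξ => ξ * gaussTail σ ξ) atTop (𝓝 0) := by
    set C := Real.exp ((1 * σ) ^ 2 / 4) / (1 * σ * √Real.pi)
    have h3 : Tendsto (fun ξ : ℝ => C * (ξ ^ 1 * Real.exp (-ξ))) atTop (𝓝 (C * 0)) :=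
      (Real.tendsto_pow_mul_exp_neg_atTop_nhds_zero 1).const_mul C
    rw [mul_zero] at h3
    refine squeeze_zero' ?_ ?_ h3
    · filter_upwards [eventually_ge_atTop 0] with ξ hξ
      exact mul_nonneg hξ (gaussTail_pos σ ξ).le
    · filter_upwards [eventually_ge_atTop 0] with ξ hξ
      refine (mul_le_mul_of_nonneg_left (gaussTail_le hσ ξ one_pos) hξ).trans_eq ?_
      simp only [C, neg_mul, one_mul, pow_one]
      ring
  have h4 := (h1.const_mul (σ ^ 2 / 2)).sub h2
  rw [mul_zero, sub_zero] at h4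
  exact h4

lemma tailInt_pos (hσ : 0 < σ) (ξ : ℝ) : 0 < tailInt σ ξ := by
  have h : ∀ y, 0 ≤ tailInt σ y := fun y =>
    (tailInt_strictAnti hσ).antitone.le_of_tendsto (tendsto_tailInt hσ) y
  exact (h (ξ + 1)).trans_lt (tailInt_strictAnti hσ (lt_add_one ξ))

lemma continuous_tailInt (hσ : 0 < σ) : Continuous (tailInt σ) :=
  continuous_iff_continuousAt.2 fun ξ => (hasDerivAt_tailInt hσ ξ).continuousAt

lemma integrableOn_gaussTail (hσ : 0 < σ) (ξ : ℝ) : IntegrableOn (gaussTail σ) (Set.Ioi ξ) := by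
  refine (((integrableOn_exp_mul_Ioi (neg_lt_zero.2 one_pos) ξ).const_mul
    (Real.exp ((1 * σ) ^ 2 / 4) / (1 * σ * √Real.pi))).mono'
    (continuous_gaussTail hσ).aestronglyMeasurable ?_)
  refine Eventually.of_forall fun x => ?_
  rw [Real.norm_of_nonneg (gaussTail_pos σ x).le]
  exact gaussTail_le hσ x one_pos

lemma integral_Ioi_gaussTail (hσ : 0 < σ) (ξ : ℝ) :
    ∫ η in Set.Ioi ξ, gaussTail σ η = tailInt σ ξ := by
  have h := integral_Ioi_of_hasDerivAt_of_tendsto (f := fun x => -tailInt σ x)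
    (f' := gaussTail σ) (a := ξ) (m := 0) (continuous_tailInt hσ).neg.continuousWithinAt
    (fun x _ => (hasDerivAt_tailInt hσ x).neg.congr_deriv (neg_neg _)) (integrableOn_gaussTail hσ ξ)
    (by simpa using (tendsto_tailInt hσ).neg)
  simpa using h

lemma integrable_gaussDens (hσ : 0 < σ) : Integrable (gaussDens σ) := by
  have h := (integrable_exp_neg_sq.comp_div hσ.ne').div_const (σ * √Real.pi)
  exact h

lemma integral_Ioi_gaussDens (hσ : 0 < σ) (ξ : ℝ) :
    ∫ η in Set.Ioi ξ, gaussDens σ η = gaussTail σ ξ := by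
  have h := integral_Ioi_of_hasDerivAt_of_tendsto (f := fun x => -gaussTail σ x)
    (f' := gaussDens σ) (a := ξ) (m := 0) (continuous_gaussTail hσ).neg.continuousWithinAt
    (fun x _ => (hasDerivAt_gaussTail hσ x).neg.congr_deriv (neg_neg _))
    (integrable_gaussDens hσ).integrableOn (by simpa using (tendsto_gaussTail hσ).neg)
  simpa using h

/-- The large deviation function in terms of the integrated tails. -/
lemma phiA_eq (hσ : 0 < σ) (ρ ξ : ℝ) :
    phiA ρ σ ξ = ρ * (√(tailInt σ ξ) - √(tailInt σ (-ξ))) ^ 2 := by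
  have h : ∀ x, ∫ η in Set.Ioi x, erfc (η / σ) = 2 * tailInt σ x := fun x => by
    rw [← integral_Ioi_gaussTail hσ, ← integral_const_mul]
    congr with η
    rw [gaussTail]
    ring
  rw [phiA, h, h, Real.sqrt_mul zero_le_two, Real.sqrt_mul zero_le_two, ← mul_sub, mul_pow,
    Real.sq_sqrt zero_le_two]
  ring

end

/-- The law of the displacement of a free particle. -/
lemma gaussianReal_Ioi {σ : ℝ} (hσ : 0 < σ) {v : ℝ≥0} (hv : (v : ℝ) = σ ^ 2 / 2) (x : ℝ) :
    (gaussianReal 0 v).real (Set.Ioi x) = gaussTail σ x := by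
  have hv0 : v ≠ 0 := by
    rintro rfl
    have : 0 < σ ^ 2 / 2 := by positivity
    rw [← hv] at this
    simp at this
  rw [measureReal_def, gaussianReal_apply_eq_integral 0 hv0, ENNReal.toReal_ofReal
    (integral_nonneg fun u => gaussianPDFReal_nonneg 0 v u), ← integral_Ioi_gaussDens hσ]
  congr with u
  rw [gaussianPDFReal, gaussDens, hv]
  have h1 : √(2 * Real.pi * (σ ^ 2 / 2)) = σ * √Real.pi := by
    rw [show 2 * Real.pi * (σ ^ 2 / 2) = σ ^ 2 * Real.pi by ring, Real.sqrt_mul (sq_nonneg _),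
      Real.sqrt_sq hσ.le]
  rw [h1, sub_zero, inv_mul_eq_div]
  congr 2
  field_simp

/-! ### The characteristic function of the crossing number -/

section Crossing

variable {Ω : Type*} [MeasurableSpace Ω] {P : Measure Ω} {ρ σ : ℝ} {Y : ℤ → Ω → ℝ}
  {B X : ℤ → ℝ≥0 → Ω → ℝ}

/-- Fubini, conditionally on the initial positions. Only finitely many noises occur, and their joint
law is a product of Gaussian measures. -/
lemma IsAnnealedSingleFile.integral_prod_eq [IsProbabilityMeasure P]
    (h : IsAnnealedSingleFile ρ σ Y B X P) (t : ℝ≥0) (s : Finset ℤ) (Φ : ℤ → ℝ → ℝ → ℂ)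
    (hΦ : ∀ j, Measurable fun p : ℝ × ℝ => Φ j p.1 p.2) (hΦ1 : ∀ j y b, ‖Φ j y b‖ ≤ 1) :
    ∫ ω, ∏ j ∈ s, Φ j (Y j ω) (B j t ω) ∂P =
      ∫ ω, ∏ j ∈ s, (∫ b, Φ j (Y j ω) b ∂(gaussianReal 0 t)) ∂P := by
  have hYm : Measurable fun ω j => Y j ω := measurable_pi_lambda _ h.initial.measurable
  have hBm : Measurable fun ω (j : s) => B j t ω :=
    measurable_pi_lambda _ fun j => h.measurable_noise j t
  have hind : IndepFun (fun ω j => Y j ω) (fun ω (j : s) => B j t ω) P := by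
    have hψ : Measurable fun (b : ℤ → ℝ≥0 → ℝ) (j : s) => b j t :=
      measurable_pi_lambda _ fun j => (measurable_pi_apply t).comp (measurable_pi_apply (j : ℤ))
    exact h.indep_initial.comp measurable_id hψ
  have hpi : P.map (fun ω (j : s) => B j t ω) = Measure.pi fun _ : s => gaussianReal 0 t := by
    have h1 : iIndepFun (fun (j : s) (ω : Ω) => B j t ω) P :=
      (h.indep_noise.comp (fun _ b => b t) fun _ => measurable_pi_apply t).precomp
        (g := fun j : s => (j : ℤ)) Subtype.val_injective
    rw [(iIndepFun_iff_map_fun_eq_pi_map fun j : s =>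
      (h.measurable_noise j t).aemeasurable).1 h1]
    congr 1
    ext1 j
    exact ((h.brownian j).hasLaw_eval t).map_eq
  have hmap := (indepFun_iff_map_prod_eq_prod_map_map hYm.aemeasurable hBm.aemeasurable).1 hind
  let G : (ℤ → ℝ) × (s → ℝ) → ℂ := fun p => ∏ j : s, Φ j (p.1 j) (p.2 j)
  have hGm : Measurable G := Finset.measurable_fun_prod _ fun j _ => by
    have hm : Measurable fun p : (ℤ → ℝ) × (s → ℝ) => (p.1 j, p.2 j) := by fun_prop
    exact (hΦ j).comp hm
  have hG1 : ∀ p, ‖G p‖ ≤ 1 := fun p => by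
    rw [norm_prod]
    exact Finset.prod_le_one (fun _ _ => norm_nonneg _) fun j _ => hΦ1 _ _ _
  calc ∫ ω, ∏ j ∈ s, Φ j (Y j ω) (B j t ω) ∂P
      = ∫ ω, G (fun j => Y j ω, fun j : s => B j t ω) ∂P := by
        congr with ω
        rw [← Finset.prod_coe_sort]
    _ = ∫ p, G p ∂((P.map fun ω j => Y j ω).prod (P.map fun ω (j : s) => B j t ω)) := by
        rw [← hmap, integral_map (hYm.prodMk hBm).aemeasurable hGm.aestronglyMeasurable]
    _ = ∫ y, ∫ b, G (y, b) ∂(P.map fun ω (j : s) => B j t ω) ∂(P.map fun ω j => Y j ω) := by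
        have := Measure.isProbabilityMeasure_map (μ := P) hYm.aemeasurable
        have := Measure.isProbabilityMeasure_map (μ := P) hBm.aemeasurable
        exact integral_prod _ (Integrable.of_bound hGm.aestronglyMeasurable 1
          (Eventually.of_forall hG1))
    _ = ∫ y : ℤ → ℝ, ∏ j ∈ s, (∫ b, Φ j (y j) b ∂(gaussianReal 0 t))
          ∂(P.map fun ω j => Y j ω) := by
        congr with y
        rw [hpi]
        simp only [G]
        rw [integral_fintype_prod_eq_prod (f := fun (j : s) (b : ℝ) => Φ j (y j) b),
          ← Finset.prod_coe_sort s]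
    _ = _ := by
        rw [integral_map hYm.aemeasurable]
        refine Measurable.aestronglyMeasurable (Finset.measurable_fun_prod _ fun j _ => ?_)
        have h2 : StronglyMeasurable fun y : ℝ => ∫ b, Φ j y b ∂(gaussianReal 0 t) :=
          (hΦ j).stronglyMeasurable.integral_prod_right'
        exact h2.measurable.comp (measurable_pi_apply j)

/-- The contribution to the crossing number of a particle which starts at `y` and is displaced by
`c * b`. -/
def crossInd (c x y b : ℝ) : ℤ := (if y < 0 then 1 else 0) - belowInd x (y + c * b)

lemma measurable_belowInd (x : ℝ) : Measurable (belowInd x) :=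
  Measurable.ite measurableSet_Iic measurable_const measurable_const

lemma measurable_crossInd (c x : ℝ) : Measurable fun p : ℝ × ℝ => crossInd c x p.1 p.2 := by
  refine (Measurable.ite (measurableSet_lt measurable_fst measurable_const) measurable_const
    measurable_const).sub ((measurable_belowInd x).comp ?_)
  fun_prop

/-- The contribution to the crossing number of the tracer. -/
def tracerInd (c x b : ℝ) : ℤ := 1 - belowInd x (c * b)

lemma measurable_tracerInd (c x : ℝ) : Measurable (tracerInd c x) :=
  measurable_const.sub ((measurable_belowInd x).comp (by fun_prop))

lemma norm_exp_mul_intCast (θ : ℝ) (n : ℤ) : ‖Complex.exp (θ * n * Complex.I)‖ = 1 := by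
  rw [show (θ : ℂ) * n = ((θ * n : ℝ) : ℂ) by push_cast; rfl]
  exact Complex.norm_exp_ofReal_mul_I _

/-- Strict ranking with `Y 0 = 0` makes `j ≤ 0` equivalent to `Y j < 0` for `j ≠ 0`. Each
contribution thus depends on the position and noise but not on the label, as the Poisson generating
functional demands. Properness makes the partial sums eventually constant. -/
lemma IsAnnealedSingleFile.ae_eventually_crossing_eq [IsProbabilityMeasure P]
    (h : IsAnnealedSingleFile ρ σ Y B X P) (t : ℝ≥0) (x : ℝ) :
    ∀ᵐ ω ∂P, ∀ᶠ s : Finset {i : ℤ // i ≠ 0} in atTop,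
      tracerInd (σ / √2) x (B 0 t ω) + ∑ i ∈ s, crossInd (σ / √2) x (Y i ω) (B i t ω) =
        crossing (fun j => Y j ω + σ / √2 * B j t ω) x := by
  filter_upwards [h.ae_properUpTo t, h.initial.ranked, h.initial.tracer] with ω h1 h2 h3
  set f : ℤ → ℤ := fun j => (if j ≤ 0 then 1 else 0) - belowInd x (Y j ω + σ / √2 * B j t ω)
  have hfin : (Function.support f).Finite := (h1.properSeq le_rfl).finite_support_crossing x
  have h0 : tracerInd (σ / √2) x (B 0 t ω) = f 0 := by simp [f, tracerInd, h3]
  have hi : ∀ i : {i : ℤ // i ≠ 0}, crossInd (σ / √2) x (Y i ω) (B i t ω) = f i := fun i => by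
    have : Y i ω < 0 ↔ (i : ℤ) ≤ 0 := by
      rw [← h3]
      exact (h2.lt_iff_lt (a := (i : ℤ)) (b := 0)).trans (lt_iff_le_and_ne.trans
        (and_iff_left i.2))
    simp only [f, crossInd, this]
  have hfin' : (Function.support fun i : {i : ℤ // i ≠ 0} => f i).Finite :=
    hfin.preimage Subtype.val_injective.injOn
  filter_upwards [eventually_ge_atTop hfin'.toFinset] with s hs
  rw [h0, Finset.sum_congr rfl fun i _ => hi i]
  change _ = ∑ᶠ j, f j
  have hsub : Function.support f ⊆ (insert 0 (s.map (Function.Embedding.subtype _)) :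
      Finset ℤ) := by
    intro j hj
    rcases eq_or_ne j 0 with rfl | hj0
    · simp
    · simp only [Finset.coe_insert, Finset.coe_map, Set.mem_insert_iff]
      exact Or.inr ⟨⟨j, hj0⟩, hs (by simpa using hj), rfl⟩
  rw [finsum_eq_sum_of_support_subset _ hsub, Finset.sum_insert (by simp), Finset.sum_map]
  rfl

lemma IsAnnealedSingleFile.aemeasurable_crossing [IsProbabilityMeasure P]
    (h : IsAnnealedSingleFile ρ σ Y B X P) (t : ℝ≥0) (x : ℝ) :
    AEMeasurable (fun ω => crossing (fun j => Y j ω + σ / √2 * B j t ω) x) P := by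
  refine aemeasurable_of_tendsto_metrizable_ae (atTop : Filter (Finset {i : ℤ // i ≠ 0}))
    (f := fun (s : Finset {i : ℤ // i ≠ 0}) ω => tracerInd (σ / √2) x (B 0 t ω) +
      ∑ i ∈ s, crossInd (σ / √2) x (Y i ω) (B i t ω)) (fun s => Measurable.aemeasurable ?_) ?_
  · refine ((measurable_tracerInd _ x).comp (h.measurable_noise 0 t)).add
      (Finset.measurable_fun_sum _ fun i _ => ?_)
    exact (measurable_crossInd _ x).comp
      ((h.initial.measurable i).prodMk (h.measurable_noise i t))
  · filter_upwards [h.ae_eventually_crossing_eq t x] with ω hω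
    exact tendsto_const_nhds.congr' (hω.mono fun s hs => hs.symm)

/-- One minus the mean phase of the crossing indicator of a particle which starts at `y`. -/
def crossPhase (s x : ℝ) (w : ℂ) (y : ℝ) : ℂ :=
  if y < 0 then (w - 1) * gaussTail s (x - y) else (w⁻¹ - 1) * gaussTail s (y - x)

lemma gaussianReal_lt_const_mul {c s : ℝ} {t : ℝ≥0} (hs : 0 < s) (hc : c ^ 2 * t = s ^ 2 / 2)
    (x : ℝ) : (gaussianReal 0 t).real {b | x < c * b} = gaussTail s x := by
  have h1 := gaussianReal_map_const_mul (μ := 0) (v := t) c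
  rw [mul_zero] at h1
  rw [← gaussianReal_Ioi hs (v := .mk (c ^ 2) (sq_nonneg c) * t) (by push_cast; exact hc) x,
    ← h1, map_measureReal_apply (by fun_prop) measurableSet_Ioi]
  rfl

lemma integral_exp_mul_ite {α : Type*} [MeasurableSpace α] (γ : Measure α)
    [IsProbabilityMeasure γ] {A : Set α} (hA : MeasurableSet A) [DecidablePred (· ∈ A)] (w : ℂ) :
    ∫ b, (if b ∈ A then w else 1) ∂γ = 1 + (w - 1) * γ.real A := by
  have h1 : ∀ b, (if b ∈ A then w else 1) = 1 + A.indicator (fun _ => w - 1) b := fun b => by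
    by_cases hb : b ∈ A <;> simp [hb]
  simp_rw [h1]
  rw [integral_add (integrable_const _) ((integrable_const _).indicator hA),
    integral_indicator_const _ hA]
  simp [mul_comm]

lemma integral_exp_tracerInd {c s : ℝ} {t : ℝ≥0} (hs : 0 < s) (hc : c ^ 2 * t = s ^ 2 / 2)
    (x θ : ℝ) : ∫ b, Complex.exp (θ * tracerInd c x b * Complex.I) ∂(gaussianReal 0 t) =
      1 + (Complex.exp (θ * Complex.I) - 1) * gaussTail s x := by
  classical
  rw [← gaussianReal_lt_const_mul hs hc,
    ← integral_exp_mul_ite _ (measurableSet_lt measurable_const (by fun_prop))]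
  congr with b
  rcases le_or_gt (c * b) x with hb | hb
  · simp [tracerInd, belowInd_of_le hb, hb]
  · simp [tracerInd, belowInd_of_lt hb, hb]

lemma integral_exp_crossInd {c s : ℝ} {t : ℝ≥0} (hs : 0 < s) (hc : c ^ 2 * t = s ^ 2 / 2)
    (x θ y : ℝ) : ∫ b, Complex.exp (θ * crossInd c x y b * Complex.I) ∂(gaussianReal 0 t) =
      1 + crossPhase s x (Complex.exp (θ * Complex.I)) y := by
  classical
  have h1 := gaussianReal_lt_const_mul hs hc (x - y)
  have hm : MeasurableSet {b : ℝ | x - y < c * b} :=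
    measurableSet_lt measurable_const (by fun_prop)
  have h2 : (gaussianReal 0 t).real {b | x - y < c * b}ᶜ = gaussTail s (y - x) := by
    rw [probReal_compl_eq_one_sub hm, h1, ← neg_sub x y, gaussTail_neg]
  rcases lt_or_ge y 0 with hy | hy
  · rw [crossPhase, if_pos hy, ← h1, ← integral_exp_mul_ite _ hm]
    congr with b
    by_cases hb : x - y < c * b
    · simp [crossInd, belowInd_of_lt (sub_lt_iff_lt_add'.1 hb), hb, hy]
    · simp [crossInd, belowInd_of_le (le_sub_iff_add_le'.1 (not_lt.1 hb)), hb, hy]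
  · rw [crossPhase, if_neg hy.not_gt, ← h2, ← integral_exp_mul_ite _ hm.compl]
    congr with b
    by_cases hb : x - y < c * b
    · simp [crossInd, belowInd_of_lt (sub_lt_iff_lt_add'.1 hb), hb, hy.not_gt]
    · simp [crossInd, belowInd_of_le (le_sub_iff_add_le'.1 (not_lt.1 hb)), hb, hy.not_gt,
        Complex.exp_neg]

lemma measurable_crossPhase {s : ℝ} (hs : 0 < s) (x : ℝ) (w : ℂ) :
    Measurable (crossPhase s x w) := by
  have := (continuous_gaussTail hs).measurable
  refine Measurable.ite measurableSet_Iio (measurable_const.mul ?_) (measurable_const.mul ?_)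
  · exact Complex.measurable_ofReal.comp (this.comp (by fun_prop))
  · exact Complex.measurable_ofReal.comp (this.comp (by fun_prop))

/-- The substitutions `x - y` on the left half-line and `y - x` on the right one turn both pieces
into integrated Gaussian tails, the Poisson parameters of the two crossing directions at density
one. -/
lemma integral_crossPhase {s : ℝ} (hs : 0 < s) (x : ℝ) (w : ℂ) :
    Integrable (crossPhase s x w) ∧
      ∫ y, crossPhase s x w y = (w - 1) * tailInt s x + (w⁻¹ - 1) * tailInt s (-x) := by
  have m1 := Measure.measurePreserving_sub_left (volume : Measure ℝ) x
  have m2 := measurePreserving_sub_right (volume : Measure ℝ) x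
  have b1 : MeasurableEmbedding fun y : ℝ => x - y :=
    (MeasurableEquiv.subLeft x).measurableEmbedding
  have b2 : MeasurableEmbedding fun y : ℝ => y - x :=
    (MeasurableEquiv.subRight x).measurableEmbedding
  have p1 : (fun y => x - y) ⁻¹' Set.Ioi x = Set.Iio 0 := by
    ext y
    simp
  have p2 : (fun y => y - x) ⁻¹' Set.Ioi (-x) = Set.Ioi 0 := by
    ext y
    simp
  have i1 : IntegrableOn (fun y => gaussTail s (x - y)) (Set.Iio 0) := by
    have := (m1.integrableOn_comp_preimage b1).2 (integrableOn_gaussTail hs x)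
    rwa [p1] at this
  have i2 : IntegrableOn (fun y => gaussTail s (y - x)) (Set.Ici 0) := by
    rw [integrableOn_Ici_iff_integrableOn_Ioi]
    have := (m2.integrableOn_comp_preimage b2).2 (integrableOn_gaussTail hs (-x))
    rwa [p2] at this
  have e1 : ∫ y in Set.Iio 0, gaussTail s (x - y) = tailInt s x := by
    rw [← integral_Ioi_gaussTail hs, ← p1]
    exact m1.setIntegral_preimage_emb b1 _ _
  have e2 : ∫ y in Set.Ici 0, gaussTail s (y - x) = tailInt s (-x) := by
    rw [← integral_Ioi_gaussTail hs, integral_Ici_eq_integral_Ioi, ← p2]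
    exact m2.setIntegral_preimage_emb b2 _ _
  have j1 : IntegrableOn (crossPhase s x w) (Set.Iio 0) := by
    refine IntegrableOn.congr_fun (i1.ofReal.const_mul (w - 1)) (fun y hy => ?_) measurableSet_Iio
    rw [crossPhase, if_pos (Set.mem_Iio.1 hy)]
    rfl
  have j2 : IntegrableOn (crossPhase s x w) (Set.Iio 0)ᶜ := by
    rw [Set.compl_Iio]
    refine IntegrableOn.congr_fun (i2.ofReal.const_mul (w⁻¹ - 1)) (fun y hy => ?_)
      measurableSet_Ici
    rw [crossPhase, if_neg (not_lt.2 hy)]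
    rfl
  have hint : Integrable (crossPhase s x w) := by
    rw [← integrableOn_univ, ← Set.union_compl_self (Set.Iio (0 : ℝ))]
    exact j1.union j2
  refine ⟨hint, ?_⟩
  rw [← integral_add_compl measurableSet_Iio hint, Set.compl_Iio,
    setIntegral_congr_fun (g := fun y => (w - 1) * ((gaussTail s (x - y) : ℝ) : ℂ))
      measurableSet_Iio (fun y hy => by rw [crossPhase, if_pos (Set.mem_Iio.1 hy)]),
    setIntegral_congr_fun (g := fun y => (w⁻¹ - 1) * ((gaussTail s (y - x) : ℝ) : ℂ))
      measurableSet_Ici (fun y hy => by rw [crossPhase, if_neg (not_lt.2 (Set.mem_Ici.1 hy))]),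
    integral_const_mul, integral_const_mul, integral_complex_ofReal, integral_complex_ofReal,
    e1, e2]

/-- The crossing number is a Skellam variable plus the independent contribution of the tracer. -/
theorem IsAnnealedSingleFile.integral_exp_crossing [IsProbabilityMeasure P]
    (h : IsAnnealedSingleFile ρ σ Y B X P) (hρ : 0 < ρ) {t : ℝ≥0} {s : ℝ} (hs : 0 < s)
    (hc : (σ / √2) ^ 2 * t = s ^ 2 / 2) (x θ : ℝ) :
    ∫ ω, Complex.exp (θ * crossing (fun j => Y j ω + σ / √2 * B j t ω) x * Complex.I) ∂P =
      Complex.exp (ρ * tailInt s x * (Complex.exp (θ * Complex.I) - 1) +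
        ρ * tailInt s (-x) * ((Complex.exp (θ * Complex.I))⁻¹ - 1)) *
      (1 + (Complex.exp (θ * Complex.I) - 1) * gaussTail s x) := by
  classical
  set c := σ / √2
  set w := Complex.exp (θ * Complex.I)
  set q : ℂ := 1 + (w - 1) * gaussTail s x
  have hL : Tendsto (fun u : Finset {i : ℤ // i ≠ 0} => ∫ ω, Complex.exp (θ *
      ((tracerInd c x (B 0 t ω) + ∑ i ∈ u, crossInd c x (Y i ω) (B i t ω) : ℤ) : ℂ) *
      Complex.I) ∂P) atTop
      (𝓝 (∫ ω, Complex.exp (θ * crossing (fun j => Y j ω + c * B j t ω) x * Complex.I) ∂P)) := by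
    refine tendsto_integral_filter_of_dominated_convergence (fun _ => 1) ?_ ?_
      (integrable_const _) ?_
    · refine Eventually.of_forall fun u => Measurable.aestronglyMeasurable ?_
      have hm : Measurable fun ω => tracerInd c x (B 0 t ω) +
          ∑ i ∈ u, crossInd c x (Y i ω) (B i t ω) :=
        ((measurable_tracerInd _ x).comp (h.measurable_noise 0 t)).add
          (Finset.measurable_fun_sum _ fun i _ => (measurable_crossInd _ x).comp
            ((h.initial.measurable i).prodMk (h.measurable_noise i t)))
      exact (Measurable.of_discrete (f := fun n : ℤ =>
        Complex.exp (θ * n * Complex.I))).comp hm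
    · exact Eventually.of_forall fun u => Eventually.of_forall fun ω =>
        (norm_exp_mul_intCast _ _).le
    · filter_upwards [h.ae_eventually_crossing_eq t x] with ω hω
      refine tendsto_const_nhds.congr' (hω.mono fun u hu => ?_)
      simp only [c, hu]
  have hR : ∀ u : Finset {i : ℤ // i ≠ 0}, ∫ ω, Complex.exp (θ *
      ((tracerInd c x (B 0 t ω) + ∑ i ∈ u, crossInd c x (Y i ω) (B i t ω) : ℤ) : ℂ) *
      Complex.I) ∂P = q * ∫ ω, ∏ i ∈ u, (1 + crossPhase s x w (Y i ω)) ∂P := by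
    intro u
    let Φ : ℤ → ℝ → ℝ → ℂ := fun j y b => if j = 0 then Complex.exp (θ * tracerInd c x b *
      Complex.I) else Complex.exp (θ * crossInd c x y b * Complex.I)
    have hΦ : ∀ j, Measurable fun p : ℝ × ℝ => Φ j p.1 p.2 := fun j => by
      have hd := Measurable.of_discrete (f := fun n : ℤ => Complex.exp (θ * n * Complex.I))
      by_cases hj : j = 0
      · simp only [Φ, hj, if_true]
        exact hd.comp ((measurable_tracerInd c x).comp measurable_snd)
      · simp only [Φ, hj, if_false]
        exact hd.comp (measurable_crossInd c x)
    have hΦ1 : ∀ j y b, ‖Φ j y b‖ ≤ 1 := fun j y b => by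
      by_cases hj : j = 0
      · simp only [Φ, hj, if_true]
        exact (norm_exp_mul_intCast _ _).le
      · simp only [Φ, hj, if_false]
        exact (norm_exp_mul_intCast _ _).le
    have key := h.integral_prod_eq t (insert 0 (u.map (Function.Embedding.subtype _))) Φ hΦ hΦ1
    have hne : ∀ i : {i : ℤ // i ≠ 0}, (i : ℤ) ≠ 0 := fun i => i.2
    rw [← integral_const_mul]
    refine Eq.trans ?_ (key.trans ?_)
    · congr with ω
      rw [Finset.prod_insert (by simp), Finset.prod_map]
      simp only [Φ, if_true, Function.Embedding.subtype_apply, hne, if_false]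
      rw [← Complex.exp_sum, ← Complex.exp_add]
      congr 1
      push_cast
      rw [mul_add, add_mul, Finset.mul_sum, Finset.sum_mul]
    · congr with ω
      rw [Finset.prod_insert (by simp), Finset.prod_map]
      simp only [Φ, if_true, Function.Embedding.subtype_apply, hne, if_false]
      rw [integral_exp_tracerInd hs hc]
      simp_rw [integral_exp_crossInd hs hc]
      rfl
  have : SigmaFinite (ENNReal.ofReal ρ • (volume : Measure ℝ)) :=
    inferInstanceAs (SigmaFinite (ρ.toNNReal • (volume : Measure ℝ)))
  obtain ⟨hi, hI⟩ := integral_crossPhase hs x w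
  have hlim := h.initial.poisson.tendsto_integral_prod (fun i => h.initial.measurable i)
    (measurable_crossPhase hs x w) (hi.smul_measure ENNReal.ofReal_ne_top) fun y => by
      rw [← integral_exp_crossInd hs hc]
      refine (norm_integral_le_of_norm_le_const (C := 1)
        (Eventually.of_forall fun b => (norm_exp_mul_intCast _ _).le)).trans ?_
      simp
  have hlim' := hlim.const_mul q
  rw [integral_smul_measure, hI, ENNReal.toReal_ofReal hρ.le] at hlim'
  refine (tendsto_nhds_unique hL ((tendsto_congr hR).2 hlim')).trans ?_
  rw [mul_comm, Complex.real_smul]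
  congr 2
  ring

end Crossing

/-! ### Fourier inversion for integer-valued variables -/

lemma circleAverage_zpow (n : ℤ) :
    Real.circleAverage (fun z : ℂ => z ^ n) 0 1 = if n = 0 then 1 else 0 := by
  rw [Real.circleAverage_eq_circleIntegral one_ne_zero]
  have h1 : (∮ z in C((0 : ℂ), 1), (z - 0)⁻¹ • z ^ n) =
      ∮ z in C((0 : ℂ), 1), (z - 0) ^ (n - 1) := by
    refine circleIntegral.integral_congr zero_le_one fun z hz => ?_
    have hz0 : z ≠ 0 := by
      rintro rfl
      simp at hz
    simp only [sub_zero, smul_eq_mul]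
    rw [zpow_sub_one₀ hz0, mul_comm]
  rw [h1]
  split_ifs with hn
  · have h2 : (∮ z in C((0 : ℂ), 1), (z - 0) ^ (n - 1)) = 2 * Real.pi * Complex.I := by
      rw [← circleIntegral.integral_sub_center_inv (0 : ℂ) one_ne_zero]
      simp [hn]
    rw [h2, smul_eq_mul, inv_mul_cancel₀]
    simp [Real.pi_ne_zero]
  · rw [circleIntegral.integral_sub_zpow_of_ne (by omega), smul_zero]

/-- Cauchy's theorem in the annulus for `f z / z`. It lets the radius be chosen freely: 1 for
probabilities, larger than 1 for tails, the saddle radius for asymptotics. -/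
lemma circleAverage_eq_of_differentiableOn {f : ℂ → ℂ} (hf : DifferentiableOn ℂ f {0}ᶜ)
    {r R : ℝ} (hr : 0 < r) (hR : 0 < R) :
    Real.circleAverage f 0 r = Real.circleAverage f 0 R := by
  wlog hrR : r ≤ R generalizing r R
  · exact (this hR hr (le_of_not_ge hrR)).symm
  rw [Real.circleAverage_eq_circleIntegral hr.ne', Real.circleAverage_eq_circleIntegral hR.ne']
  congr 1
  refine (Complex.circleIntegral_sub_center_inv_smul_eq_of_differentiable_on_annulus_off_countable
    hr hrR Set.countable_empty (hf.continuousOn.mono fun z hz => ?_) fun z hz => ?_).symm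
  · rintro rfl
    exact hz.2 (by simpa using hr)
  · refine (hf z ?_).differentiableAt (isOpen_compl_singleton.mem_nhds ?_) <;>
    · rintro rfl
      exact hz.1.2 (by simpa using hr.le)

section Fourier

variable {Ω : Type*} [MeasurableSpace Ω] {P : Measure Ω} [IsProbabilityMeasure P] {D : Ω → ℤ}
  {f : ℂ → ℂ}

lemma circleMap_zero_one (θ : ℝ) : circleMap 0 1 θ = Complex.exp (θ * Complex.I) := by
  simp [circleMap]

/-- Fourier inversion: the weights of an integer-valued variable are the Laurent coefficients of
its generating function. -/
lemma measureReal_eq_circleAverage (hD : AEMeasurable D P) (hf : DifferentiableOn ℂ f {0}ᶜ)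
    (h : ∀ θ : ℝ, ∫ ω, Complex.exp (θ * D ω * Complex.I) ∂P = f (Complex.exp (θ * Complex.I)))
    (k : ℤ) {r : ℝ} (hr : 0 < r) :
    (P.real {ω | D ω = k} : ℂ) = Real.circleAverage (fun z => f z * z ^ (-k)) 0 r := by
  have hd : DifferentiableOn ℂ (fun z => f z * z ^ (-k)) {0}ᶜ := hf.mul fun z hz =>
    (differentiableAt_zpow.2 (Or.inl hz)).differentiableWithinAt
  -- Only the unit circle is accessible to probability: there `z ^ (D ω - k)` has modulus 1, Fubini
  -- applies, and the hypothesis identifies the mean with `f`.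
  rw [circleAverage_eq_of_differentiableOn hd hr one_pos]
  have hset : NullMeasurableSet {ω | D ω = k} P :=
    hD.nullMeasurable (measurableSet_singleton k)
  have h1 : (P.real {ω | D ω = k} : ℂ) =
      ∫ ω, Real.circleAverage (fun z : ℂ => z ^ (D ω - k)) 0 1 ∂P := by
    have h2 : ∀ ω, Real.circleAverage (fun z : ℂ => z ^ (D ω - k)) 0 1 =
        {ω | D ω = k}.indicator (fun _ => (1 : ℂ)) ω := fun ω => by
      rw [circleAverage_zpow]
      by_cases hω : D ω = k
      · simp [hω]
      · simp [hω, sub_eq_zero]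
    simp_rw [h2]
    rw [integral_indicator₀ hset]
    simp
  rw [h1]
  simp_rw [Real.circleAverage_def]
  rw [integral_smul]
  congr 1
  rw [← MeasureTheory.intervalIntegral_integral_swap]
  · refine intervalIntegral.integral_congr fun θ _ => ?_
    simp only [circleMap_zero_one]
    rw [← h θ, ← integral_mul_const]
    congr with ω
    rw [← Complex.exp_int_mul, ← Complex.exp_int_mul, ← Complex.exp_add]
    congr 1
    push_cast
    ring
  · have : IsFiniteMeasure (volume.restrict (Set.uIoc 0 (2 * Real.pi))) :=
      ⟨by rw [Measure.restrict_apply_univ, Set.uIoc, Real.volume_Ioc]; exact ENNReal.ofReal_lt_top⟩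
    refine Integrable.of_bound (C := 1) ?_ (Eventually.of_forall fun p => ?_)
    · have hm : AEMeasurable (fun p : ℝ × Ω => (p.1, D p.2))
          ((volume.restrict (Set.uIoc 0 (2 * Real.pi))).prod P) :=
        measurable_fst.aemeasurable.prodMk hD.comp_snd
      have hg : Measurable fun p : ℝ × ℤ => circleMap 0 1 p.1 ^ (p.2 - k) :=
        measurable_from_prod_countable_left fun n => by
          simp only [circleMap_zero_one, ← Complex.exp_int_mul]
          fun_prop
      exact (hg.comp_aemeasurable hm).aestronglyMeasurable
    · simp only [Function.uncurry, norm_zpow, norm_circleMap_zero, abs_one, one_zpow, le_refl]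

/-- The tail of an integer-valued variable as a contour integral. -/
lemma measureReal_one_le_eq_circleAverage (hD : AEMeasurable D P)
    (hf : DifferentiableOn ℂ f {0}ᶜ)
    (h : ∀ θ : ℝ, ∫ ω, Complex.exp (θ * D ω * Complex.I) ∂P = f (Complex.exp (θ * Complex.I)))
    {r : ℝ} (hr : 1 < r) :
    (P.real {ω | 1 ≤ D ω} : ℂ) = Real.circleAverage (fun z => f z * (z - 1)⁻¹) 0 r := by
  have hr0 : 0 < r := one_pos.trans hr
  have hfc : Continuous fun θ => f (circleMap 0 r θ) :=
    hf.continuousOn.comp_continuous (continuous_circleMap 0 r) fun θ => circleMap_ne_center hr0.ne'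
  have h1 : HasSum (fun n : ℕ => (P.real {ω | D ω = (n : ℤ) + 1} : ℂ))
      (P.real {ω | 1 ≤ D ω} : ℂ) := by
    have h2 : {ω | 1 ≤ D ω} = ⋃ n : ℕ, {ω | D ω = (n : ℤ) + 1} := by
      ext ω
      simp only [Set.mem_ofPred_eq, Set.mem_iUnion]
      constructor
      · intro hω
        exact ⟨(D ω - 1).toNat, by omega⟩
      · rintro ⟨n, hn⟩
        omega
    have hm : ∀ n : ℕ, NullMeasurableSet {ω | D ω = (n : ℤ) + 1} P := fun n =>
      hD.nullMeasurable (measurableSet_singleton _)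
    have hdis : Pairwise (Function.onFun (AEDisjoint P) fun n : ℕ => {ω | D ω = (n : ℤ) + 1}) := by
      intro i j hij
      refine Disjoint.aedisjoint (Set.disjoint_left.2 fun ω h1 h2 => hij ?_)
      simp only [Set.mem_ofPred_eq] at h1 h2
      omega
    have h3 := measure_iUnion₀ hdis hm
    rw [← h2] at h3
    refine Complex.hasSum_ofReal.2 ?_
    have h4 : ∑' n : ℕ, P {ω | D ω = (n : ℤ) + 1} ≠ ∞ := by
      rw [← h3]
      exact measure_ne_top _ _
    have h5 := (ENNReal.summable_toReal h4).hasSum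
    rw [← ENNReal.tsum_toReal_eq fun n => measure_ne_top _ _, ← h3] at h5
    exact h5
  -- On `|z| = r > 1` the geometric series of `z ^ (-(n + 1))` converges uniformly to `(z - 1)⁻¹`;
  -- summing the weights over `k ≥ 1` therefore creates this kernel.
  have h2 : HasSum (fun n : ℕ => Real.circleAverage (fun z => f z * z ^ (-((n : ℤ) + 1))) 0 r)
      (Real.circleAverage (fun z => f z * (z - 1)⁻¹) 0 r) := by
    simp_rw [Real.circleAverage_def]
    refine HasSum.const_smul _ ?_
    refine intervalIntegral.hasSum_integral_of_dominated_convergence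
      (fun (n : ℕ) θ => ‖f (circleMap 0 r θ)‖ * (r⁻¹ * r⁻¹ ^ n)) (fun n => ?_) (fun n => ?_) ?_ ?_
      ?_
    · refine Continuous.aestronglyMeasurable (hfc.mul ?_)
      exact (continuous_circleMap 0 r).zpow₀ _ fun θ => Or.inl (circleMap_ne_center hr0.ne')
    · refine Eventually.of_forall fun θ _ => le_of_eq ?_
      rw [norm_mul, norm_zpow, norm_circleMap_zero, abs_of_pos hr0, zpow_neg, ← inv_zpow,
        zpow_add_one₀ (inv_ne_zero hr0.ne'), zpow_natCast, mul_comm (r⁻¹ ^ n)]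
    · refine Eventually.of_forall fun θ _ => ?_
      exact ((summable_geometric_of_lt_one (by positivity) (inv_lt_one_of_one_lt₀ hr)).mul_left
        _).mul_left _
    · simp_rw [tsum_mul_left]
      exact (hfc.norm.mul continuous_const).intervalIntegrable _ _
    · refine Eventually.of_forall fun θ _ => ?_
      have hz : circleMap 0 r θ ≠ 0 := circleMap_ne_center hr0.ne'
      have hz1 : ‖(circleMap 0 r θ)⁻¹‖ < 1 := by
        rw [norm_inv, norm_circleMap_zero, abs_of_pos hr0]
        exact inv_lt_one_of_one_lt₀ hr
      have h6 := ((hasSum_geometric_of_norm_lt_one hz1).mul_left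
        (circleMap 0 r θ)⁻¹).mul_left (f (circleMap 0 r θ))
      have e1 : ∀ n : ℕ, f (circleMap 0 r θ) * circleMap 0 r θ ^ (-((n : ℤ) + 1)) =
          f (circleMap 0 r θ) * ((circleMap 0 r θ)⁻¹ * (circleMap 0 r θ)⁻¹ ^ n) := fun n => by
        rw [zpow_neg, ← inv_zpow, zpow_add_one₀ (inv_ne_zero hz), zpow_natCast,
          mul_comm ((circleMap 0 r θ)⁻¹ ^ n)]
      have e2 : (circleMap 0 r θ - 1)⁻¹ =
          (circleMap 0 r θ)⁻¹ * (1 - (circleMap 0 r θ)⁻¹)⁻¹ := by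
        rw [← mul_inv, mul_sub, mul_inv_cancel₀ hz, mul_one]
      simp_rw [e1, e2]
      exact h6
  have h3 : ∀ n : ℕ, (P.real {ω | D ω = (n : ℤ) + 1} : ℂ) =
      Real.circleAverage (fun z => f z * z ^ (-((n : ℤ) + 1))) 0 r := fun n =>
    measureReal_eq_circleAverage hD hf h _ hr0
  simp_rw [h3] at h1
  exact h1.unique h2

end Fourier

/-! ### Scaled modified Bessel functions -/

/-- Differentiation under the integral sign for a continuous derivative on a compact interval. -/
lemma hasDerivAt_intervalIntegral_of_continuous {𝕜 : Type*} [RCLike 𝕜] {F F' : 𝕜 → ℝ → ℂ}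
    [NormedSpace 𝕜 ℂ] {x : 𝕜} {a b ε : ℝ} (hε : 0 < ε)
    (hF : ∀ y ∈ Metric.closedBall x ε, Continuous (F y))
    (hF' : ContinuousOn (fun p : 𝕜 × ℝ => F' p.1 p.2) (Metric.closedBall x ε ×ˢ Set.univ))
    (h : ∀ y ∈ Metric.closedBall x ε, ∀ θ, HasDerivAt (fun y => F y θ) (F' y θ) y) :
    HasDerivAt (fun y => ∫ θ in a..b, F y θ) (∫ θ in a..b, F' x θ) x := by
  have hK : IsCompact (Metric.closedBall x ε ×ˢ Set.uIcc a b) :=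
    (isCompact_closedBall x ε).prod isCompact_uIcc
  obtain ⟨C, hC⟩ := hK.exists_bound_of_continuousOn
    (hF'.mono (Set.prod_mono_right (Set.subset_univ _)))
  have hx : x ∈ Metric.closedBall x ε := Metric.mem_closedBall_self hε.le
  refine (intervalIntegral.hasDerivAt_integral_of_dominated_loc_of_deriv_le
    (bound := fun _ => C) (Metric.ball_mem_nhds x hε) ?_ ((hF x hx).intervalIntegrable _ _) ?_ ?_
    intervalIntegrable_const ?_).2
  · filter_upwards [Metric.ball_mem_nhds x hε] with y hy
    exact (hF y (Metric.ball_subset_closedBall hy)).aestronglyMeasurable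
  · refine Continuous.aestronglyMeasurable ?_
    exact hF'.comp_continuous (by fun_prop : Continuous fun θ : ℝ => (x, θ))
      fun θ => ⟨hx, Set.mem_univ _⟩
  · refine Eventually.of_forall fun θ hθ y hy => hC (y, θ) ⟨Metric.ball_subset_closedBall hy, ?_⟩
    exact Set.uIoc_subset_uIcc hθ
  · exact Eventually.of_forall fun θ _ y hy => h y (Metric.ball_subset_closedBall hy) θ

/-- The scaled modified Bessel function `e^{-s} I_k(s)`. -/
def bess (k : ℕ) (s : ℝ) : ℝ :=
  (2 * Real.pi)⁻¹ * ∫ θ in -Real.pi..Real.pi, Real.exp (-s * (1 - Real.cos θ)) * Real.cos (k * θ)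

/-- The scaled modified Bessel function `e^{-s} I_k(s)` on the complex plane. -/
def bessC (k : ℕ) (s : ℂ) : ℂ :=
  (2 * Real.pi : ℂ)⁻¹ * ∫ θ in -Real.pi..Real.pi,
    Complex.exp (-s * (1 - Real.cos θ)) * Real.cos (k * θ)

lemma bessC_ofReal (k : ℕ) (s : ℝ) : bessC k s = bess k s := by
  rw [bessC, bess]
  push_cast
  rw [← intervalIntegral.integral_ofReal]
  push_cast
  rfl

lemma differentiable_bessC (k : ℕ) : Differentiable ℂ (bessC k) := by
  intro s
  refine DifferentiableAt.const_mul ?_ _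
  refine (hasDerivAt_intervalIntegral_of_continuous (ε := 1)
    (F := fun s θ => Complex.exp (-s * (1 - Real.cos θ)) * Real.cos (k * θ))
    (F' := fun s θ => Complex.exp (-s * (1 - Real.cos θ)) * (-1 * (1 - Real.cos θ)) *
      Real.cos (k * θ)) one_pos (fun y _ => ?_) ?_ fun y _ θ => ?_).differentiableAt
  · fun_prop
  · refine Continuous.continuousOn ?_
    fun_prop
  · exact (((hasDerivAt_id y).neg.mul_const _).cexp).mul_const _

/-- On the unit circle `(z + z⁻¹) / 2 = cos θ` is even in `θ`, so `G` may be replaced by its even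
part, which yields the cosines of the Bessel integrals. -/
lemma circleAverage_exp_mul (s : ℂ) {G : ℂ → ℂ} (hG : Continuous fun θ => G (circleMap 0 1 θ)) :
    Real.circleAverage (fun z => Complex.exp (-s * (1 - (z + z⁻¹) / 2)) * G z) 0 1 =
      (2 * Real.pi : ℂ)⁻¹ * ∫ θ in -Real.pi..Real.pi,
        Complex.exp (-s * (1 - Real.cos θ)) * ((G (Complex.exp (θ * Complex.I)) +
          G (Complex.exp (-θ * Complex.I))) / 2) := by
  have h1 : ∀ θ : ℝ, (circleMap 0 1 θ + (circleMap 0 1 θ)⁻¹) / 2 = Real.cos θ := fun θ => by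
    rw [circleMap_zero_one, ← Complex.exp_neg, Complex.ofReal_cos, Complex.cos]
    ring_nf
  let f : ℝ → ℂ := fun θ => Complex.exp (-s * (1 - Real.cos θ)) * G (circleMap 0 1 θ)
  have hf : Continuous f := (by fun_prop :
    Continuous fun θ : ℝ => Complex.exp (-s * (1 - Real.cos θ))).mul hG
  have hfn : Continuous fun θ => f (-θ) := hf.comp continuous_neg
  have hper : Function.Periodic f (2 * Real.pi) := fun θ => by
    simp only [f, Real.cos_add_two_pi, periodic_circleMap 0 1 θ]
  have h2 : ∫ θ in (0 : ℝ)..2 * Real.pi, f θ = ∫ θ in -Real.pi..Real.pi, f θ := by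
    have := hper.intervalIntegral_add_eq 0 (-Real.pi)
    rwa [zero_add, show -Real.pi + 2 * Real.pi = Real.pi by ring] at this
  have h3 : ∫ θ in -Real.pi..Real.pi, f θ = ∫ θ in -Real.pi..Real.pi, f (-θ) := by
    rw [intervalIntegral.integral_comp_neg, neg_neg]
  have h4 : ∫ θ in -Real.pi..Real.pi, f θ =
      ∫ θ in -Real.pi..Real.pi, (f θ + f (-θ)) / 2 := by
    rw [intervalIntegral.integral_div, intervalIntegral.integral_add
      (hf.intervalIntegrable _ _) (hfn.intervalIntegrable _ _), ← h3]
    ring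
  rw [Real.circleAverage_def]
  simp only [h1]
  rw [Complex.real_smul, Complex.ofReal_inv, Complex.ofReal_mul, Complex.ofReal_ofNat]
  congr 1
  refine (h2.trans h4).trans ?_
  refine intervalIntegral.integral_congr fun θ _ => ?_
  simp only [f, Real.cos_neg, circleMap_zero_one, Complex.ofReal_neg]
  ring

lemma circleAverage_exp_eq_bessC (s α β γ : ℂ) :
    Real.circleAverage (fun z => Complex.exp (-s * (1 - (z + z⁻¹) / 2)) *
      (α + β * z + γ * z⁻¹)) 0 1 = α * bessC 0 s + (β + γ) * bessC 1 s := by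
  have hz : ∀ θ, circleMap 0 1 θ ≠ 0 := fun θ => circleMap_ne_center one_ne_zero
  have hc := continuous_circleMap 0 1
  rw [circleAverage_exp_mul s (G := fun z => α + β * z + γ * z⁻¹)
    ((continuous_const.add (continuous_const.mul hc)).add (continuous_const.mul (hc.inv₀ hz)))]
  have hI : ∀ x y A B : ℂ, x * ((2 * Real.pi : ℂ)⁻¹ * A) + y * ((2 * Real.pi : ℂ)⁻¹ * B) =
      (2 * Real.pi : ℂ)⁻¹ * (x * A + y * B) := fun x y A B => by ring
  rw [bessC, bessC, hI]
  congr 1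
  rw [← intervalIntegral.integral_const_mul, ← intervalIntegral.integral_const_mul,
    ← intervalIntegral.integral_add]
  · refine intervalIntegral.integral_congr fun θ _ => ?_
    simp only [← Complex.exp_neg, Complex.ofReal_cos, Nat.cast_zero, zero_mul, Nat.cast_one,
      one_mul, Complex.ofReal_zero, neg_zero, Complex.exp_zero, Complex.cos]
    ring_nf
  · exact Continuous.intervalIntegrable (by fun_prop) _ _
  · exact Continuous.intervalIntegrable (by fun_prop) _ _

lemma continuous_bess (k : ℕ) : Continuous (bess k) := by
  have h1 : Continuous fun s : ℝ => (bessC k s).re :=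
    Complex.continuous_re.comp ((differentiable_bessC k).continuous.comp Complex.continuous_ofReal)
  simpa [bessC_ofReal] using h1

lemma bess_zero_pos (s : ℝ) : 0 < bess 0 s := by
  refine mul_pos (by positivity) ?_
  refine intervalIntegral.intervalIntegral_pos_of_pos (Continuous.intervalIntegrable
    (by fun_prop) _ _) (fun θ => ?_) (by linarith [Real.pi_pos])
  simpa using Real.exp_pos _

/-- The integral of `exp (-s) * cos θ` vanishes and can be subtracted; `exp (-s (1 - cos θ)) - exp
(-s)` has the sign of `cos θ`, so the remaining integrand is nonnegative. -/
lemma bess_one_nonneg {s : ℝ} (hs : 0 ≤ s) : 0 ≤ bess 1 s := by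
  refine mul_nonneg (by positivity) ?_
  have h0 : ∫ θ in -Real.pi..Real.pi, Real.exp (-s) * Real.cos θ = 0 := by
    rw [intervalIntegral.integral_const_mul, integral_cos]
    simp
  rw [← h0]
  refine intervalIntegral.integral_mono_on (by linarith [Real.pi_pos])
    (Continuous.intervalIntegrable (by fun_prop) _ _)
    (Continuous.intervalIntegrable (by fun_prop) _ _) fun θ _ => ?_
  simp only [Nat.cast_one, one_mul]
  rcases le_total 0 (Real.cos θ) with h | h
  · refine mul_le_mul_of_nonneg_right (Real.exp_le_exp.2 ?_) h
    nlinarith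
  · refine mul_le_mul_of_nonpos_right (Real.exp_le_exp.2 ?_) h
    nlinarith

/-- The inequality `cos θ ≤ 1 - 2 θ ^ 2 / π ^ 2` on `[-π, π]` dominates the integrand by a Gaussian.
The constant is crude; what matters is the decay `(Re s) ^ (-1/2)` in the complex half-plane. -/
lemma norm_bessC_le (k : ℕ) {s : ℂ} (hs : 0 < s.re) : ‖bessC k s‖ ≤ √(Real.pi / s.re) := by
  have hpi := Real.pi_pos
  have h1 : ‖∫ θ in -Real.pi..Real.pi, Complex.exp (-s * (1 - Real.cos θ)) * Real.cos (k * θ)‖ ≤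
      ∫ θ in -Real.pi..Real.pi, Real.exp (-(s.re * (2 / Real.pi ^ 2)) * θ ^ 2) := by
    refine intervalIntegral.norm_integral_le_of_norm_le (by linarith) ?_
      (Continuous.intervalIntegrable (by fun_prop) _ _)
    refine Eventually.of_forall fun θ hθ => ?_
    rw [norm_mul, Complex.norm_exp, Complex.norm_real]
    have h2 : (-s * (1 - Real.cos θ)).re = -s.re * (1 - Real.cos θ) := by
      rw [show -s * (1 - (Real.cos θ : ℂ)) = ((1 - Real.cos θ : ℝ) : ℂ) * (-s) by
        push_cast; ring, Complex.re_ofReal_mul, Complex.neg_re]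
      ring
    rw [h2]
    have h3 : Real.cos θ ≤ 1 - 2 / Real.pi ^ 2 * θ ^ 2 :=
      Real.cos_le_one_sub_mul_cos_sq (abs_le.2 ⟨hθ.1.le, hθ.2⟩)
    refine (mul_le_of_le_one_right (Real.exp_pos _).le (Real.abs_cos_le_one _)).trans ?_
    refine Real.exp_le_exp.2 ?_
    nlinarith
  have h4 : ∫ θ in -Real.pi..Real.pi, Real.exp (-(s.re * (2 / Real.pi ^ 2)) * θ ^ 2) ≤
      √(Real.pi / (s.re * (2 / Real.pi ^ 2))) := by
    rw [← integral_gaussian, intervalIntegral.integral_of_le (by linarith)]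
    exact setIntegral_le_integral (integrable_exp_neg_mul_sq (by positivity))
      (Eventually.of_forall fun θ => (Real.exp_pos _).le)
  rw [bessC, norm_mul, norm_inv, norm_mul, Complex.norm_real, Complex.norm_ofNat,
    Real.norm_of_nonneg hpi.le, inv_mul_le_iff₀ (by positivity)]
  refine (h1.trans h4).trans ?_
  rw [show Real.pi / (s.re * (2 / Real.pi ^ 2)) = (Real.pi ^ 2 / 2) * (Real.pi / s.re) by
    field_simp, Real.sqrt_mul (by positivity)]
  refine mul_le_mul_of_nonneg_right ?_ (Real.sqrt_nonneg _)
  rw [Real.sqrt_le_left (by positivity)]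
  nlinarith [sq_nonneg Real.pi]

/-- On `0 ≤ θ ≤ 1 / s` the exponent is at least `-1`. The true order is `s ^ (-1/2)`, but any power
is invisible at logarithmic precision. -/
lemma bess_zero_ge {s : ℝ} (hs : 1 ≤ s) : (2 * Real.pi)⁻¹ * Real.exp (-1) / s ≤ bess 0 s := by
  have hpi := Real.pi_gt_three
  have hs0 : 0 < s := one_pos.trans_le hs
  have hs1 : s⁻¹ ≤ 1 := inv_le_one_of_one_le₀ hs
  rw [bess, mul_div_assoc]
  refine mul_le_mul_of_nonneg_left ?_ (by positivity)
  have h1 : ∫ θ in (0 : ℝ)..s⁻¹, Real.exp (-1) ≤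
      ∫ θ in (0 : ℝ)..s⁻¹, Real.exp (-s * (1 - Real.cos θ)) * Real.cos ((0 : ℕ) * θ) := by
    refine intervalIntegral.integral_mono_on (by positivity) intervalIntegrable_const
      (Continuous.intervalIntegrable (by fun_prop) _ _) fun θ hθ => ?_
    simp only [Nat.cast_zero, zero_mul, Real.cos_zero, mul_one]
    refine Real.exp_le_exp.2 ?_
    have h2 := Real.one_sub_sq_div_two_le_cos (x := θ)
    have h3 : θ ^ 2 ≤ s⁻¹ := by
      have := mul_le_mul hθ.2 (hθ.2.trans hs1) hθ.1 (by positivity)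
      nlinarith
    have h4 : s * s⁻¹ = 1 := mul_inv_cancel₀ hs0.ne'
    nlinarith
  rw [intervalIntegral.integral_const, smul_eq_mul, sub_zero, mul_comm, ← div_eq_mul_inv] at h1
  refine h1.trans ?_
  refine intervalIntegral.integral_mono_interval (by linarith) (by positivity) (by linarith)
    (Eventually.of_forall fun θ => ?_) (Continuous.intervalIntegrable (by fun_prop) _ _)
  simpa using (Real.exp_pos _).le

/-! ### The density of the tracer -/

/-- The exponent of the generating function of the crossing number. -/
def crossExp (ρ s x : ℝ) (z : ℂ) : ℂ :=
  ρ * tailInt s x * (z - 1) + ρ * tailInt s (-x) * (z⁻¹ - 1)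

/-- The generating function of the crossing number of the level `x`. -/
def crossGen (ρ s x : ℝ) (z : ℂ) : ℂ :=
  Complex.exp (crossExp ρ s x z) * (1 + (z - 1) * gaussTail s x)

/-- The argument of the Bessel functions in the density of the tracer. -/
def besselArg (s x : ℝ) : ℝ := 2 * √(tailInt s x * tailInt s (-x))

/-- The density at `x` of a tracer in a system of density `ρ` whose free particles have had a
displacement of variance `s ^ 2 / 2`. -/
def tracerDens (ρ s x : ℝ) : ℝ :=
  Real.exp (-phiA ρ s x) *
    ((gaussDens s x + 2 * ρ * gaussTail s x * (1 - gaussTail s x)) * bess 0 (ρ * besselArg s x) +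
      ρ * ((1 - gaussTail s x) ^ 2 * (2 * tailInt s x) + gaussTail s x ^ 2 * (2 * tailInt s (-x))) /
        besselArg s x * bess 1 (ρ * besselArg s x))

section

variable {ρ s : ℝ}

lemma differentiableOn_crossExp (ρ s x : ℝ) : DifferentiableOn ℂ (crossExp ρ s x) {0}ᶜ :=
  fun z hz => by
    have hz' : z ≠ 0 := hz
    unfold crossExp
    exact (((differentiableAt_id.sub_const _).const_mul _).add
      (((differentiableAt_inv hz').sub_const _).const_mul _)).differentiableWithinAt

lemma differentiableOn_crossGen (ρ s x : ℝ) : DifferentiableOn ℂ (crossGen ρ s x) {0}ᶜ :=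
  (differentiableOn_crossExp ρ s x).cexp.mul (by fun_prop)

lemma besselArg_pos (hs : 0 < s) (x : ℝ) : 0 < besselArg s x := by
  have h1 := tailInt_pos hs x
  have h2 := tailInt_pos hs (-x)
  unfold besselArg
  positivity

lemma besselArg_neg (s x : ℝ) : besselArg s (-x) = besselArg s x := by
  rw [besselArg, besselArg, neg_neg, mul_comm (tailInt s (-x))]

lemma continuous_besselArg (hs : 0 < s) : Continuous (besselArg s) := by
  have := continuous_tailInt hs
  unfold besselArg
  fun_prop

lemma phiA_eq_sub (hs : 0 < s) (ρ x : ℝ) :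
    phiA ρ s x = ρ * (tailInt s x + tailInt s (-x) - besselArg s x) := by
  have h1 := (tailInt_pos hs x).le
  have h2 := (tailInt_pos hs (-x)).le
  rw [phiA_eq hs, besselArg, Real.sqrt_mul h1, sub_sq, Real.sq_sqrt h1, Real.sq_sqrt h2]
  ring

lemma continuous_phiA (hs : 0 < s) (ρ : ℝ) : Continuous (phiA ρ s) := by
  have h1 := continuous_tailInt hs
  have h2 := continuous_besselArg hs
  have : phiA ρ s = fun x => ρ * (tailInt s x + tailInt s (-x) - besselArg s x) :=
    funext (phiA_eq_sub hs ρ)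
  rw [this]
  fun_prop

lemma phiA_neg (ρ s x : ℝ) : phiA ρ s (-x) = phiA ρ s x := by
  rw [phiA, phiA, neg_neg, ← neg_sub, neg_sq]

lemma continuous_tracerDens (hs : 0 < s) (ρ : ℝ) : Continuous (tracerDens ρ s) := by
  have h1 := continuous_tailInt hs
  have h2 := continuous_besselArg hs
  have h3 := continuous_phiA hs ρ
  have h4 := continuous_gaussTail hs
  have h5 := continuous_gaussDens hs
  have h6 := continuous_bess 0
  have h7 := continuous_bess 1
  have h8 : ∀ x, besselArg s x ≠ 0 := fun x => (besselArg_pos hs x).ne'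
  unfold tracerDens
  fun_prop (disch := assumption)

/-- All other terms of the density are nonnegative; this one alone already has the right exponential
order. -/
lemma gaussDens_mul_bess_le_tracerDens (hρ : 0 < ρ) (hs : 0 < s) (x : ℝ) :
    Real.exp (-phiA ρ s x) * (gaussDens s x * bess 0 (ρ * besselArg s x)) ≤ tracerDens ρ s x := by
  have h1 := tailInt_pos hs x
  have h2 := tailInt_pos hs (-x)
  have h3 := besselArg_pos hs x
  have h4 := gaussTail_pos s x
  have h5 := sub_pos.2 (gaussTail_lt_one s x)
  have h6 := bess_zero_pos (ρ * besselArg s x)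
  have h7 := bess_one_nonneg (mul_pos hρ h3).le
  refine mul_le_mul_of_nonneg_left ?_ (Real.exp_pos _).le
  rw [add_mul, add_assoc]
  exact le_add_of_nonneg_right (by positivity)

lemma tracerDens_pos (hρ : 0 < ρ) (hs : 0 < s) (x : ℝ) : 0 < tracerDens ρ s x := by
  refine lt_of_lt_of_le ?_ (gaussDens_mul_bess_le_tracerDens hρ hs x)
  have h5 := gaussDens_pos hs x
  have h6 := bess_zero_pos (ρ * besselArg s x)
  positivity

lemma tracerDens_neg (ρ s x : ℝ) : tracerDens ρ s (-x) = tracerDens ρ s x := by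
  rw [tracerDens, tracerDens, phiA_neg, besselArg_neg, gaussDens_neg, gaussTail_neg, neg_neg]
  ring_nf

/-- A contour integral of the generating function on the circle through the saddle points. -/
lemma circleAverage_exp_crossExp (hs : 0 < s) (ρ x α β γ : ℝ) {r : ℝ} (hr : 0 < r) :
    Real.circleAverage (fun z => Complex.exp (crossExp ρ s x z) * (α + β * z + γ * z⁻¹)) 0 r =
      Real.exp (-phiA ρ s x) * (α * bess 0 (ρ * besselArg s x) +
        (β * (2 * tailInt s (-x)) + γ * (2 * tailInt s x)) / besselArg s x *
          bess 1 (ρ * besselArg s x) : ℝ) := by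
  have h1 := tailInt_pos hs x
  have h2 := tailInt_pos hs (-x)
  have h3 := besselArg_pos hs x
  -- `R = √(tailInt s (-x) / tailInt s x)` is the saddle radius: after `z ↦ R z` the coefficients of
  -- `z` and `z⁻¹` in the exponent are both `ρ * besselArg s x / 2`, as in the generating function
  -- of the Bessel functions.
  set R : ℝ := 2 * tailInt s (-x) / besselArg s x with hR
  have hR0 : 0 < R := by positivity
  have hw : besselArg s x ^ 2 = 4 * (tailInt s x * tailInt s (-x)) := by
    rw [besselArg, mul_pow, Real.sq_sqrt (by positivity)]
    ring
  have hR1 : R⁻¹ = 2 * tailInt s x / besselArg s x := by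
    rw [hR, inv_div, div_eq_div_iff (by positivity) (by positivity)]
    linear_combination hw
  have hAR : tailInt s x * R = besselArg s x / 2 := by
    rw [hR]
    field_simp
    linear_combination -hw
  have hBR : tailInt s (-x) * R⁻¹ = besselArg s x / 2 := by
    rw [hR1]
    field_simp
    linear_combination -hw
  have hd : DifferentiableOn ℂ
      (fun z => Complex.exp (crossExp ρ s x z) * (α + β * z + γ * z⁻¹)) {0}ᶜ := by
    refine (differentiableOn_crossExp ρ s x).cexp.mul fun z hz => ?_
    have hz' : z ≠ 0 := hz
    exact (((differentiableAt_const _).add (differentiableAt_id.const_mul _)).add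
      ((differentiableAt_inv hz').const_mul _)).differentiableWithinAt
  rw [circleAverage_eq_of_differentiableOn hd hr hR0, Real.circleAverage_eq_circleAverage_zero_one]
  have hcong : Set.EqOn (fun z : ℂ => Complex.exp (crossExp ρ s x (R * z + 0)) *
      (α + β * (R * z + 0) + γ * (R * z + 0)⁻¹))
      (fun z => (Real.exp (-phiA ρ s x) : ℂ) • (Complex.exp (-((ρ * besselArg s x : ℝ) : ℂ) *
        (1 - (z + z⁻¹) / 2)) * ((α : ℂ) + ((β * R : ℝ) : ℂ) * z + ((γ * R⁻¹ : ℝ) : ℂ) * z⁻¹)))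
      (Metric.sphere 0 |1|) := fun z _ => by
    simp only [add_zero, smul_eq_mul]
    refine Eq.trans ?_ (mul_assoc _ _ _)
    rw [Complex.ofReal_exp, ← Complex.exp_add]
    congr 1
    · congr 1
      rw [crossExp, mul_inv, phiA_eq_sub hs]
      have e1 : ((tailInt s x : ℝ) : ℂ) * R = besselArg s x / 2 := by exact_mod_cast hAR
      have e2 : ((tailInt s (-x) : ℝ) : ℂ) * (R : ℂ)⁻¹ = besselArg s x / 2 := by
        exact_mod_cast hBR
      push_cast
      linear_combination (ρ * z) * e1 + (ρ * z⁻¹) * e2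
    · push_cast
      rw [mul_inv]
      ring
  rw [Real.circleAverage_congr_sphere hcong, Real.circleAverage_fun_smul,
    circleAverage_exp_eq_bessC, bessC_ofReal, bessC_ofReal, smul_eq_mul, hR1, hR]
  push_cast
  ring

/-- Write `q = gaussTail s x`. The `x`-derivative of the exponent is `-ρ (z - 1) (q + (1 - q) z⁻¹)`,
and that of the last factor is `-(z - 1) * gaussDens s x`. Both are divisible by `z - 1`, so the
pole disappears and a Laurent polynomial of degrees `-1, 0, 1` remains. The radius 2 is an arbitrary
one above 1. -/
lemma hasDerivAt_circleAverage_crossGen (hs : 0 < s) (ρ x : ℝ) :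
    HasDerivAt (fun y => Real.circleAverage (fun z => crossGen ρ s y z * (z - 1)⁻¹) 0 2)
      (-(tracerDens ρ s x : ℂ)) x := by
  have hz : ∀ θ, circleMap 0 2 θ ≠ 0 := fun θ => circleMap_ne_center two_ne_zero
  have hz1 : ∀ θ, circleMap 0 2 θ - 1 ≠ 0 := fun θ h => by
    have := norm_circleMap_zero 2 θ
    rw [sub_eq_zero.1 h] at this
    norm_num at this
  have hc := continuous_circleMap 0 2
  have c1 := continuous_tailInt hs
  have c2 := continuous_gaussTail hs
  have c3 := continuous_gaussDens hs
  have h1 : HasDerivAt (fun y => ∫ θ in (0 : ℝ)..2 * Real.pi,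
      crossGen ρ s y (circleMap 0 2 θ) * (circleMap 0 2 θ - 1)⁻¹)
      (∫ θ in (0 : ℝ)..2 * Real.pi, -(Complex.exp (crossExp ρ s x (circleMap 0 2 θ)) *
        (((gaussDens s x + 2 * ρ * gaussTail s x * (1 - gaussTail s x) : ℝ) : ℂ) +
          ((ρ * gaussTail s x ^ 2 : ℝ) : ℂ) * circleMap 0 2 θ +
          ((ρ * (1 - gaussTail s x) ^ 2 : ℝ) : ℂ) * (circleMap 0 2 θ)⁻¹))) x := by
    refine hasDerivAt_intervalIntegral_of_continuous (𝕜 := ℝ) (ε := 1)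
      (F := fun y θ => crossGen ρ s y (circleMap 0 2 θ) * (circleMap 0 2 θ - 1)⁻¹)
      (F' := fun x θ => -(Complex.exp (crossExp ρ s x (circleMap 0 2 θ)) *
        (((gaussDens s x + 2 * ρ * gaussTail s x * (1 - gaussTail s x) : ℝ) : ℂ) +
          ((ρ * gaussTail s x ^ 2 : ℝ) : ℂ) * circleMap 0 2 θ +
          ((ρ * (1 - gaussTail s x) ^ 2 : ℝ) : ℂ) * (circleMap 0 2 θ)⁻¹)))
      one_pos (fun y _ => ?_) (Continuous.continuousOn ?_) fun y _ θ => ?_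
    · unfold crossGen crossExp
      fun_prop (disch := assumption)
    · have hz' : ∀ p : ℝ × ℝ, circleMap 0 2 p.2 ≠ 0 := fun p => hz p.2
      unfold crossExp
      fun_prop (disch := assumption)
    · have d1 := (hasDerivAt_tailInt hs y).ofReal_comp
      have d2 := ((hasDerivAt_tailInt hs (-y)).comp y (hasDerivAt_neg y)).ofReal_comp
      have d3 := (hasDerivAt_gaussTail hs y).ofReal_comp
      have d4 := ((d1.const_mul (ρ : ℂ)).mul_const (circleMap 0 2 θ - 1)).add
        ((d2.const_mul (ρ : ℂ)).mul_const ((circleMap 0 2 θ)⁻¹ - 1))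
      have d5 := (d4.cexp.mul ((d3.const_mul (circleMap 0 2 θ - 1)).const_add 1)).mul_const
        (circleMap 0 2 θ - 1)⁻¹
      refine d5.congr_deriv ?_
      have e1 := hz θ
      have e2 := hz1 θ
      rw [gaussTail_neg]
      simp only [Pi.add_apply, Function.comp_apply, crossExp]
      push_cast
      field_simp
      ring
  have h2 := h1.const_smul ((2 * Real.pi)⁻¹ : ℝ)
  simp only [Real.circleAverage_def]
  refine h2.congr_deriv ?_
  rw [intervalIntegral.integral_neg, smul_neg, ← Real.circleAverage_def
    (f := fun z => Complex.exp (crossExp ρ s x z) *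
        (((gaussDens s x + 2 * ρ * gaussTail s x * (1 - gaussTail s x) : ℝ) : ℂ) +
          ((ρ * gaussTail s x ^ 2 : ℝ) : ℂ) * z +
          ((ρ * (1 - gaussTail s x) ^ 2 : ℝ) : ℂ) * z⁻¹)),
    circleAverage_exp_crossExp hs _ _ _ _ _ two_pos, tracerDens]
  push_cast
  ring

end

/-! ### The law of the tracer and a lower bound on its tail -/

section Law

variable {Ω : Type*} [MeasurableSpace Ω] {P : Measure Ω} [IsProbabilityMeasure P] {ρ s : ℝ}
  {Z : Ω → ℝ}

/-- A random variable with the tails of the tracer has the density of the tracer. -/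
lemma map_eq_withDensity_tracerDens (hρ : 0 < ρ) (hs : 0 < s) (hZ : Measurable Z)
    (h : ∀ x r, 1 < r → (P.real {ω | x < Z ω} : ℂ) =
      Real.circleAverage (fun z => crossGen ρ s x z * (z - 1)⁻¹) 0 r) :
    P.map Z = volume.withDensity fun x => ENNReal.ofReal (tracerDens ρ s x) := by
  have hd : ∀ x, HasDerivAt (fun y => P.real {ω | y < Z ω}) (-tracerDens ρ s x) x := fun x => by
    have h1 := hasDerivAt_circleAverage_crossGen hs ρ x
    simp_rw [← h _ 2 one_lt_two] at h1
    have h2 := Complex.reCLM.hasFDerivAt.comp_hasDerivAt x h1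
    exact h2.congr_deriv (by simp)
  have : IsProbabilityMeasure (P.map Z) := Measure.isProbabilityMeasure_map hZ.aemeasurable
  refine Measure.ext_of_Ioc _ _ fun a b hab => ?_
  have hpre : Z ⁻¹' Set.Ioc a b = {ω | a < Z ω} \ {ω | b < Z ω} := by
    ext ω
    simp
  have hsub : {ω | b < Z ω} ⊆ {ω | a < Z ω} := fun ω hω => hab.trans hω
  have hftc := intervalIntegral.integral_eq_sub_of_hasDerivAt (a := a) (b := b)
    (fun x _ => hd x) ((continuous_tracerDens hs ρ).neg.intervalIntegrable _ _)
  rw [intervalIntegral.integral_neg] at hftc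
  rw [Measure.map_apply hZ measurableSet_Ioc, hpre, withDensity_apply _ measurableSet_Ioc,
    ← ofReal_integral_eq_lintegral_ofReal, ← intervalIntegral.integral_of_le hab.le,
    show ∫ x in a..b, tracerDens ρ s x = P.real {ω | a < Z ω} - P.real {ω | b < Z ω} by linarith,
    ← measureReal_sdiff hsub (measurableSet_lt measurable_const hZ), ofReal_measureReal]
  · exact (continuous_tracerDens hs ρ).integrableOn_Ioc
  · exact Eventually.of_forall fun x => (tracerDens_pos hρ hs x).le

end Law

section Tracer

variable {Ω : Type*} [MeasurableSpace Ω] {P : Measure Ω} [IsProbabilityMeasure P] {ρ σ : ℝ}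
  {Y : ℤ → Ω → ℝ} {B X : ℤ → ℝ≥0 → Ω → ℝ}

lemma sq_scale (σ : ℝ) (t : ℝ≥0) : (σ / √2) ^ 2 * t = (σ * √(t : ℝ)) ^ 2 / 2 := by
  rw [div_pow, mul_pow, Real.sq_sqrt zero_le_two, Real.sq_sqrt t.coe_nonneg]
  ring

lemma IsAnnealedSingleFile.measureReal_eq_crossing (h : IsAnnealedSingleFile ρ σ Y B X P)
    (t : ℝ≥0) (x : ℝ) : P.real {ω | x < X 0 t ω} =
      P.real {ω | 1 ≤ crossing (fun j => Y j ω + σ / √2 * B j t ω) x} := by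
  refine measureReal_congr ?_
  filter_upwards [h.ae_lt_tracer_iff t] with ω hω
  exact propext (hω x)

lemma IsAnnealedSingleFile.tail_eq_circleAverage (h : IsAnnealedSingleFile ρ σ Y B X P)
    (hρ : 0 < ρ) (hσ : 0 < σ) {t : ℝ≥0} (ht : 0 < t) (x : ℝ) {r : ℝ} (hr : 1 < r) :
    (P.real {ω | x < X 0 t ω} : ℂ) =
      Real.circleAverage (fun z => crossGen ρ (σ * √(t : ℝ)) x z * (z - 1)⁻¹) 0 r := by
  have hs : 0 < σ * √(t : ℝ) := by positivity
  rw [h.measureReal_eq_crossing t x]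
  exact measureReal_one_le_eq_circleAverage (h.aemeasurable_crossing t x)
    (differentiableOn_crossGen _ _ _)
    (fun θ => h.integral_exp_crossing hρ hs (sq_scale σ t) x θ) hr

/-- The tail is bounded below by the probability that the crossing number is exactly 1. This is a
Laurent coefficient, so the pole at `z = 1` never appears; of the two resulting Bessel terms the
second is dropped. -/
lemma IsAnnealedSingleFile.le_tail (h : IsAnnealedSingleFile ρ σ Y B X P)
    (hρ : 0 < ρ) (hσ : 0 < σ) {t : ℝ≥0} (ht : 0 < t) (x : ℝ) :
    gaussTail (σ * √(t : ℝ)) x * (Real.exp (-phiA ρ (σ * √(t : ℝ)) x) *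
      bess 0 (ρ * besselArg (σ * √(t : ℝ)) x)) ≤ P.real {ω | x < X 0 t ω} := by
  have hs : 0 < σ * √(t : ℝ) := by positivity
  set s := σ * √(t : ℝ)
  have h1 := measureReal_eq_circleAverage (h.aemeasurable_crossing t x)
    (differentiableOn_crossGen ρ s x)
    (fun θ => h.integral_exp_crossing hρ hs (sq_scale σ t) x θ) 1 one_pos
  have h2 : Set.EqOn (fun z => crossGen ρ s x z * z ^ (-1 : ℤ)) (fun z =>
      Complex.exp (crossExp ρ s x z) * ((gaussTail s x : ℂ) + ((0 : ℝ) : ℂ) * z +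
        ((1 - gaussTail s x : ℝ) : ℂ) * z⁻¹)) (Metric.sphere 0 |1|) := fun z hz => by
    have hz0 : z ≠ 0 := by
      rintro rfl
      simp at hz
    simp only [crossGen]
    push_cast
    rw [zpow_neg_one]
    field_simp
    ring
  rw [Real.circleAverage_congr_sphere h2, circleAverage_exp_crossExp hs _ _ _ _ _ one_pos] at h1
  have h3 : P.real {ω | crossing (fun j => Y j ω + σ / √2 * B j t ω) x = 1} ≤
      P.real {ω | x < X 0 t ω} := by
    rw [h.measureReal_eq_crossing t x]
    exact measureReal_mono fun ω (hω : _ = 1) => hω.ge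
  refine le_trans ?_ h3
  rw [← Complex.ofReal_mul, Complex.ofReal_inj] at h1
  rw [h1, ← mul_assoc, mul_comm (gaussTail s x), mul_assoc]
  refine mul_le_mul_of_nonneg_left (le_add_of_nonneg_right ?_) (Real.exp_pos _).le
  have h4 := tailInt_pos hs x
  have h5 := besselArg_pos hs x
  have h6 := (sub_pos.2 (gaussTail_lt_one s x)).le
  have h7 := bess_one_nonneg (mul_pos hρ h5).le
  rw [zero_mul, zero_add]
  positivity

end Tracer

/-! ### Large deviations -/

section Scaling

variable {σ T : ℝ}

lemma gaussDens_scale (hT : 0 < T) (σ ξ : ℝ) :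
    gaussDens (σ * T) (ξ * T) = gaussDens σ ξ / T := by
  rw [gaussDens, gaussDens, mul_div_mul_right _ _ hT.ne', div_div]
  ring_nf

lemma gaussTail_scale (hT : 0 < T) (σ ξ : ℝ) : gaussTail (σ * T) (ξ * T) = gaussTail σ ξ := by
  rw [gaussTail, gaussTail, mul_div_mul_right _ _ hT.ne']

lemma tailInt_scale (hT : 0 < T) (σ ξ : ℝ) :
    tailInt (σ * T) (ξ * T) = T * tailInt σ ξ := by
  rw [tailInt, tailInt, gaussDens_scale hT, gaussTail_scale hT]
  field_simp

lemma tailInt_neg_scale (hT : 0 < T) (σ ξ : ℝ) :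
    tailInt (σ * T) (-(ξ * T)) = T * tailInt σ (-ξ) := by
  rw [← neg_mul, tailInt_scale hT]

lemma besselArg_scale (hT : 0 < T) (σ ξ : ℝ) :
    besselArg (σ * T) (ξ * T) = T * besselArg σ ξ := by
  rw [besselArg, besselArg, tailInt_scale hT, tailInt_neg_scale hT,
    show T * tailInt σ ξ * (T * tailInt σ (-ξ)) = T ^ 2 * (tailInt σ ξ * tailInt σ (-ξ)) by ring,
    Real.sqrt_mul (sq_nonneg T), Real.sqrt_sq hT.le]
  ring

lemma phiA_scale (hσ : 0 < σ) (hT : 0 < T) (ρ ξ : ℝ) :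
    phiA ρ (σ * T) (ξ * T) = T * phiA ρ σ ξ := by
  rw [phiA_eq_sub (mul_pos hσ hT), phiA_eq_sub hσ, tailInt_scale hT, tailInt_neg_scale hT,
    besselArg_scale hT]
  ring

lemma bess_le {s : ℝ} (hs : 0 < s) (k : ℕ) : bess k s ≤ √(Real.pi / s) := by
  have h := norm_bessC_le k (s := (s : ℂ)) (by simpa using hs)
  rw [bessC_ofReal, Complex.norm_real, Complex.ofReal_re] at h
  exact (Real.le_norm_self _).trans h

lemma phiA_pos (hσ : 0 < σ) {ρ : ℝ} (hρ : 0 < ρ) {ξ : ℝ} (hξ : ξ ≠ 0) : 0 < phiA ρ σ ξ := by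
  rw [phiA_eq hσ]
  have h1 := (tailInt_pos hσ ξ).le
  have h2 := (tailInt_pos hσ (-ξ)).le
  have h3 : √(tailInt σ ξ) - √(tailInt σ (-ξ)) ≠ 0 := by
    rw [sub_ne_zero, Ne, Real.sqrt_inj h1 h2, tailInt_neg]
    intro h
    exact hξ (by linarith)
  positivity

lemma tracerDens_scale (hσ : 0 < σ) (hT : 0 < T) (ρ ξ : ℝ) :
    tracerDens ρ (σ * T) (ξ * T) = Real.exp (-T * phiA ρ σ ξ) *
      ((gaussDens σ ξ / T + 2 * ρ * gaussTail σ ξ * (1 - gaussTail σ ξ)) *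
        bess 0 (ρ * (T * besselArg σ ξ)) +
      ρ * ((1 - gaussTail σ ξ) ^ 2 * (2 * tailInt σ ξ) +
        gaussTail σ ξ ^ 2 * (2 * tailInt σ (-ξ))) / besselArg σ ξ *
          bess 1 (ρ * (T * besselArg σ ξ))) := by
  have h1 := (besselArg_pos hσ ξ).ne'
  rw [tracerDens, phiA_scale hσ hT, gaussDens_scale hT, gaussTail_scale hT, besselArg_scale hT,
    tailInt_scale hT, tailInt_neg_scale hT, neg_mul]
  congr 3
  field_simp

end Scaling

section LogEquiv

variable {f : ℝ≥0 → ℝ} {φ c C : ℝ}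

lemma tendsto_sqrt_coe_atTop : Tendsto (fun t : ℝ≥0 => √(t : ℝ)) atTop atTop :=
  Real.tendsto_sqrt_atTop.comp (NNReal.tendsto_coe_atTop.2 tendsto_id)

/-- A factor polynomial in `√t` contributes `O(log t)` to the logarithm. The lower hypothesis allows
a loss of `1 / t`, which leaves room for the crude lower bound on the Bessel function. -/
lemma tendsto_log_div_sqrt (hc : 0 < c)
    (h1 : ∀ᶠ t : ℝ≥0 in atTop, c / √(t : ℝ) ^ 2 * Real.exp (-√(t : ℝ) * φ) ≤ f t)
    (h2 : ∀ᶠ t : ℝ≥0 in atTop, f t ≤ C * Real.exp (-√(t : ℝ) * φ)) :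
    Tendsto (fun t => Real.log (f t) / √(t : ℝ)) atTop (𝓝 (-φ)) := by
  have hT := tendsto_sqrt_coe_atTop
  have hlog : Tendsto (fun t : ℝ≥0 => Real.log √(t : ℝ) / √(t : ℝ)) atTop (𝓝 0) :=
    Real.isLittleO_log_id_atTop.tendsto_div_nhds_zero.comp hT
  have hinv : Tendsto (fun t : ℝ≥0 => (√(t : ℝ))⁻¹) atTop (𝓝 0) := tendsto_inv_atTop_zero.comp hT
  have hl : Tendsto (fun t : ℝ≥0 => Real.log c * (√(t : ℝ))⁻¹ -
      2 * (Real.log √(t : ℝ) / √(t : ℝ)) - φ) atTop (𝓝 (-φ)) := by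
    simpa using ((hinv.const_mul (Real.log c)).sub (hlog.const_mul 2)).sub_const φ
  have hu : Tendsto (fun t : ℝ≥0 => Real.log C * (√(t : ℝ))⁻¹ - φ) atTop (𝓝 (-φ)) := by
    simpa using (hinv.const_mul (Real.log C)).sub_const φ
  refine tendsto_of_tendsto_of_tendsto_of_le_of_le' hl hu ?_ ?_
  · filter_upwards [h1, hT.eventually_gt_atTop 0] with t ht hpos
    have h3 := Real.log_le_log (by positivity) ht
    rw [Real.log_mul (by positivity) (Real.exp_pos _).ne', Real.log_exp,
      Real.log_div hc.ne' (by positivity), Real.log_pow] at h3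
    rw [le_div_iff₀ hpos]
    refine le_of_eq_of_le ?_ h3
    push_cast
    field_simp
    ring
  · filter_upwards [h1, h2, hT.eventually_gt_atTop 0] with t ht ht2 hpos
    have h0 : 0 < f t := lt_of_lt_of_le (by positivity) ht
    have hC : 0 < C := pos_of_mul_pos_left (h0.trans_le ht2) (Real.exp_pos _).le
    have h3 := Real.log_le_log h0 ht2
    rw [Real.log_mul hC.ne' (Real.exp_pos _).ne', Real.log_exp] at h3
    rw [div_le_iff₀ hpos]
    refine h3.trans_eq ?_
    field_simp
    ring

/-- At `φ = 0` the reference function is identically 1 and the ratio of logarithms has no meaning,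
hence the exclusion of `ξ = 0`. -/
lemma logEquiv_of_tendsto (hφ : φ ≠ 0)
    (h : Tendsto (fun t => Real.log (f t) / √(t : ℝ)) atTop (𝓝 (-φ))) :
    LogEquiv f fun t => Real.exp (-√(t : ℝ) * φ) := by
  have h1 := h.div_const (-φ)
  rw [div_self (neg_ne_zero.2 hφ)] at h1
  refine h1.congr fun t => ?_
  rw [Real.log_exp, div_div]
  ring_nf

end LogEquiv

/-- After scaling the exponential factor is exact. Below, the term `gaussDens σ ξ / √t` times a
Bessel function of order at least `1 / √t` gives `c / t`; above, all coefficients are bounded for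
`√t ≥ 1`. -/
lemma tendsto_log_tracerDens {ρ σ : ℝ} (hρ : 0 < ρ) (hσ : 0 < σ) (ξ : ℝ) :
    Tendsto (fun t : ℝ≥0 => Real.log (tracerDens ρ (σ * √(t : ℝ)) (ξ * √(t : ℝ))) / √(t : ℝ)) atTop
      (𝓝 (-phiA ρ σ ξ)) := by
  have hT := tendsto_sqrt_coe_atTop
  have hw := besselArg_pos hσ ξ
  have hg := gaussDens_pos hσ ξ
  have hq := gaussTail_pos σ ξ
  have hq1 := sub_pos.2 (gaussTail_lt_one σ ξ)
  have hA := tailInt_pos hσ ξ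
  have hB := tailInt_pos hσ (-ξ)
  have hpi := Real.pi_pos
  set K : ℝ := ρ * ((1 - gaussTail σ ξ) ^ 2 * (2 * tailInt σ ξ) +
        gaussTail σ ξ ^ 2 * (2 * tailInt σ (-ξ))) / besselArg σ ξ with hK
  have hK0 : 0 ≤ K := by positivity
  refine tendsto_log_div_sqrt
    (c := gaussDens σ ξ * ((2 * Real.pi)⁻¹ * Real.exp (-1) / (ρ * besselArg σ ξ)))
    (C := (gaussDens σ ξ + 2 * ρ * gaussTail σ ξ * (1 - gaussTail σ ξ) + K) *
      √(Real.pi / (ρ * besselArg σ ξ))) (by positivity) ?_ ?_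
  · filter_upwards [hT.eventually_ge_atTop 1, hT.eventually_ge_atTop (ρ * besselArg σ ξ)⁻¹] with t
      ht1 ht2
    have hpos : 0 < √(t : ℝ) := one_pos.trans_le ht1
    have h1 := gaussDens_mul_bess_le_tracerDens hρ (mul_pos hσ hpos) (ξ * √(t : ℝ))
    refine le_trans ?_ h1
    rw [phiA_scale hσ hpos, gaussDens_scale hpos, besselArg_scale hpos, mul_comm, neg_mul]
    refine mul_le_mul_of_nonneg_left ?_ (Real.exp_pos _).le
    have h2 : 1 ≤ ρ * (√(t : ℝ) * besselArg σ ξ) := by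
      rw [inv_le_iff_one_le_mul₀ (by positivity)] at ht2
      linarith
    refine le_trans (le_of_eq ?_) (mul_le_mul_of_nonneg_left (bess_zero_ge h2) (by positivity))
    field_simp
  · filter_upwards [hT.eventually_ge_atTop 1] with t ht1
    have hpos : 0 < √(t : ℝ) := one_pos.trans_le ht1
    rw [tracerDens_scale hσ hpos, mul_comm]
    refine mul_le_mul_of_nonneg_right ?_ (Real.exp_pos _).le
    have h3 : ∀ k, bess k (ρ * (√(t : ℝ) * besselArg σ ξ)) ≤ √(Real.pi / (ρ * besselArg σ ξ)) :=
      fun k => (bess_le (by positivity) k).trans (Real.sqrt_le_sqrt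
        (div_le_div_of_nonneg_left hpi.le (by positivity) (mul_le_mul_of_nonneg_left
          (le_mul_of_one_le_left hw.le ht1) hρ.le)))
    rw [add_mul _ K]
    refine add_le_add (mul_le_mul ?_ (h3 0) (bess_zero_pos _).le (by positivity))
      (mul_le_mul_of_nonneg_left (h3 1) hK0)
    exact add_le_add_left (div_le_self hg.le ht1) _

lemma isEquivalent_phiA {ρ σ : ℝ} (hρ : 0 < ρ) (hσ : 0 < σ) :
    (fun ξ : ℝ => phiA ρ σ ξ) ~[Bornology.cobounded ℝ] (fun ξ => ρ * |ξ|) := by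
  have hne : ∀ᶠ ξ : ℝ in Bornology.cobounded ℝ, ρ * |ξ| ≠ 0 := by
    filter_upwards [Bornology.eventually_ne_cobounded (0 : ℝ)] with ξ hξ
    positivity
  rw [isEquivalent_iff_tendsto_one hne]
  have h1 : Tendsto (fun u => phiA ρ σ u / (ρ * u)) atTop (𝓝 1) := by
    have h2 : Tendsto (fun u => tailInt σ u / u) atTop (𝓝 0) := by
      simpa [div_eq_mul_inv] using (tendsto_tailInt hσ).mul tendsto_inv_atTop_zero
    -- With `y = tailInt σ u / u` and `tailInt σ (-u) = tailInt σ u + u`, the quotient is the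
    -- continuous function `2 y + 1 - 2 √(y (y + 1))`, and `y` tends to 0.
    have h3 : Tendsto (fun u => 2 * (tailInt σ u / u) + 1 -
        2 * √(tailInt σ u / u * (tailInt σ u / u + 1))) atTop (𝓝 1) := by
      have h4 : Continuous fun y : ℝ => 2 * y + 1 - 2 * √(y * (y + 1)) := by fun_prop
      simpa [Function.comp_def] using (h4.tendsto 0).comp h2
    refine h3.congr' ?_
    filter_upwards [eventually_gt_atTop 0] with u hu
    rw [phiA_eq_sub hσ, besselArg, tailInt_neg, mul_div_mul_left _ _ hρ.ne',
      show tailInt σ u / u * (tailInt σ u / u + 1) =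
        (tailInt σ u * (tailInt σ u + u)) / u ^ 2 by field_simp, Real.sqrt_div' _ (sq_nonneg u),
      Real.sqrt_sq hu.le]
    field_simp
    ring
  have h5 : Tendsto (fun ξ : ℝ => |ξ|) (Bornology.cobounded ℝ) atTop := tendsto_norm_cobounded_atTop
  refine (h1.comp h5).congr fun ξ => ?_
  rcases abs_choice ξ with h | h
  · simp [h]
  · simp [h, phiA_neg]

/-! ### Tail probabilities and symmetry of the law -/

section Tail

variable {Ω : Type*} [MeasurableSpace Ω] {P : Measure Ω} [IsProbabilityMeasure P] {ρ σ : ℝ}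
  {Y : ℤ → Ω → ℝ} {B X : ℤ → ℝ≥0 → Ω → ℝ}

lemma norm_circleAverage_le {f : ℂ → ℂ} {r C : ℝ} (hr : 0 ≤ r) (h : ∀ z, ‖z‖ = r → ‖f z‖ ≤ C) :
    ‖Real.circleAverage f 0 r‖ ≤ C := by
  have hpi := Real.pi_pos
  rw [Real.circleAverage_def, norm_smul, Real.norm_of_nonneg (by positivity),
    inv_mul_le_iff₀ (by positivity)]
  refine (intervalIntegral.norm_integral_le_of_norm_le_const (C := C) fun θ _ => h _ ?_).trans_eq ?_
  · rw [norm_circleMap_zero, abs_of_nonneg hr]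
  · rw [sub_zero, abs_of_pos (by positivity)]
    ring

/-- Chernoff bound for the tracer. -/
lemma IsAnnealedSingleFile.tail_le (h : IsAnnealedSingleFile ρ σ Y B X P)
    (hρ : 0 < ρ) (hσ : 0 < σ) {t : ℝ≥0} (ht : 0 < t) (x : ℝ) {r : ℝ} (hr : 1 < r) :
    P.real {ω | x < X 0 t ω} ≤ Real.exp (ρ * tailInt (σ * √(t : ℝ)) x * (r - 1) +
      ρ * tailInt (σ * √(t : ℝ)) (-x) * (r⁻¹ - 1)) *
        ((r - 1)⁻¹ + gaussTail (σ * √(t : ℝ)) x) := by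
  have hs : 0 < σ * √(t : ℝ) := by positivity
  set s := σ * √(t : ℝ)
  have hr0 : 0 < r := one_pos.trans hr
  have h1 := tailInt_pos hs x
  have h2 := tailInt_pos hs (-x)
  have h3 := norm_circleAverage_le (f := fun z => crossGen ρ s x z * (z - 1)⁻¹) (r := r)
    (C := Real.exp (ρ * tailInt s x * (r - 1) + ρ * tailInt s (-x) * (r⁻¹ - 1)) *
      ((r - 1)⁻¹ + gaussTail s x)) hr0.le fun z hz => by
    have hz1 : r - 1 ≤ ‖z - 1‖ := by
      have := norm_sub_norm_le z 1
      rwa [hz, norm_one] at this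
    have hr1 : 0 < r - 1 := sub_pos.2 hr
    have hz2 : z - 1 ≠ 0 := norm_pos_iff.1 (hr1.trans_le hz1)
    have e : crossGen ρ s x z * (z - 1)⁻¹ =
        Complex.exp (crossExp ρ s x z) * ((z - 1)⁻¹ + gaussTail s x) := by
      rw [crossGen]
      field_simp
    rw [e, norm_mul, Complex.norm_exp]
    -- Both coefficients of the exponent are nonnegative, so on `|z| = r` its real part is largest
    -- at `z = r`, where `|z - 1|` is also smallest.
    have hre : (crossExp ρ s x z).re ≤
        ρ * tailInt s x * (r - 1) + ρ * tailInt s (-x) * (r⁻¹ - 1) := by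
      rw [crossExp, Complex.add_re, ← Complex.ofReal_mul, ← Complex.ofReal_mul,
        Complex.re_ofReal_mul, Complex.re_ofReal_mul, Complex.sub_re, Complex.sub_re,
        Complex.one_re]
      have e1 : z.re ≤ r := hz ▸ Complex.re_le_norm z
      have e2 : (z⁻¹).re ≤ r⁻¹ := (Complex.re_le_norm _).trans_eq (by rw [norm_inv, hz])
      gcongr
    refine mul_le_mul (Real.exp_le_exp.2 hre) ?_ (norm_nonneg _) (Real.exp_pos _).le
    refine (norm_add_le _ _).trans (add_le_add ?_ ?_)
    · rw [norm_inv]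
      exact inv_anti₀ hr1 hz1
    · rw [Complex.norm_real, Real.norm_of_nonneg (gaussTail_pos s x).le]
  rw [← h.tail_eq_circleAverage hρ hσ ht x hr, Complex.norm_real,
    Real.norm_of_nonneg measureReal_nonneg] at h3
  exact h3

lemma IsAnnealedSingleFile.map_tracer (h : IsAnnealedSingleFile ρ σ Y B X P)
    (hρ : 0 < ρ) (hσ : 0 < σ) {t : ℝ≥0} (ht : 0 < t) :
    P.map (X 0 t) =
      volume.withDensity fun x => ENNReal.ofReal (tracerDens ρ (σ * √(t : ℝ)) x) :=
  map_eq_withDensity_tracerDens hρ (by positivity) (h.measurable 0 t)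
    fun x _ hr => h.tail_eq_circleAverage hρ hσ ht x hr

/-- The law of the tracer is symmetric. -/
lemma IsAnnealedSingleFile.map_neg_tracer (h : IsAnnealedSingleFile ρ σ Y B X P)
    (hρ : 0 < ρ) (hσ : 0 < σ) {t : ℝ≥0} (ht : 0 < t) :
    P.map (fun ω => -X 0 t ω) = P.map (X 0 t) := by
  have hm := h.measurable 0 t
  rw [show (fun ω => -X 0 t ω) = Neg.neg ∘ X 0 t from rfl, ← Measure.map_map measurable_neg hm,
    h.map_tracer hρ hσ ht]
  ext S hS
  rw [Measure.map_apply measurable_neg hS, withDensity_apply _ (measurable_neg hS),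
    withDensity_apply _ hS, ← lintegral_indicator (measurable_neg hS), ← lintegral_indicator hS,
    ← lintegral_neg_eq_self]
  congr with x
  have hx : -x ∈ Neg.neg ⁻¹' S ↔ x ∈ S := by rw [Set.mem_preimage, neg_neg]
  by_cases hxS : x ∈ S
  · rw [Set.indicator_of_mem hxS, Set.indicator_of_mem (hx.2 hxS), tracerDens_neg]
  · rw [Set.indicator_of_notMem hxS, Set.indicator_of_notMem (hx.not.2 hxS)]

lemma IsAnnealedSingleFile.left_tail_eq (h : IsAnnealedSingleFile ρ σ Y B X P)
    (hρ : 0 < ρ) (hσ : 0 < σ) {t : ℝ≥0} (ht : 0 < t) (x : ℝ) :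
    P.real {ω | X 0 t ω < -x} = P.real {ω | x < X 0 t ω} := by
  have hm := h.measurable 0 t
  have h1 : P.real {ω | x < X 0 t ω} = (P.map (X 0 t)).real (Set.Ioi x) := by
    rw [map_measureReal_apply hm measurableSet_Ioi]
    rfl
  rw [h1, ← h.map_neg_tracer hρ hσ ht,
    map_measureReal_apply (f := fun ω => -X 0 t ω) hm.neg measurableSet_Ioi]
  congr 1
  ext ω
  simp [lt_neg]

lemma IsAnnealedSingleFile.logEquiv_tail (h : IsAnnealedSingleFile ρ σ Y B X P)
    (hρ : 0 < ρ) (hσ : 0 < σ) {ξ : ℝ} (hξ : 0 < ξ) :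
    LogEquiv (fun t => P.real {ω | ξ * √(t : ℝ) < X 0 t ω})
      (fun t => Real.exp (-√(t : ℝ) * phiA ρ σ ξ)) := by
  refine logEquiv_of_tendsto (phiA_pos hσ hρ hξ.ne').ne' ?_
  have hT := tendsto_sqrt_coe_atTop
  have hw := besselArg_pos hσ ξ
  have hq := gaussTail_pos σ ξ
  have hA := tailInt_pos hσ ξ
  have hB := tailInt_pos hσ (-ξ)
  have hpi := Real.pi_pos
  -- The saddle radius again, which minimises the exponent of the Chernoff bound and makes it `-√t *
  -- phiA ρ σ ξ`. It exceeds 1, as the bound requires, precisely because `ξ > 0`.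
  set r : ℝ := 2 * tailInt σ (-ξ) / besselArg σ ξ with hrdef
  have hw2 : besselArg σ ξ ^ 2 = 4 * (tailInt σ ξ * tailInt σ (-ξ)) := by
    rw [besselArg, mul_pow, Real.sq_sqrt (by positivity)]
    ring
  have hr : 1 < r := by
    rw [hrdef, one_lt_div hw]
    refine lt_of_pow_lt_pow_left₀ 2 (by positivity) ?_
    rw [hw2, tailInt_neg]
    nlinarith
  refine tendsto_log_div_sqrt
    (c := gaussTail σ ξ * ((2 * Real.pi)⁻¹ * Real.exp (-1) / (ρ * besselArg σ ξ)))
    (C := (r - 1)⁻¹ + gaussTail σ ξ) (by positivity) ?_ ?_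
  · filter_upwards [hT.eventually_ge_atTop 1, hT.eventually_ge_atTop (ρ * besselArg σ ξ)⁻¹,
      eventually_gt_atTop 0] with t ht1 ht2 ht
    have hpos : 0 < √(t : ℝ) := one_pos.trans_le ht1
    refine le_trans ?_ (h.le_tail hρ hσ ht (ξ * √(t : ℝ)))
    rw [phiA_scale hσ hpos, gaussTail_scale hpos, besselArg_scale hpos, ← mul_assoc,
      mul_comm (gaussTail σ ξ) (Real.exp _), mul_assoc, mul_comm, neg_mul]
    refine mul_le_mul_of_nonneg_left ?_ (Real.exp_pos _).le
    have h2 : 1 ≤ ρ * (√(t : ℝ) * besselArg σ ξ) := by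
      rw [inv_le_iff_one_le_mul₀ (by positivity)] at ht2
      linarith
    rw [mul_div_assoc]
    refine mul_le_mul_of_nonneg_left (le_trans ?_ (bess_zero_ge h2)) hq.le
    rw [div_div]
    refine div_le_div_of_nonneg_left (by positivity) (by positivity) ?_
    nlinarith [mul_pos hρ hw, mul_pos (mul_pos hρ hw) hpos]
  · filter_upwards [hT.eventually_ge_atTop 1, eventually_gt_atTop 0] with t ht1 ht
    have hpos : 0 < √(t : ℝ) := one_pos.trans_le ht1
    refine (h.tail_le hρ hσ ht (ξ * √(t : ℝ)) hr).trans_eq ?_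
    rw [gaussTail_scale hpos, tailInt_scale hpos, tailInt_neg_scale hpos, mul_comm,
      phiA_eq_sub hσ]
    congr 2
    have e1 : tailInt σ ξ * r = besselArg σ ξ / 2 := by
      rw [hrdef]
      field_simp
      linear_combination -hw2
    have e2 : tailInt σ (-ξ) * r⁻¹ = besselArg σ ξ / 2 := by
      rw [hrdef]
      field_simp
    linear_combination (ρ * √(t : ℝ)) * e1 + (ρ * √(t : ℝ)) * e2

lemma IsAnnealedSingleFile.logEquiv_left_tail (h : IsAnnealedSingleFile ρ σ Y B X P)
    (hρ : 0 < ρ) (hσ : 0 < σ) {ξ : ℝ} (hξ : ξ < 0) :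
    LogEquiv (fun t => P.real {ω | X 0 t ω < ξ * √(t : ℝ)})
      (fun t => Real.exp (-√(t : ℝ) * phiA ρ σ ξ)) := by
  have h1 := h.logEquiv_tail hρ hσ (neg_pos.2 hξ)
  rw [phiA_neg] at h1
  refine Tendsto.congr' ?_ h1
  filter_upwards [eventually_gt_atTop 0] with t ht
  have h2 := h.left_tail_eq hρ hσ ht (-ξ * √(t : ℝ))
  rw [neg_mul, neg_neg] at h2
  rw [neg_mul, h2]

end Tail

/-! ### Exponential moments -/

section ExpMoments

variable {Ω : Type*} [MeasurableSpace Ω] {P : Measure Ω} [IsProbabilityMeasure P] {Z : Ω → ℝ}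

/-- Exponential tails give exponential moments. -/
lemma lintegral_exp_le (hZ : Measurable Z) {x₀ K κ l : ℝ} (hl : 0 < l) (hlκ : l < κ)
    (h : ∀ x, x₀ ≤ x → P.real {ω | x < Z ω} ≤ K * Real.exp (-κ * x)) :
    ∫⁻ ω in {ω | x₀ < Z ω}, ENNReal.ofReal (Real.exp (l * Z ω)) ∂P ≤
      ENNReal.ofReal (K * (κ / (κ - l)) * Real.exp (-(κ - l) * x₀)) := by
  have hκl : 0 < κ - l := sub_pos.2 hlκ
  have hK : 0 ≤ K := by
    have := measureReal_nonneg.trans (h x₀ le_rfl)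
    exact nonneg_of_mul_nonneg_left this (Real.exp_pos _)
  have hS : MeasurableSet {ω | x₀ < Z ω} := measurableSet_lt measurable_const hZ
  let f : Ω → ℝ := fun ω => max (Z ω - x₀) 0
  have hf : Measurable f := (hZ.sub_const _).max measurable_const
  let g : ℝ → ℝ := fun u => l * Real.exp (l * (u + x₀))
  have hg : Continuous g := by
    simp only [g]
    fun_prop
  have hint : ∀ y, ∫ u in (0 : ℝ)..y, g u = Real.exp (l * (y + x₀)) - Real.exp (l * x₀) := by
    intro y
    have hd : ∀ u, HasDerivAt (fun u => Real.exp (l * (u + x₀))) (g u) u := fun u => by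
      have := ((((hasDerivAt_id u).add_const x₀).const_mul l)).exp
      refine this.congr_deriv ?_
      simp only [g, id_eq]
      ring
    rw [intervalIntegral.integral_eq_sub_of_hasDerivAt (fun u _ => hd u)
      (hg.intervalIntegrable _ _), zero_add]
  -- Layer cake for the excess `f` of `Z` over `x₀`: its weight `g` is the derivative of `exp (l (u
  -- + x₀))`, so the constant `exp (l x₀)` is missing and is accounted for separately.
  have hlayer := lintegral_comp_eq_lintegral_meas_lt_mul P (f := f) (g := g)
    (Eventually.of_forall fun ω => le_max_right _ _) hf.aemeasurable
    (fun t _ => hg.intervalIntegrable _ _)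
    (Eventually.of_forall fun u => mul_nonneg hl.le (Real.exp_pos _).le)
  have h1 : ∫⁻ ω in {ω | x₀ < Z ω}, ENNReal.ofReal (Real.exp (l * Z ω)) ∂P ≤
      ∫⁻ ω in {ω | x₀ < Z ω}, (ENNReal.ofReal (∫ u in (0 : ℝ)..f ω, g u) +
        ENNReal.ofReal (Real.exp (l * x₀))) ∂P := by
    refine setLIntegral_mono' hS fun ω hω => ?_
    have hω' : f ω = Z ω - x₀ := max_eq_left (sub_pos.2 hω).le
    rw [hint, hω', sub_add_cancel, ← ENNReal.ofReal_add ?_ (Real.exp_pos _).le, sub_add_cancel]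
    exact sub_nonneg.2 (Real.exp_le_exp.2 (mul_le_mul_of_nonneg_left (le_of_lt hω) hl.le))
  have h2 : ∫⁻ u in Set.Ioi 0, P {a | u < f a} * ENNReal.ofReal (g u) ≤
      ENNReal.ofReal (K * (l / (κ - l)) * Real.exp (-(κ - l) * x₀)) := by
    have h3 : ∀ u ∈ Set.Ioi (0 : ℝ), P {a | u < f a} * ENNReal.ofReal (g u) ≤
        ENNReal.ofReal (K * l * Real.exp (-(κ - l) * x₀) * Real.exp (-(κ - l) * u)) := by
      intro u hu
      have h4 : {a | u < f a} = {a | u + x₀ < Z a} := by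
        ext a
        simp only [f, Set.mem_ofPred_eq, lt_max_iff, not_lt.2 (le_of_lt (Set.mem_Ioi.1 hu)), or_false,
          lt_sub_iff_add_lt]
      rw [h4, ← ofReal_measureReal, ← ENNReal.ofReal_mul measureReal_nonneg]
      refine ENNReal.ofReal_le_ofReal ?_
      refine (mul_le_mul_of_nonneg_right (h (u + x₀) (by linarith [Set.mem_Ioi.1 hu]))
        (mul_nonneg hl.le (Real.exp_pos _).le)).trans_eq ?_
      have e1 : Real.exp (-(κ - l) * x₀) * Real.exp (-(κ - l) * u) =
          Real.exp (-κ * (u + x₀)) * Real.exp (l * (u + x₀)) := by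
        rw [← Real.exp_add, ← Real.exp_add]
        ring_nf
      rw [mul_assoc (K * l), e1]
      ring
    refine (setLIntegral_mono' measurableSet_Ioi h3).trans ?_
    rw [← ofReal_integral_eq_lintegral_ofReal]
    · rw [integral_const_mul, integral_exp_mul_Ioi (neg_lt_zero.2 hκl)]
      refine ENNReal.ofReal_le_ofReal (le_of_eq ?_)
      rw [mul_zero, Real.exp_zero, neg_div_neg_eq]
      ring
    · exact (integrableOn_exp_mul_Ioi (neg_lt_zero.2 hκl) 0).const_mul _
    · exact Eventually.of_forall fun u => by positivity
  refine h1.trans ?_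
  rw [lintegral_add_right _ measurable_const, setLIntegral_const]
  have h5 : ENNReal.ofReal (Real.exp (l * x₀)) * P {ω | x₀ < Z ω} ≤
      ENNReal.ofReal (K * Real.exp (-(κ - l) * x₀)) := by
    rw [← ofReal_measureReal, ← ENNReal.ofReal_mul (Real.exp_pos _).le]
    refine ENNReal.ofReal_le_ofReal ?_
    refine (mul_le_mul_of_nonneg_left (h x₀ le_rfl) (Real.exp_pos _).le).trans_eq ?_
    rw [mul_left_comm, ← Real.exp_add]
    ring_nf
  -- The excess and the constant part combine through `l / (κ - l) + 1 = κ / (κ - l)`.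
  refine (add_le_add ((setLIntegral_le_lintegral _ _).trans (hlayer.le.trans h2)) h5).trans ?_
  rw [← ENNReal.ofReal_add (by positivity) (by positivity)]
  refine ENNReal.ofReal_le_ofReal (le_of_eq ?_)
  field_simp
  ring

lemma integrable_exp_of_tail (hZ : Measurable Z) {K κ l : ℝ} (hl : 0 < l) (hlκ : l < κ)
    (h : ∀ x, 0 ≤ x → P.real {ω | x < Z ω} ≤ K * Real.exp (-κ * x)) :
    Integrable (fun ω => Real.exp (l * Z ω)) P := by
  have hm : Measurable fun ω => Real.exp (l * Z ω) := (hZ.const_mul l).exp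
  refine ⟨hm.aestronglyMeasurable, ?_⟩
  rw [hasFiniteIntegral_iff_ofReal (Eventually.of_forall fun ω => (Real.exp_pos _).le)]
  have hS : MeasurableSet {ω | 0 < Z ω} := measurableSet_lt measurable_const hZ
  rw [← lintegral_add_compl _ hS]
  refine ENNReal.add_lt_top.2 ⟨(lintegral_exp_le hZ hl hlκ h).trans_lt ENNReal.ofReal_lt_top, ?_⟩
  have h1 : ∫⁻ ω in {ω | 0 < Z ω}ᶜ, ENNReal.ofReal (Real.exp (l * Z ω)) ∂P ≤
      ∫⁻ ω in {ω | 0 < Z ω}ᶜ, 1 ∂P := by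
    refine setLIntegral_mono' hS.compl fun ω hω => ?_
    rw [ENNReal.ofReal_le_one, Real.exp_le_one_iff]
    exact mul_nonpos_of_nonneg_of_nonpos hl.le (not_lt.1 hω)
  refine h1.trans_lt ?_
  rw [setLIntegral_one]
  exact measure_lt_top _ _

end ExpMoments

/-! ### Exponential tails, integrability and odd cumulants of the tracer -/

section Moments

variable {Ω : Type*} [MeasurableSpace Ω] {P : Measure Ω} [IsProbabilityMeasure P] {ρ σ : ℝ}
  {Y : ℤ → Ω → ℝ} {B X : ℤ → ℝ≥0 → Ω → ℝ}

/-- Chernoff with `r = 1 + 1 / (ρ * tailInt s x)`: the growing part of the exponent is 1, the other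
part is nonpositive, and the prefactor is small when the integrated tail is. At fixed time this
inherits superexponential decay. -/
lemma IsAnnealedSingleFile.tail_le_exp_one (h : IsAnnealedSingleFile ρ σ Y B X P)
    (hρ : 0 < ρ) (hσ : 0 < σ) {t : ℝ≥0} (ht : 0 < t) (x : ℝ) :
    P.real {ω | x < X 0 t ω} ≤ Real.exp 1 *
      (ρ * tailInt (σ * √(t : ℝ)) x + gaussTail (σ * √(t : ℝ)) x) := by
  have hs : 0 < σ * √(t : ℝ) := by positivity
  set s := σ * √(t : ℝ)
  have h1 := tailInt_pos hs x
  have h2 := tailInt_pos hs (-x)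
  have ha : 0 < ρ * tailInt s x := by positivity
  have hr : 1 < 1 + (ρ * tailInt s x)⁻¹ := lt_add_of_pos_right _ (by positivity)
  refine (h.tail_le hρ hσ ht x hr).trans ?_
  have hq := gaussTail_pos s x
  rw [add_sub_cancel_left, inv_inv, mul_inv_cancel₀ ha.ne']
  refine mul_le_mul_of_nonneg_right (Real.exp_le_exp.2 ?_) (by positivity)
  have := inv_le_one_of_one_le₀ hr.le
  nlinarith [mul_pos hρ h2]

/-- The tail of the tracer decays faster than every exponential. -/
lemma IsAnnealedSingleFile.exists_tail_le (h : IsAnnealedSingleFile ρ σ Y B X P)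
    (hρ : 0 < ρ) (hσ : 0 < σ) {t : ℝ≥0} (ht : 0 < t) {κ : ℝ} (hκ : 0 < κ) :
    ∃ K, ∀ x, 0 ≤ x → P.real {ω | x < X 0 t ω} ≤ K * Real.exp (-κ * x) := by
  have hs : 0 < σ * √(t : ℝ) := by positivity
  have h1 : ∃ C, ∀ x, 0 ≤ x → tailInt (σ * √(t : ℝ)) x ≤ C * Real.exp (-κ * x) :=
    ⟨_, fun x hx => tailInt_le hs hx κ⟩
  have h2 : ∃ C, ∀ x, gaussTail (σ * √(t : ℝ)) x ≤ C * Real.exp (-κ * x) :=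
    ⟨_, fun x => gaussTail_le hs x hκ⟩
  obtain ⟨C, hC⟩ := h1
  obtain ⟨C', hC'⟩ := h2
  refine ⟨Real.exp 1 * (ρ * C + C'), fun x hx => (h.tail_le_exp_one hρ hσ ht x).trans ?_⟩
  rw [mul_assoc]
  refine mul_le_mul_of_nonneg_left ?_ (Real.exp_pos _).le
  rw [add_mul, mul_assoc]
  exact add_le_add (mul_le_mul_of_nonneg_left (hC x hx) hρ.le) (hC' x)

/-- In the scaling regime the tail of the tracer is uniformly exponential. -/
lemma IsAnnealedSingleFile.exists_uniform_tail_le (h : IsAnnealedSingleFile ρ σ Y B X P)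
    (hρ : 0 < ρ) (hσ : 0 < σ) {δ : ℝ} (hδ : 0 < δ) :
    ∃ K κ, 0 < κ ∧ ∀ t : ℝ≥0, 0 < t → ∀ x, δ * √(t : ℝ) ≤ x →
      P.real {ω | x < X 0 t ω} ≤ K * Real.exp (-κ * x) := by
  have hm := tailInt_pos hσ 0
  -- A radius `1 + e` independent of `t` and `x`. The exponent is `e / (1 + e) * (ρ A e - ρ x)` with
  -- `A ≤ √t * tailInt σ 0`, and `e` is such that `ρ A e ≤ ρ δ √t / 2 ≤ ρ x / 2`; half of the linear
  -- gain survives.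
  set e : ℝ := ρ * δ / (2 * (ρ * tailInt σ 0)) with he
  have he0 : 0 < e := by positivity
  refine ⟨e⁻¹ + 1, e / (1 + e) * (ρ / 2), by positivity, fun t ht x hx => ?_⟩
  have hT : 0 < √(t : ℝ) := by positivity
  refine (h.tail_le hρ hσ ht x (lt_add_of_pos_right 1 he0)).trans ?_
  have hx0 : 0 ≤ x := le_trans (by positivity) hx
  have hA : tailInt (σ * √(t : ℝ)) x ≤ √(t : ℝ) * tailInt σ 0 := by
    refine ((tailInt_strictAnti (mul_pos hσ hT)).antitone hx0).trans_eq ?_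
    have := tailInt_scale hT σ 0
    rwa [zero_mul] at this
  have hq := gaussTail_lt_one (σ * √(t : ℝ)) x
  have hq0 := gaussTail_pos (σ * √(t : ℝ)) x
  rw [add_sub_cancel_left, mul_comm, tailInt_neg]
  refine mul_le_mul (by linarith) (Real.exp_le_exp.2 ?_) (Real.exp_pos _).le (by positivity)
  set A := tailInt (σ * √(t : ℝ)) x
  have h1 : ρ * A * e + ρ * (A + x) * ((1 + e)⁻¹ - 1) = e / (1 + e) * (ρ * A * e - ρ * x) := by
    field_simp
    ring
  have h5 : -(e / (1 + e) * (ρ / 2)) * x = e / (1 + e) * -(ρ / 2 * x) := by ring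
  rw [h1, h5]
  refine mul_le_mul_of_nonneg_left ?_ (by positivity)
  have h2 : ρ * A * e ≤ ρ * (√(t : ℝ) * tailInt σ 0) * e := by gcongr
  have h3 : ρ * (√(t : ℝ) * tailInt σ 0) * e = ρ * (δ * √(t : ℝ)) / 2 := by
    rw [he]
    field_simp
  have h4 : ρ * (δ * √(t : ℝ)) ≤ ρ * x := by gcongr
  linarith

lemma IsAnnealedSingleFile.tracer_zero (h : IsAnnealedSingleFile ρ σ Y B X P) :
    X 0 0 =ᵐ[P] fun _ => 0 := by
  have hB : ∀ᵐ ω ∂P, B 0 0 ω = 0 := by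
    have h1 := ((h.brownian 0).hasLaw_eval 0).map_eq
    rw [gaussianReal_zero_var] at h1
    have h2 : ∀ᵐ y ∂(P.map (B 0 0)), y = 0 := by
      rw [h1]
      exact (ae_dirac_iff (measurableSet_singleton (0 : ℝ))).2 rfl
    exact ae_of_ae_map (h.measurable_noise 0 0).aemeasurable h2
  filter_upwards [h.hardCore, h.initial.tracer, hB] with ω h1 h2 h3
  rw [h1.start 0, h2, h3]
  simp

lemma IsAnnealedSingleFile.map_neg_tracer' (h : IsAnnealedSingleFile ρ σ Y B X P)
    (hρ : 0 < ρ) (hσ : 0 < σ) (t : ℝ≥0) : P.map (fun ω => -X 0 t ω) = P.map (X 0 t) := by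
  rcases (zero_le : 0 ≤ t).eq_or_lt with rfl | ht
  · refine Measure.map_congr ?_
    filter_upwards [h.tracer_zero] with ω hω
    rw [hω, neg_zero]
  · exact h.map_neg_tracer hρ hσ ht

lemma IsAnnealedSingleFile.integrable_exp (h : IsAnnealedSingleFile ρ σ Y B X P)
    (hρ : 0 < ρ) (hσ : 0 < σ) (t : ℝ≥0) (l : ℝ) :
    Integrable (fun ω => Real.exp (l * X 0 t ω)) P := by
  rcases (zero_le : 0 ≤ t).eq_or_lt with rfl | ht
  · refine (integrable_const (1 : ℝ)).congr ?_
    filter_upwards [h.tracer_zero] with ω hω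
    rw [hω, mul_zero, Real.exp_zero]
  have hm := h.measurable 0 t
  have hpos : ∀ l, 0 < l → Integrable (fun ω => Real.exp (l * X 0 t ω)) P := fun l hl => by
    obtain ⟨K, hK⟩ := h.exists_tail_le hρ hσ ht (by linarith : 0 < l + 1)
    exact integrable_exp_of_tail hm hl (lt_add_one l) hK
  rcases lt_trichotomy l 0 with hl | rfl | hl
  · have h1 := hpos (-l) (neg_pos.2 hl)
    have hc : Continuous fun x : ℝ => Real.exp (-l * x) := by fun_prop
    have h2 : Integrable (fun x => Real.exp (-l * x)) (P.map (X 0 t)) :=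
      (integrable_map_measure hc.aestronglyMeasurable hm.aemeasurable).2 h1
    rw [← h.map_neg_tracer hρ hσ ht] at h2
    have h3 := (integrable_map_measure hc.aestronglyMeasurable
      (hm.neg.aemeasurable (μ := P))).1 h2
    simpa [Function.comp_def] using h3
  · simp
  · exact hpos l hl

lemma IsAnnealedSingleFile.mgf_neg (h : IsAnnealedSingleFile ρ σ Y B X P)
    (hρ : 0 < ρ) (hσ : 0 < σ) (t : ℝ≥0) (l : ℝ) : mgf (X 0 t) P (-l) = mgf (X 0 t) P l := by
  have hm := h.measurable 0 t
  have h1 : mgf (fun ω => -X 0 t ω) P l = mgf (X 0 t) P l := by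
    rw [← mgf_id_map hm.aemeasurable, ← h.map_neg_tracer' hρ hσ t,
      mgf_id_map (X := fun ω => -X 0 t ω) hm.neg.aemeasurable]
  rw [← h1]
  simp [mgf]

/-- The odd cumulants of the tracer vanish. -/
lemma IsAnnealedSingleFile.cumulant_odd (h : IsAnnealedSingleFile ρ σ Y B X P)
    (hρ : 0 < ρ) (hσ : 0 < σ) (t : ℝ≥0) {n : ℕ} (hn : Odd n) : cumulant n (X 0 t) P = 0 := by
  have h1 : (fun l => cgf (X 0 t) P (-l)) = cgf (X 0 t) P := by
    ext l
    rw [cgf, cgf, h.mgf_neg hρ hσ t]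
  have h2 := iteratedDeriv_comp_neg n (cgf (X 0 t) P) 0
  rw [h1, neg_zero, hn.neg_one_pow, neg_one_smul] at h2
  rw [cumulant]
  linarith

end Moments

/-! ### A uniform Laplace estimate in the complex domain -/

section Laplace

/-- Second order Taylor lower bound, obtained by applying monotonicity first to `k'` and then to
`k`. -/
lemma add_le_of_two_mul_le_deriv {k k' k'' : ℝ → ℝ} {m : ℝ}
    (h1 : ∀ τ ∈ Set.Icc (0 : ℝ) 1, HasDerivAt k (k' τ) τ)
    (h2 : ∀ τ ∈ Set.Icc (0 : ℝ) 1, HasDerivAt k' (k'' τ) τ)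
    (h3 : ∀ τ ∈ Set.Icc (0 : ℝ) 1, 2 * m ≤ k'' τ) : k 0 + k' 0 + m ≤ k 1 := by
  have hmem0 : (0 : ℝ) ∈ Set.Icc (0 : ℝ) 1 := by simp
  have hmem1 : (1 : ℝ) ∈ Set.Icc (0 : ℝ) 1 := by simp
  have a1 : MonotoneOn (fun τ => k' τ - 2 * m * τ) (Set.Icc 0 1) := by
    have hd : ∀ τ ∈ Set.Icc (0 : ℝ) 1,
        HasDerivAt (fun τ => k' τ - 2 * m * τ) (k'' τ - 2 * m * 1) τ := fun τ hτ =>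
      (h2 τ hτ).sub ((hasDerivAt_id τ).const_mul (2 * m))
    refine monotoneOn_of_deriv_nonneg (convex_Icc 0 1)
      (fun τ hτ => (hd τ hτ).continuousAt.continuousWithinAt)
      (fun τ hτ => (hd τ (interior_subset hτ)).differentiableAt.differentiableWithinAt)
      fun τ hτ => ?_
    rw [(hd τ (interior_subset hτ)).deriv]
    linarith [h3 τ (interior_subset hτ)]
  have a2 : MonotoneOn (fun τ => k τ - k' 0 * τ - m * τ ^ 2) (Set.Icc 0 1) := by
    have hd : ∀ τ ∈ Set.Icc (0 : ℝ) 1, HasDerivAt (fun τ => k τ - k' 0 * τ - m * τ ^ 2)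
        (k' τ - k' 0 * 1 - m * (2 * τ)) τ := fun τ hτ => by
      refine (((h1 τ hτ).sub ((hasDerivAt_id τ).const_mul (k' 0))).sub
        ((hasDerivAt_pow 2 τ).const_mul m)).congr_deriv ?_
      norm_num
    refine monotoneOn_of_deriv_nonneg (convex_Icc 0 1)
      (fun τ hτ => (hd τ hτ).continuousAt.continuousWithinAt)
      (fun τ hτ => (hd τ (interior_subset hτ)).differentiableAt.differentiableWithinAt)
      fun τ hτ => ?_
    have hτ' := interior_subset hτ
    rw [(hd τ hτ').deriv]
    have := a1 hmem0 hτ' hτ'.1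
    simp only [mul_zero, sub_zero] at this
    linarith
  have := a2 hmem0 hmem1 zero_le_one
  simp only [mul_zero, sub_zero, mul_one, one_pow] at this
  norm_num at this
  linarith

variable {φ φ' φ'' : ℂ → ℂ} {r c : ℝ}

/-- Strong convexity along horizontal lines. -/
lemma re_add_le_of_le_re_deriv (h1 : ∀ z ∈ Metric.ball (0 : ℂ) r, HasDerivAt φ (φ' z) z)
    (h2 : ∀ z ∈ Metric.ball (0 : ℂ) r, HasDerivAt φ' (φ'' z) z)
    (h3 : ∀ z ∈ Metric.ball (0 : ℂ) r, 2 * c ≤ (φ'' z).re) {ζ ξ : ℂ}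
    (hζ : ζ ∈ Metric.ball (0 : ℂ) r) (hξ : ξ ∈ Metric.ball (0 : ℂ) r) (d : ℝ) (hd : ξ = ζ + d) :
    (φ ζ).re + (φ' ζ).re * d + c * d ^ 2 ≤ (φ ξ).re := by
  have hseg : ∀ τ ∈ Set.Icc (0 : ℝ) 1, ζ + τ * d ∈ Metric.ball (0 : ℂ) r := fun τ hτ => by
    have := (convex_ball (0 : ℂ) r) hζ hξ (sub_nonneg.2 hτ.2) hτ.1 (sub_add_cancel 1 τ)
    convert this using 1
    rw [hd, Complex.real_smul, Complex.real_smul]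
    push_cast
    ring
  have hl : ∀ τ : ℝ, HasDerivAt (fun τ : ℝ => ζ + τ * d) (d : ℂ) τ := fun τ => by
    have := ((Complex.ofRealCLM.hasDerivAt (x := τ)).mul_const (d : ℂ)).const_add ζ
    exact this.congr_deriv (by simp)
  have key := add_le_of_two_mul_le_deriv (m := c * d ^ 2)
    (k := fun τ => (φ (ζ + τ * d)).re) (k' := fun τ => (φ' (ζ + τ * d)).re * d)
    (k'' := fun τ => (φ'' (ζ + τ * d)).re * d * d) (fun τ hτ => ?_) (fun τ hτ => ?_) fun τ hτ => ?_
  · simp only [Complex.ofReal_zero, zero_mul, add_zero, Complex.ofReal_one, one_mul, ← hd] at key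
    exact key
  · have e := Complex.reCLM.hasFDerivAt.comp_hasDerivAt τ
      ((h1 _ (hseg τ hτ)).comp τ (hl τ))
    refine e.congr_deriv ?_
    simp
  · have e := (Complex.reCLM.hasFDerivAt.comp_hasDerivAt τ
      ((h2 _ (hseg τ hτ)).comp τ (hl τ))).mul_const d
    refine e.congr_deriv ?_
    simp
  · nlinarith [h3 _ (hseg τ hτ), sq_nonneg d]

/-- Cauchy's theorem on the rectangle: the real segment is moved to height `v` at the cost of the
two vertical sides. -/
lemma norm_integral_le_of_rectangle {f : ℂ → ℂ} {δ v : ℝ}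
    (hf : DifferentiableOn ℂ f (Metric.ball 0 r)) (hr : |δ| + |v| < r) :
    ‖∫ u in -δ..δ, f u‖ ≤ ‖∫ u in -δ..δ, f (u + v * Complex.I)‖ +
      ‖∫ y in (0 : ℝ)..v, f (δ + y * Complex.I)‖ +
        ‖∫ y in (0 : ℝ)..v, f (-δ + y * Complex.I)‖ := by
  have hsub : (Set.uIcc (-δ) δ ×ℂ Set.uIcc 0 v) ⊆ Metric.ball 0 r := fun z hz => by
    rw [mem_ball_zero_iff]
    have h1 : |z.re| ≤ |δ| := by
      rcases Set.mem_uIcc.1 hz.1 with h | h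
      · exact abs_le_abs h.2 (by linarith [h.1])
      · exact abs_le.2 ⟨by linarith [neg_abs_le δ, le_abs_self δ, neg_le_abs δ],
          by linarith [neg_le_abs δ]⟩
    have h2 : |z.im| ≤ |v| := by
      have := Set.abs_sub_left_of_mem_uIcc hz.2
      simpa using this
    exact (Complex.norm_le_abs_re_add_abs_im z).trans_lt (by linarith)
  have key := Complex.integral_boundary_rect_eq_zero_of_differentiableOn f (-δ : ℂ)
    (δ + v * Complex.I) (hf.mono (by simpa using hsub))
  simp at key
  have e : ∫ u in -δ..δ, f u = (∫ u in -δ..δ, f (u + v * Complex.I)) -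
      Complex.I * (∫ y in (0 : ℝ)..v, f (δ + y * Complex.I)) +
      Complex.I * ∫ y in (0 : ℝ)..v, f (-δ + y * Complex.I) := by
    linear_combination key
  rw [e]
  refine (norm_add_le _ _).trans (add_le_add ((norm_sub_le _ _).trans (le_of_eq ?_)) (le_of_eq ?_))
  · rw [norm_mul, Complex.norm_I, one_mul]
  · rw [norm_mul, Complex.norm_I, one_mul]

/-- The integral of the exponential of a phase over a real interval around a nearly real saddle
point. -/
lemma norm_integral_exp_le (h1 : ∀ z ∈ Metric.ball (0 : ℂ) r, HasDerivAt φ (φ' z) z)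
    (h2 : ∀ z ∈ Metric.ball (0 : ℂ) r, HasDerivAt φ' (φ'' z) z)
    (h3 : ∀ z ∈ Metric.ball (0 : ℂ) r, 2 * c ≤ (φ'' z).re) (hc : 0 < c) {δ : ℝ}
    (hδr : 2 * δ ≤ r) {ζ : ℂ} (hζ : ‖ζ‖ < δ) {R : ℂ → ℂ}
    (hR : DifferentiableOn ℂ R (Metric.ball 0 r)) {M : ℝ}
    (hRM : ∀ z ∈ Metric.ball (0 : ℂ) r, ‖R z‖ ≤ M) {η : ℝ}
    (hη : ∀ y s : ℝ, |y| ≤ |ζ.im| → |s| = δ → (φ' ζ * (s + y * Complex.I) -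
      φ (s + y * Complex.I)).re ≤ (φ' ζ * ζ - φ ζ).re - η) {T : ℝ} (hT : 0 < T) :
    ‖∫ u in -δ..δ, Complex.exp (T * (φ' ζ * u - φ u)) * R u‖ ≤
      M * Real.exp (T * (φ' ζ * ζ - φ ζ).re) *
        (√(Real.pi / (c * T)) + 2 * δ * Real.exp (-η * T)) := by
  have hδ : 0 < δ := (norm_nonneg ζ).trans_lt hζ
  have hv : |ζ.im| < δ := (Complex.abs_im_le_norm ζ).trans_lt hζ
  have hr0 : (0 : ℂ) ∈ Metric.ball (0 : ℂ) r := Metric.mem_ball_self (by linarith)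
  have hM : 0 ≤ M := (norm_nonneg _).trans (hRM 0 hr0)
  have hζr : ζ ∈ Metric.ball (0 : ℂ) r := mem_ball_zero_iff.2 (by linarith)
  set E : ℝ := (φ' ζ * ζ - φ ζ).re with hE
  let f : ℂ → ℂ := fun ξ => Complex.exp (T * (φ' ζ * ξ - φ ξ)) * R ξ
  have hφ : DifferentiableOn ℂ φ (Metric.ball 0 r) := fun z hz =>
    (h1 z hz).differentiableAt.differentiableWithinAt
  have hf : DifferentiableOn ℂ f (Metric.ball 0 r) :=
    ((((differentiableOn_id.const_mul (φ' ζ)).sub hφ).const_mul (T : ℂ)).cexp).mul hR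
  have hnorm : ∀ ξ ∈ Metric.ball (0 : ℂ) r,
      ‖f ξ‖ ≤ M * Real.exp (T * (φ' ζ * ξ - φ ξ).re) := fun ξ hξ => by
    simp only [f]
    rw [norm_mul, Complex.norm_exp, Complex.re_ofReal_mul, mul_comm]
    exact mul_le_mul_of_nonneg_right (hRM ξ hξ) (Real.exp_pos _).le
  -- At height `ζ.im` the contour passes through the saddle point `ζ`. A complex saddle would
  -- otherwise leave oscillations on the real segment larger than the saddle value.
  refine (norm_integral_le_of_rectangle (v := ζ.im) hf
    (by rw [abs_of_pos hδ]; linarith)).trans ?_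
  have hhor : ‖∫ u in -δ..δ, f (u + ζ.im * Complex.I)‖ ≤
      M * Real.exp (T * E) * √(Real.pi / (c * T)) := by
    have b1 : ‖∫ u in -δ..δ, f (u + ζ.im * Complex.I)‖ ≤
        ∫ u in -δ..δ, M * Real.exp (T * E) * Real.exp (-(c * T) * (u - ζ.re) ^ 2) := by
      refine intervalIntegral.norm_integral_le_of_norm_le (by linarith)
        (Eventually.of_forall fun u hu => ?_) (Continuous.intervalIntegrable (by fun_prop) _ _)
      have hub : (u : ℂ) + ζ.im * Complex.I ∈ Metric.ball (0 : ℂ) r := by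
        rw [mem_ball_zero_iff]
        refine (Complex.norm_le_abs_re_add_abs_im _).trans_lt ?_
        have : |u| ≤ δ := abs_le.2 ⟨hu.1.le, hu.2⟩
        simp
        linarith
      refine (hnorm _ hub).trans ?_
      rw [mul_assoc, ← Real.exp_add]
      refine mul_le_mul_of_nonneg_left (Real.exp_le_exp.2 ?_) hM
      have hdec : (u : ℂ) + ζ.im * Complex.I = ζ + ((u - ζ.re : ℝ) : ℂ) := by
        apply Complex.ext <;> simp
      -- The dual variable is exactly `φ' ζ`, so the linear terms cancel and strong convexity leaves
      -- a Gaussian centred at `ζ.re`.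
      have h4 := re_add_le_of_le_re_deriv h1 h2 h3 hζr hub (u - ζ.re) hdec
      have h5 : (φ' ζ * (u + ζ.im * Complex.I)).re =
          (φ' ζ * ζ).re + (φ' ζ).re * (u - ζ.re) := by
        rw [hdec, mul_add, Complex.add_re, mul_comm (φ' ζ) ((u - ζ.re : ℝ) : ℂ),
          Complex.re_ofReal_mul]
        ring
      rw [Complex.sub_re, h5, hE, Complex.sub_re]
      nlinarith
    have b2 : ∫ u in -δ..δ, Real.exp (-(c * T) * (u - ζ.re) ^ 2) ≤ √(Real.pi / (c * T)) := by
      rw [← integral_gaussian, intervalIntegral.integral_of_le (by linarith),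
        ← integral_sub_right_eq_self (fun u => Real.exp (-(c * T) * u ^ 2)) ζ.re]
      refine setIntegral_le_integral ?_ (Eventually.of_forall fun u => (Real.exp_pos _).le)
      exact (integrable_exp_neg_mul_sq (by positivity : 0 < c * T)).comp_sub_right ζ.re
    rw [intervalIntegral.integral_const_mul] at b1
    exact b1.trans (mul_le_mul_of_nonneg_left b2 (by positivity))
  have hver : ∀ s : ℝ, |s| = δ → ‖∫ y in (0 : ℝ)..ζ.im, f (s + y * Complex.I)‖ ≤
      M * Real.exp (T * E) * (δ * Real.exp (-η * T)) := fun s hs => by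
    have b1 : ‖∫ y in (0 : ℝ)..ζ.im, f (s + y * Complex.I)‖ ≤
        M * Real.exp (T * (E - η)) * |ζ.im - 0| := by
      refine intervalIntegral.norm_integral_le_of_norm_le_const fun y hy => ?_
      have hy' : |y| ≤ |ζ.im| := by
        have := Set.abs_sub_left_of_mem_uIcc (Set.uIoc_subset_uIcc hy)
        simpa using this
      have hub : (s : ℂ) + y * Complex.I ∈ Metric.ball (0 : ℂ) r := by
        rw [mem_ball_zero_iff]
        refine (Complex.norm_le_abs_re_add_abs_im _).trans_lt ?_
        simp
        linarith
      refine (hnorm _ hub).trans (mul_le_mul_of_nonneg_left (Real.exp_le_exp.2 ?_) hM)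
      exact mul_le_mul_of_nonneg_left (hη y s hy' hs) hT.le
    refine b1.trans ?_
    rw [sub_zero, show T * (E - η) = T * E + -η * T by ring, Real.exp_add, mul_assoc, mul_assoc,
      mul_assoc]
    refine mul_le_mul_of_nonneg_left (mul_le_mul_of_nonneg_left ?_ (Real.exp_pos _).le) hM
    rw [mul_comm]
    exact mul_le_mul_of_nonneg_right hv.le (Real.exp_pos _).le
  have hv1 := hver δ (abs_of_pos hδ)
  have hv2 := hver (-δ) (by rw [abs_neg, abs_of_pos hδ])
  rw [Complex.ofReal_neg] at hv2
  refine (add_le_add (add_le_add hhor hv1) hv2).trans_eq ?_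
  ring

end Laplace

section Law

variable {Ω : Type*} [MeasurableSpace Ω] {P : Measure Ω} [IsProbabilityMeasure P] {Z : Ω → ℝ}

lemma norm_setIntegral_exp_le (hZ : Measurable Z) {x₀ K κ l : ℝ} (hl : 0 < l) (hlκ : l < κ)
    (h : ∀ x, x₀ ≤ x → P.real {ω | x < Z ω} ≤ K * Real.exp (-κ * x)) (hx₀ : 0 ≤ x₀) {z : ℂ}
    (hz : ‖z‖ ≤ l) : ‖∫ ω in {ω | x₀ < Z ω}, Complex.exp (z * Z ω) ∂P‖ ≤
      K * (κ / (κ - l)) * Real.exp (-(κ - l) * x₀) := by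
  have hκl : 0 < κ - l := sub_pos.2 hlκ
  have hK : 0 ≤ K := by
    have := measureReal_nonneg.trans (h x₀ le_rfl)
    exact nonneg_of_mul_nonneg_left this (Real.exp_pos _)
  have hκ : 0 < κ := hl.trans hlκ
  refine (norm_integral_le_lintegral_norm _).trans ?_
  refine ENNReal.toReal_le_of_le_ofReal (by positivity) (le_trans ?_ (lintegral_exp_le hZ hl hlκ h))
  refine setLIntegral_mono' (measurableSet_lt measurable_const hZ) fun ω hω => ?_
  refine ENNReal.ofReal_le_ofReal ?_
  rw [Complex.norm_exp, mul_comm, Complex.re_ofReal_mul, mul_comm]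
  have hω' : 0 ≤ Z ω := hx₀.trans (le_of_lt hω)
  exact Real.exp_le_exp.2 (mul_le_mul_of_nonneg_right ((Complex.re_le_norm z).trans hz) hω')

end Law

section LaplaceLaw

variable {Ω : Type*} [MeasurableSpace Ω] {P : Measure Ω} [IsProbabilityMeasure P]

/-- Splitting of a moment generating function into a central part and two tails. -/
lemma complexMGF_eq_add {Z : Ω → ℝ} (hZ : Measurable Z) {z : ℂ}
    (hint : Integrable (fun ω => Real.exp (z.re * Z ω)) P) {p : ℝ → ℝ} (hp : Continuous p)
    (hp0 : ∀ x, 0 ≤ p x) (hlaw : P.map Z = volume.withDensity fun x => ENNReal.ofReal (p x))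
    {a : ℝ} (ha : 0 ≤ a) :
    complexMGF Z P z = (∫ x in -a..a, Complex.exp (z * x) * p x) +
      (∫ ω in {ω | a < Z ω}, Complex.exp (z * Z ω) ∂P) +
        ∫ ω in {ω | a < -Z ω}, Complex.exp (-z * (-Z ω : ℝ)) ∂P := by
  have hi : Integrable (fun ω => Complex.exp (z * Z ω)) P :=
    integrable_cexp_mul_of_re_mem_integrableExpSet hZ.aemeasurable hint
  have m1 : MeasurableSet {ω | a < Z ω} := measurableSet_lt measurable_const hZ
  have m2 : MeasurableSet {ω | a < -Z ω} := measurableSet_lt measurable_const hZ.neg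
  have m3 : MeasurableSet (Z ⁻¹' Set.Icc (-a) a) := hZ measurableSet_Icc
  have hcompl : (Z ⁻¹' Set.Icc (-a) a)ᶜ = {ω | a < Z ω} ∪ {ω | a < -Z ω} := by
    ext ω
    simp only [Set.mem_compl_iff, Set.mem_preimage, Set.mem_Icc, not_and_or, not_le, Set.mem_union,
      Set.mem_ofPred_eq]
    constructor
    · rintro (h | h)
      · exact Or.inr (by linarith)
      · exact Or.inl h
    · rintro (h | h)
      · exact Or.inr h
      · exact Or.inl (by linarith)
  have hdisj : Disjoint {ω | a < Z ω} {ω | a < -Z ω} :=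
    Set.disjoint_left.2 fun ω (h1 : a < Z ω) (h2 : a < -Z ω) => by linarith
  rw [complexMGF, ← integral_add_compl m3 hi, hcompl,
    setIntegral_union hdisj m2 hi.integrableOn hi.integrableOn, ← add_assoc]
  have hc : Continuous fun x : ℝ => Complex.exp (z * x) := by fun_prop
  congr 1
  · congr 1
    rw [← setIntegral_map (f := fun x : ℝ => Complex.exp (z * x)) measurableSet_Icc
      hc.aestronglyMeasurable hZ.aemeasurable, hlaw,
      setIntegral_withDensity_eq_setIntegral_toReal_smul hp.measurable.ennreal_ofReal
        (Eventually.of_forall fun x => ENNReal.ofReal_lt_top) _ measurableSet_Icc,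
      integral_Icc_eq_integral_Ioc, ← intervalIntegral.integral_of_le (by linarith)]
    refine intervalIntegral.integral_congr fun x _ => ?_
    simp only [ENNReal.toReal_ofReal (hp0 x), Complex.real_smul, mul_comm]
  · congr with ω
    push_cast
    ring_nf

/-- A uniform Laplace estimate: the moment generating function of a random variable whose density
is, in the scaling `x = T ξ`, the exponential of `-T φ (ξ)` is at most of the order of its saddle
point value on a complex neighbourhood of the origin. -/
theorem exists_norm_complexMGF_le {φ φ' φ'' : ℂ → ℂ} {r c : ℝ}
    (h1 : ∀ z ∈ Metric.ball (0 : ℂ) r, HasDerivAt φ (φ' z) z)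
    (h2 : ∀ z ∈ Metric.ball (0 : ℂ) r, HasDerivAt φ' (φ'' z) z)
    (h3 : ∀ z ∈ Metric.ball (0 : ℂ) r, 2 * c ≤ (φ'' z).re) (hc : 0 < c) (h0 : φ 0 = 0)
    (h0' : φ' 0 = 0) {δ : ℝ} (hδ : 0 < δ) (hδr : 2 * δ ≤ r) {C₀ K κ : ℝ} (hκ : 0 < κ) :
    ∃ r₀, 0 < r₀ ∧ r₀ ≤ δ ∧ ∃ C, ∀ (T : ℝ) (Z : Ω → ℝ) (p : ℝ → ℝ) (R : ℂ → ℂ), 1 ≤ T →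
      Measurable Z → (∀ l, Integrable (fun ω => Real.exp (l * Z ω)) P) → Continuous p →
      (∀ x, 0 ≤ p x) → P.map Z = volume.withDensity (fun x => ENNReal.ofReal (p x)) →
      DifferentiableOn ℂ R (Metric.ball 0 r) → (∀ z ∈ Metric.ball (0 : ℂ) r, ‖R z‖ ≤ C₀ / √T) →
      (∀ u ∈ Set.Icc (-δ) δ, (p (T * u) : ℂ) = Complex.exp (-T * φ u) * R u) →
      (∀ x, δ * T ≤ x → P.real {ω | x < Z ω} ≤ K * Real.exp (-κ * x)) →
      (∀ x, δ * T ≤ x → P.real {ω | x < -Z ω} ≤ K * Real.exp (-κ * x)) →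
      ∀ ζ, ‖ζ‖ < r₀ →
        ‖complexMGF Z P (φ' ζ) * Complex.exp (-(T * (φ' ζ * ζ - φ ζ)))‖ ≤ C := by
  have hr : 0 < r := by linarith
  have hmem0 : (0 : ℂ) ∈ Metric.ball (0 : ℂ) r := Metric.mem_ball_self hr
  -- At `|s| = δ` convexity gains `c s ^ 2 = 8 η`. Three error terms of size at most `η` and `|E.re|
  -- ≤ 2 η` are paid from it, leaving the gap `3 η` on the vertical sides.
  set η : ℝ := c * δ ^ 2 / 8 with hη
  have hη0 : 0 < η := by positivity
  -- The second bound gives `E.re ≥ -κ δ / 4`, so the tails beyond `δ T`, of order `exp (-κ δ T /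
  -- 2)`, stay below the saddle value `exp (T * E.re)`.
  set η' : ℝ := min η (κ * δ / 8) with hη'
  have hη'0 : 0 < η' := lt_min hη0 (by positivity)
  have hη'1 : η' ≤ η := min_le_left _ _
  have hη'2 : η' ≤ κ * δ / 8 := min_le_right _ _
  have hsmall : ∀ᶠ z in 𝓝 (0 : ℂ), ‖φ z‖ < η' ∧ ‖φ' z‖ < η' / (2 * δ) ∧ ‖φ' z‖ < κ / 2 := by
    have c1 := (h1 0 hmem0).continuousAt.norm
    have c2 := (h2 0 hmem0).continuousAt.norm
    refine (c1.eventually_lt_const ?_).and ((c2.eventually_lt_const ?_).and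
      (c2.eventually_lt_const ?_))
    · simpa [h0] using hη'0
    · simp only [h0', norm_zero]
      positivity
    · simpa [h0'] using hκ
  obtain ⟨r₁, hr₁, hball⟩ := Metric.eventually_nhds_iff_ball.1 hsmall
  -- In the first term the Jacobian `T`, the prefactor `C₀ / √T` and the Gaussian width `1 / √T`
  -- cancel. Each tail gives `2 K`, the factor `κ / (κ - l)` at `l = κ / 2`.
  refine ⟨min r₁ δ, lt_min hr₁ hδ, min_le_right _ _,
    C₀ * (√(Real.pi / c) + 2 * δ * (3 * η)⁻¹) + 4 * K, ?_⟩
  intro T Z p R hT hZ hint hp hp0 hlaw hR hRb hpR htail htail' ζ hζ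
  have hT0 : 0 < T := one_pos.trans_le hT
  have hζδ : ‖ζ‖ < δ := hζ.trans_le (min_le_right _ _)
  have hζ1 : ζ ∈ Metric.ball (0 : ℂ) r₁ := mem_ball_zero_iff.2 (hζ.trans_le (min_le_left _ _))
  obtain ⟨s1, s2, s3⟩ := hball ζ hζ1
  have s2' : ‖φ' ζ‖ * (2 * δ) ≤ η' := ((lt_div_iff₀ (by positivity)).1 s2).le
  have hsT : 0 < √T := by positivity
  have hC₀ : 0 ≤ C₀ := by
    have := (norm_nonneg _).trans (hRb 0 hmem0)
    by_contra h
    exact absurd this (not_le.2 (div_neg_of_neg_of_pos (not_le.1 h) hsT))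
  have hK : 0 ≤ K := by
    have := measureReal_nonneg.trans (htail (δ * T) le_rfl)
    exact nonneg_of_mul_nonneg_left this (Real.exp_pos _)
  set E : ℂ := φ' ζ * ζ - φ ζ with hE
  have hEn : ‖E‖ ≤ 2 * η' := by
    refine (norm_sub_le _ _).trans ?_
    rw [norm_mul]
    have := mul_le_mul_of_nonneg_left hζδ.le (norm_nonneg (φ' ζ))
    linarith
  have hEre := abs_le.1 ((Complex.abs_re_le_norm E).trans hEn)
  have hside : ∀ y s : ℝ, |y| ≤ |ζ.im| → |s| = δ → (φ' ζ * (s + y * Complex.I) -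
      φ (s + y * Complex.I)).re ≤ E.re - 3 * η := fun y s hy hs => by
    have hy' : |y| ≤ ‖ζ‖ := hy.trans (Complex.abs_im_le_norm ζ)
    have hyn : ‖(y : ℂ) * Complex.I‖ = |y| := by
      rw [norm_mul, Complex.norm_I, mul_one, Complex.norm_real, Real.norm_eq_abs]
    have hy1 : (y : ℂ) * Complex.I ∈ Metric.ball (0 : ℂ) r₁ := by
      rw [mem_ball_zero_iff, hyn]
      exact hy'.trans_lt (mem_ball_zero_iff.1 hζ1)
    have hyr : (y : ℂ) * Complex.I ∈ Metric.ball (0 : ℂ) r := by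
      rw [mem_ball_zero_iff, hyn]
      linarith
    have hsn : ‖(s : ℂ) + y * Complex.I‖ ≤ 2 * δ := by
      refine (norm_add_le _ _).trans ?_
      rw [hyn, Complex.norm_real, Real.norm_eq_abs, hs]
      linarith
    have hsr : (s : ℂ) + y * Complex.I ∈ Metric.ball (0 : ℂ) r := by
      rw [mem_ball_zero_iff]
      refine (norm_add_le _ _).trans_lt ?_
      rw [hyn, Complex.norm_real, Real.norm_eq_abs, hs]
      linarith
    obtain ⟨t1, t2, -⟩ := hball _ hy1
    have t2' : ‖φ' (y * Complex.I)‖ * (2 * δ) ≤ η' := ((lt_div_iff₀ (by positivity)).1 t2).le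
    have key := re_add_le_of_le_re_deriv h1 h2 h3 hyr hsr s (add_comm _ _)
    have e1 := (abs_le.1 ((Complex.abs_re_le_norm _).trans t1.le)).1
    have e2 : -η' ≤ (φ' (y * Complex.I)).re * s := by
      refine neg_le_of_abs_le ?_
      rw [abs_mul, hs]
      have := mul_le_mul_of_nonneg_right (Complex.abs_re_le_norm (φ' (y * Complex.I))) hδ.le
      nlinarith [norm_nonneg (φ' (y * Complex.I))]
    have e3 : (φ' ζ * (s + y * Complex.I)).re ≤ η' := by
      refine (Complex.re_le_norm _).trans ?_
      rw [norm_mul]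
      exact (mul_le_mul_of_nonneg_left hsn (norm_nonneg _)).trans s2'
    have e4 : c * s ^ 2 = 8 * η := by
      rw [← sq_abs, hs, hη]
      ring
    rw [Complex.sub_re]
    linarith [hEre.1]
  have hmid := norm_integral_exp_le h1 h2 h3 hc hδr hζδ hR hRb hside hT0
  have hnE : ‖Complex.exp (-(T * E))‖ = Real.exp (-(T * E.re)) := by
    rw [Complex.norm_exp, Complex.neg_re, Complex.re_ofReal_mul]
  have hδT : 0 ≤ δ * T := by positivity
  rw [complexMGF_eq_add hZ (hint _) hp hp0 hlaw hδT, norm_mul, hnE]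
  have hsub : ∫ x in -(δ * T)..δ * T, Complex.exp (φ' ζ * x) * p x =
      T * ∫ u in -δ..δ, Complex.exp (T * (φ' ζ * u - φ u)) * R u := by
    have := intervalIntegral.smul_integral_comp_mul_left (a := -δ) (b := δ)
      (fun x : ℝ => Complex.exp (φ' ζ * x) * p x) T
    rw [mul_neg, mul_comm T δ] at this
    rw [← this, Complex.real_smul]
    congr 1
    refine intervalIntegral.integral_congr fun u hu => ?_
    rw [Set.uIcc_of_le (by linarith)] at hu
    simp only [hpR u hu]
    rw [← mul_assoc, ← Complex.exp_add]
    congr 2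
    push_cast
    ring
  have hκ2 : κ / 2 < κ := by linarith
  have htl := norm_setIntegral_exp_le hZ (half_pos hκ) hκ2 htail hδT s3.le
  have htl' := norm_setIntegral_exp_le (Z := fun ω => -Z ω) hZ.neg (half_pos hκ) hκ2 htail' hδT
    (z := -φ' ζ) (by rw [norm_neg]; exact s3.le)
  have hκκ : κ / (κ - κ / 2) = 2 := by field_simp; norm_num
  rw [hκκ] at htl htl'
  have hmid' : ‖∫ x in -(δ * T)..δ * T, Complex.exp (φ' ζ * x) * p x‖ ≤
      Real.exp (T * E.re) * (C₀ * (√(Real.pi / c) + 2 * δ * (3 * η)⁻¹)) := by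
    rw [hsub, norm_mul, Complex.norm_real, Real.norm_of_nonneg hT0.le]
    refine (mul_le_mul_of_nonneg_left hmid hT0.le).trans ?_
    have e1 : √(Real.pi / (c * T)) = √(Real.pi / c) / √T := by
      rw [← div_div, Real.sqrt_div' _ hT0.le]
    have e2 : T / √T = √T := Real.div_sqrt
    have e3 : √T * Real.exp (-(3 * η) * T) ≤ (3 * η)⁻¹ := by
      have a1 : √T ≤ T := by
        rw [Real.sqrt_le_left hT0.le]
        nlinarith
      have a2 : 3 * η * T ≤ Real.exp (3 * η * T) := by linarith [Real.add_one_le_exp (3 * η * T)]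
      rw [neg_mul, Real.exp_neg, ← div_eq_mul_inv, div_le_iff₀ (Real.exp_pos _),
        inv_mul_eq_div, le_div_iff₀ (by positivity)]
      nlinarith
    calc T * (C₀ / √T * Real.exp (T * E.re) *
          (√(Real.pi / (c * T)) + 2 * δ * Real.exp (-(3 * η) * T)))
        = Real.exp (T * E.re) * (C₀ * (T / √T * (√(Real.pi / c) / √T) +
            2 * δ * (T / √T * Real.exp (-(3 * η) * T)))) := by
          rw [e1]
          ring
      _ ≤ _ := by
          rw [e2, mul_div_cancel₀ _ hsT.ne']
          gcongr
  have hexp : Real.exp (-(κ - κ / 2) * (δ * T)) ≤ Real.exp (T * E.re) := by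
    refine Real.exp_le_exp.2 ?_
    have : -(κ * δ / 4) ≤ E.re := by linarith [hEre.1]
    nlinarith [mul_pos hκ hδ, mul_pos (mul_pos hκ hδ) hT0]
  have hT1 : 1 = Real.exp (T * E.re) * Real.exp (-(T * E.re)) := by
    rw [← Real.exp_add, add_neg_cancel, Real.exp_zero]
  have hfin : ‖((∫ x in -(δ * T)..δ * T, Complex.exp (φ' ζ * x) * p x) +
      (∫ ω in {ω | δ * T < Z ω}, Complex.exp (φ' ζ * Z ω) ∂P) +
        ∫ ω in {ω | δ * T < -Z ω}, Complex.exp (-φ' ζ * (-Z ω : ℝ)) ∂P)‖ ≤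
      Real.exp (T * E.re) * (C₀ * (√(Real.pi / c) + 2 * δ * (3 * η)⁻¹) + 4 * K) := by
    refine (norm_add₃_le).trans ((add_le_add (add_le_add hmid' (htl.trans
      (mul_le_mul_of_nonneg_left hexp (by positivity)))) (htl'.trans
      (mul_le_mul_of_nonneg_left hexp (by positivity)))).trans_eq ?_)
    ring
  refine (mul_le_mul_of_nonneg_right hfin (Real.exp_pos _).le).trans_eq ?_
  rw [mul_right_comm, ← hT1, one_mul]

end LaplaceLaw

/-! ### The large deviation function in the complex domain -/

/-- The Gaussian density on the complex plane. -/
def gaussDensC (σ : ℝ) (z : ℂ) : ℂ := Complex.exp (-(z / σ) ^ 2) / (σ * √Real.pi : ℝ)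

lemma gaussDensC_ofReal (σ x : ℝ) : gaussDensC σ x = gaussDens σ x := by
  rw [gaussDensC, gaussDens]
  push_cast
  rfl

lemma gaussDensC_neg (σ : ℝ) (z : ℂ) : gaussDensC σ (-z) = gaussDensC σ z := by
  simp [gaussDensC, neg_div]

lemma hasDerivAt_gaussDensC (σ : ℝ) (z : ℂ) :
    HasDerivAt (gaussDensC σ) (-(2 * z / σ ^ 2) * gaussDensC σ z) z := by
  have h1 := ((((hasDerivAt_id z).div_const (σ : ℂ)).pow 2).neg.cexp).div_const
    ((σ * √Real.pi : ℝ) : ℂ)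
  refine h1.congr_deriv ?_
  simp only [gaussDensC, Pi.neg_apply, Pi.pow_apply, id_eq]
  push_cast
  ring

/-- An entire function has an entire primitive; its value at 0 is fixed to match the real tail. -/
lemma exists_gaussTailC (σ : ℝ) : ∃ q : ℂ → ℂ, q 0 = 1 / 2 ∧
    ∀ z, HasDerivAt q (-gaussDensC σ z) z := by
  have hd : Differentiable ℂ fun z => -gaussDensC σ z := fun z =>
    (hasDerivAt_gaussDensC σ z).differentiableAt.neg
  obtain ⟨q, h0, h1⟩ := hd.isExactOn_univ.with_val_at 0 (1 / 2)
  exact ⟨q, h0, fun z => h1 z (Set.mem_univ z)⟩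

/-- The Gaussian tail function on the complex plane. -/
def gaussTailC (σ : ℝ) : ℂ → ℂ := (exists_gaussTailC σ).choose

lemma gaussTailC_zero (σ : ℝ) : gaussTailC σ 0 = 1 / 2 := (exists_gaussTailC σ).choose_spec.1

lemma hasDerivAt_gaussTailC (σ : ℝ) (z : ℂ) : HasDerivAt (gaussTailC σ) (-gaussDensC σ z) z :=
  (exists_gaussTailC σ).choose_spec.2 z

/-- The integrated Gaussian tail on the complex plane. -/
def tailIntC (σ : ℝ) (z : ℂ) : ℂ := σ ^ 2 / 2 * gaussDensC σ z - z * gaussTailC σ z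

/-- The sum of the integrated Gaussian tails of the two half-lines. -/
def tailSumC (σ : ℝ) (z : ℂ) : ℂ := tailIntC σ z + tailIntC σ (-z)

/-- The argument of the Bessel functions on the complex plane. -/
def besselArgC (σ : ℝ) (z : ℂ) : ℂ := Complex.exp (Complex.log (tailSumC σ z ^ 2 - z ^ 2) / 2)

/-- The large deviation function on the complex plane, at density one. -/
def rateC (σ : ℝ) (z : ℂ) : ℂ := tailSumC σ z - besselArgC σ z

/-- The density of the tracer divided by its exponential order, in the scaling regime and on the
complex plane. -/
def prefactorC (ρ σ T : ℝ) (z : ℂ) : ℂ :=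
  (gaussDensC σ z / T + 2 * ρ * gaussTailC σ z * (1 - gaussTailC σ z)) *
      bessC 0 (ρ * T * besselArgC σ z) +
    ρ * ((1 - gaussTailC σ z) ^ 2 * (2 * tailIntC σ z) +
      gaussTailC σ z ^ 2 * (2 * tailIntC σ (-z))) / besselArgC σ z *
        bessC 1 (ρ * T * besselArgC σ z)

section

variable {σ : ℝ}

lemma gaussTailC_ofReal (hσ : 0 < σ) (x : ℝ) : gaussTailC σ x = gaussTail σ x := by
  have h : ∀ y : ℝ, HasDerivAt (fun y : ℝ => gaussTailC σ y - gaussTail σ y) 0 y := fun y => by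
    have h1 := (hasDerivAt_gaussTailC σ y).comp_ofReal
    have h2 := (hasDerivAt_gaussTail hσ y).ofReal_comp
    refine (h1.sub h2).congr_deriv ?_
    rw [gaussDensC_ofReal]
    push_cast
    ring
  have h3 := is_const_of_deriv_eq_zero (fun y => (h y).differentiableAt) (fun y => (h y).deriv) x 0
  have h4 : gaussTailC σ ((0 : ℝ) : ℂ) - ((gaussTail σ 0 : ℝ) : ℂ) = 0 := by
    rw [Complex.ofReal_zero, gaussTailC_zero, gaussTail_zero]
    norm_num
  simp only [h4] at h3
  exact sub_eq_zero.1 h3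

lemma tailIntC_ofReal (hσ : 0 < σ) (x : ℝ) : tailIntC σ x = tailInt σ x := by
  rw [tailIntC, tailInt, gaussDensC_ofReal, gaussTailC_ofReal hσ]
  push_cast
  rfl

lemma tailIntC_neg_ofReal (hσ : 0 < σ) (x : ℝ) : tailIntC σ (-x) = tailInt σ (-x) := by
  rw [← Complex.ofReal_neg, tailIntC_ofReal hσ]

lemma hasDerivAt_tailIntC (hσ : 0 < σ) (z : ℂ) : HasDerivAt (tailIntC σ) (-gaussTailC σ z) z := by
  have h1 := ((hasDerivAt_gaussDensC σ z).const_mul ((σ : ℂ) ^ 2 / 2)).sub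
    ((hasDerivAt_id z).mul (hasDerivAt_gaussTailC σ z))
  refine h1.congr_deriv ?_
  have : (σ : ℂ) ≠ 0 := Complex.ofReal_ne_zero.2 hσ.ne'
  field_simp
  simp
  ring

lemma hasDerivAt_tailSumC (hσ : 0 < σ) (z : ℂ) :
    HasDerivAt (tailSumC σ) (gaussTailC σ (-z) - gaussTailC σ z) z := by
  have h1 := (hasDerivAt_tailIntC hσ z).add
    ((hasDerivAt_tailIntC hσ (-z)).comp z (hasDerivAt_neg z))
  refine h1.congr_deriv ?_
  ring

lemma differentiable_gaussDensC (σ : ℝ) : Differentiable ℂ (gaussDensC σ) := fun z =>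
  (hasDerivAt_gaussDensC σ z).differentiableAt

lemma differentiable_gaussTailC (σ : ℝ) : Differentiable ℂ (gaussTailC σ) := fun z =>
  (hasDerivAt_gaussTailC σ z).differentiableAt

lemma differentiable_tailIntC (hσ : 0 < σ) : Differentiable ℂ (tailIntC σ) := fun z =>
  (hasDerivAt_tailIntC hσ z).differentiableAt

lemma differentiable_tailSumC (hσ : 0 < σ) : Differentiable ℂ (tailSumC σ) := fun z =>
  (hasDerivAt_tailSumC hσ z).differentiableAt

lemma tailSumC_ofReal (hσ : 0 < σ) (x : ℝ) :
    tailSumC σ x = (tailInt σ x + tailInt σ (-x) : ℝ) := by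
  rw [tailSumC, tailIntC_ofReal hσ, tailIntC_neg_ofReal hσ, Complex.ofReal_add]

/-- `(A + B) ^ 2 - (B - A) ^ 2 = 4 A B` with `B - A = x`. This shows why `besselArgC` is a square
root of `tailSumC σ z ^ 2 - z ^ 2`. -/
lemma tailSumC_sq_sub_ofReal (hσ : 0 < σ) (x : ℝ) :
    tailSumC σ x ^ 2 - (x : ℂ) ^ 2 = (4 * (tailInt σ x * tailInt σ (-x)) : ℝ) := by
  rw [tailSumC_ofReal hσ, tailInt_neg]
  push_cast
  ring

lemma tailSumC_zero (hσ : 0 < σ) : tailSumC σ 0 = (σ / √Real.pi : ℝ) := by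
  have h := tailSumC_ofReal hσ 0
  rw [Complex.ofReal_zero] at h
  rw [h, neg_zero, tailInt_zero hσ]
  congr 1
  have : √Real.pi ≠ 0 := by positivity
  field_simp
  norm_num

lemma besselArgC_ofReal (hσ : 0 < σ) (x : ℝ) : besselArgC σ x = besselArg σ x := by
  have h1 := tailInt_pos hσ x
  have h2 := tailInt_pos hσ (-x)
  have h3 : 0 < tailInt σ x * tailInt σ (-x) := mul_pos h1 h2
  rw [besselArgC, tailSumC_sq_sub_ofReal hσ, ← Complex.ofReal_log (by positivity), besselArg,
    ← Complex.ofReal_ofNat, ← Complex.ofReal_div, ← Complex.ofReal_exp]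
  congr 1
  rw [Real.exp_half, Real.exp_log (by positivity), Real.sqrt_mul (by norm_num),
    show (4 : ℝ) = 2 ^ 2 by norm_num, Real.sqrt_sq zero_le_two]

lemma besselArgC_sq {z : ℂ} (h : tailSumC σ z ^ 2 - z ^ 2 ≠ 0) :
    besselArgC σ z ^ 2 = tailSumC σ z ^ 2 - z ^ 2 := by
  rw [besselArgC, ← Complex.exp_nat_mul]
  push_cast
  rw [mul_div_cancel₀ _ two_ne_zero, Complex.exp_log h]

lemma rateC_ofReal (hσ : 0 < σ) (ρ x : ℝ) : ρ * rateC σ x = phiA ρ σ x := by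
  rw [rateC, tailSumC_ofReal hσ, besselArgC_ofReal hσ, phiA_eq_sub hσ]
  push_cast
  ring

lemma rateC_neg (σ : ℝ) (z : ℂ) : rateC σ (-z) = rateC σ z := by
  have h : tailSumC σ (-z) = tailSumC σ z := by rw [tailSumC, tailSumC, neg_neg, add_comm]
  rw [rateC, rateC, besselArgC, besselArgC, h, neg_sq]

lemma besselArgC_zero (hσ : 0 < σ) : besselArgC σ 0 = (σ / √Real.pi : ℝ) := by
  have h := besselArgC_ofReal hσ 0
  rw [Complex.ofReal_zero] at h
  have h1 := tailInt_pos hσ 0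
  rw [h, besselArg, neg_zero, Real.sqrt_mul_self h1.le, tailInt_zero hσ]
  congr 1
  have : √Real.pi ≠ 0 := by positivity
  field_simp

lemma rateC_zero (hσ : 0 < σ) : rateC σ 0 = 0 := by
  rw [rateC, tailSumC_zero hσ, besselArgC_zero hσ, sub_self]

lemma tracerDens_eq_prefactorC (hσ : 0 < σ) {T : ℝ} (hT : 0 < T) (ρ u : ℝ) :
    (tracerDens ρ (σ * T) (T * u) : ℂ) =
      Complex.exp (-T * (ρ * rateC σ u)) * prefactorC ρ σ T u := by
  rw [mul_comm T u, tracerDens_scale hσ hT, rateC_ofReal hσ, prefactorC, gaussDensC_ofReal,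
    gaussTailC_ofReal hσ, besselArgC_ofReal hσ, tailIntC_ofReal hσ, tailIntC_neg_ofReal hσ,
    show (ρ : ℂ) * T * besselArg σ u = ((ρ * (T * besselArg σ u) : ℝ) : ℂ) by push_cast; ring,
    bessC_ofReal, bessC_ofReal]
  push_cast
  rfl

/-- The regularity of the large deviation function near the origin. -/
lemma exists_ball_rateC (hσ : 0 < σ) {ρ : ℝ} (hρ : 0 < ρ) : ∃ r, 0 < r ∧
    DifferentiableOn ℂ (rateC σ) (Metric.ball 0 r) ∧
    (∀ z ∈ Metric.ball (0 : ℂ) r, 2 * tailSumC σ z * rateC σ z = z ^ 2 + rateC σ z ^ 2) ∧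
    ∃ C, ∀ T : ℝ, 1 ≤ T → DifferentiableOn ℂ (prefactorC ρ σ T) (Metric.ball 0 r) ∧
      ∀ z ∈ Metric.ball (0 : ℂ) r, ‖prefactorC ρ σ T z‖ ≤ C / √T := by
  have hpi := Real.pi_pos
  have cg := (differentiable_gaussDensC σ).continuous
  have cq := (differentiable_gaussTailC σ).continuous
  have cH := (differentiable_tailIntC hσ).continuous
  have ch := (differentiable_tailSumC hσ).continuous
  set w₀ : ℝ := σ / √Real.pi with hw₀
  have hw₀0 : 0 < w₀ := by positivity
  have e1 : ∀ᶠ z in 𝓝 (0 : ℂ), tailSumC σ z ^ 2 - z ^ 2 ∈ Complex.slitPlane := by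
    have c1 : ContinuousAt (fun z => tailSumC σ z ^ 2 - z ^ 2) 0 := by fun_prop
    refine c1.eventually_mem (Complex.isOpen_slitPlane.mem_nhds ?_)
    rw [tailSumC_zero hσ, zero_pow two_ne_zero, sub_zero, ← Complex.ofReal_pow]
    exact Complex.ofReal_mem_slitPlane.2 (by positivity)
  have hdw : ∀ z, tailSumC σ z ^ 2 - z ^ 2 ∈ Complex.slitPlane →
      DifferentiableAt ℂ (besselArgC σ) z := fun z hz => by
    have d1 : DifferentiableAt ℂ (fun z => tailSumC σ z ^ 2 - z ^ 2) z :=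
      ((differentiable_tailSumC hσ z).pow 2).sub (differentiableAt_id.pow 2)
    exact ((d1.clog hz).div_const 2).cexp
  have cw : ContinuousAt (besselArgC σ) 0 := (hdw 0 e1.self_of_nhds).continuousAt
  have hw0 : besselArgC σ 0 ≠ 0 := Complex.exp_ne_zero _
  -- A positive lower bound on the real part gives the uniform decay `O(1 / √T)` of both Bessel
  -- factors off the real axis.
  have e2 : ∀ᶠ z in 𝓝 (0 : ℂ), w₀ / 2 < (besselArgC σ z).re := by
    refine (Complex.continuous_re.continuousAt.comp cw).eventually_const_lt ?_
    simp only [Function.comp_apply, besselArgC_zero hσ, Complex.ofReal_re]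
    linarith
  obtain ⟨M₁, e3⟩ : ∃ M, ∀ᶠ z in 𝓝 (0 : ℂ), ‖gaussDensC σ z‖ < M :=
    ⟨_, cg.norm.continuousAt.eventually_lt_const (lt_add_one _)⟩
  obtain ⟨M₂, e4⟩ : ∃ M, ∀ᶠ z in 𝓝 (0 : ℂ),
      ‖2 * ρ * gaussTailC σ z * (1 - gaussTailC σ z)‖ < M := by
    have c1 : Continuous fun z => ‖2 * ρ * gaussTailC σ z * (1 - gaussTailC σ z)‖ := by fun_prop
    exact ⟨_, c1.continuousAt.eventually_lt_const (lt_add_one _)⟩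
  obtain ⟨M₃, e5⟩ : ∃ M, ∀ᶠ z in 𝓝 (0 : ℂ),
      ‖ρ * ((1 - gaussTailC σ z) ^ 2 * (2 * tailIntC σ z) +
        gaussTailC σ z ^ 2 * (2 * tailIntC σ (-z))) / besselArgC σ z‖ < M := by
    have c1 : Continuous fun z => ρ * ((1 - gaussTailC σ z) ^ 2 * (2 * tailIntC σ z) +
        gaussTailC σ z ^ 2 * (2 * tailIntC σ (-z))) := by fun_prop
    exact ⟨_, ((c1.continuousAt.div cw hw0).norm).eventually_lt_const (lt_add_one _)⟩
  obtain ⟨r, hr, hball⟩ := Metric.eventually_nhds_iff_ball.1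
    (e1.and (e2.and (e3.and (e4.and e5))))
  refine ⟨r, hr, fun z hz => ((differentiable_tailSumC hσ z).sub
    (hdw z (hball z hz).1)).differentiableWithinAt, fun z hz => ?_,
    (M₁ + M₂ + M₃) * √(Real.pi / (ρ * (w₀ / 2))), fun T hT => ⟨fun z hz => ?_, fun z hz => ?_⟩⟩
  -- With `w = S - f` and `w ^ 2 = S ^ 2 - z ^ 2`, expanding the square gives the quadratic equation
  -- for `f`.
  · have h1 := besselArgC_sq (Complex.slitPlane_ne_zero (hball z hz).1)
    rw [rateC]
    linear_combination -h1
  · have d1 := differentiable_gaussDensC σ z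
    have d2 := differentiable_gaussTailC σ z
    have d3 := differentiable_tailIntC hσ z
    have d4 : DifferentiableAt ℂ (fun z => tailIntC σ (-z)) z :=
      (differentiable_tailIntC hσ (-z)).comp z differentiableAt_id.neg
    have d5 := hdw z (hball z hz).1
    have d6 : ∀ k, DifferentiableAt ℂ (fun z => bessC k (ρ * T * besselArgC σ z)) z := fun k =>
      (differentiable_bessC k _).comp z (d5.const_mul _)
    have d7 := d6 0
    have d8 := d6 1
    have hw : besselArgC σ z ≠ 0 := Complex.exp_ne_zero _
    unfold prefactorC
    refine DifferentiableAt.differentiableWithinAt ?_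
    fun_prop (disch := assumption)
  · obtain ⟨-, b2, b3, b4, b5⟩ := hball z hz
    have hT0 : 0 < T := one_pos.trans_le hT
    have hre : (ρ * T * besselArgC σ z : ℂ).re = ρ * T * (besselArgC σ z).re := by
      rw [← Complex.ofReal_mul, Complex.re_ofReal_mul]
    have hb : ∀ k, ‖bessC k (ρ * T * besselArgC σ z)‖ ≤
        √(Real.pi / (ρ * (w₀ / 2))) / √T := fun k => by
      have hpos : 0 < (ρ * T * besselArgC σ z : ℂ).re := by
        rw [hre]
        have : 0 < (besselArgC σ z).re := lt_trans (by positivity) b2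
        positivity
      refine (norm_bessC_le k hpos).trans ?_
      rw [← Real.sqrt_div' _ hT0.le, div_div, hre]
      refine Real.sqrt_le_sqrt (div_le_div_of_nonneg_left hpi.le (by positivity) ?_)
      rw [mul_right_comm]
      gcongr
    have hgT : ‖gaussDensC σ z / T‖ ≤ M₁ := by
      rw [norm_div, Complex.norm_real, Real.norm_of_nonneg hT0.le]
      exact (div_le_self (norm_nonneg _) hT).trans b3.le
    have hM₃ : 0 ≤ M₃ := (norm_nonneg _).trans b5.le
    have hM₁₂ : 0 ≤ M₁ + M₂ := add_nonneg ((norm_nonneg _).trans b3.le)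
      ((norm_nonneg _).trans b4.le)
    rw [prefactorC, mul_div_assoc (M₁ + M₂ + M₃), add_mul (M₁ + M₂)]
    refine (norm_add_le _ _).trans (add_le_add ?_ ?_)
    · rw [norm_mul]
      exact mul_le_mul ((norm_add_le _ _).trans (add_le_add hgT b4.le)) (hb 0) (norm_nonneg _) hM₁₂
    · rw [norm_mul]
      exact mul_le_mul b5.le (hb 1) (norm_nonneg _) hM₃

end

/-! ### Derivatives with respect to a changed variable -/

/-- The derivation `Φ⁻¹ d/dz`. -/
def scaledDeriv (Φ f : ℂ → ℂ) (z : ℂ) : ℂ := deriv f z / Φ z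

section

variable {Φ f g : ℂ → ℂ}

/-- Cauchy's estimate, halving the radius at each derivative. The point is that `B` does not depend
on `f`, which will vary with time. -/
lemma exists_norm_iterate_scaledDeriv_le (n : ℕ) {m : ℝ} (hm : 0 < m) {r : ℝ} (hr : 0 < r)
    (hΦ : DifferentiableOn ℂ Φ (Metric.ball 0 r)) (hΦm : ∀ z ∈ Metric.ball (0 : ℂ) r, m ≤ ‖Φ z‖)
    (M : ℝ) : ∃ B, ∀ f : ℂ → ℂ, DifferentiableOn ℂ f (Metric.ball 0 r) →
      (∀ z ∈ Metric.ball (0 : ℂ) r, ‖f z‖ ≤ M) → ‖(scaledDeriv Φ)^[n] f 0‖ ≤ B := by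
  induction n generalizing r M with
  | zero => exact ⟨M, fun f _ hf => hf 0 (Metric.mem_ball_self hr)⟩
  | succ n ih =>
    have hsub : Metric.ball (0 : ℂ) (r / 2) ⊆ Metric.ball 0 r :=
      Metric.ball_subset_ball (by linarith)
    obtain ⟨B, hB⟩ := ih (half_pos hr) (hΦ.mono hsub) (fun z hz => hΦm z (hsub hz))
      (M / (r / 2) / m)
    refine ⟨B, fun f hf hfM => ?_⟩
    rw [Function.iterate_succ_apply]
    refine hB _ (fun z hz => ?_) fun z hz => ?_
    · have hne : Φ z ≠ 0 := norm_pos_iff.1 (hm.trans_le (hΦm z (hsub hz)))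
      exact ((hf.deriv Metric.isOpen_ball).mono hsub z hz).div (hΦ.mono hsub z hz) hne
    · have hMn : 0 ≤ M := (norm_nonneg _).trans (hfM 0 (Metric.mem_ball_self hr))
      rw [scaledDeriv, norm_div]
      refine div_le_div₀ (by positivity) ?_ hm (hΦm z (hsub hz))
      have hcl : Metric.ball z (r / 2) ⊆ Metric.ball 0 r := by
        refine Metric.ball_subset_ball' ?_
        have := Metric.mem_ball.1 hz
        linarith
      refine Complex.norm_deriv_le_of_forall_mem_sphere_norm_le (half_pos hr) ?_ fun w hw => ?_
      · refine DifferentiableOn.diffContOnCl (hf.mono ?_)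
        rw [closure_ball z (half_pos hr).ne']
        intro w hw
        rw [mem_ball_zero_iff]
        have h1 := mem_ball_zero_iff.1 hz
        have h2 : ‖w - z‖ ≤ r / 2 := by rwa [Metric.mem_closedBall, dist_eq_norm] at hw
        linarith [norm_add_le (w - z) z, congrArg norm (sub_add_cancel w z)]
      · refine hfM w ?_
        rw [mem_ball_zero_iff]
        have h1 := mem_ball_zero_iff.1 hz
        have h2 : ‖w - z‖ = r / 2 := by rwa [Metric.mem_sphere, dist_eq_norm] at hw
        linarith [norm_add_le (w - z) z, congrArg norm (sub_add_cancel w z)]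

lemma scaledDeriv_congr (h : f =ᶠ[𝓝 0] g) : scaledDeriv Φ f =ᶠ[𝓝 0] scaledDeriv Φ g := by
  filter_upwards [h.deriv] with z hz
  rw [scaledDeriv, scaledDeriv, hz]

lemma iterate_scaledDeriv_congr (n : ℕ) (h : f =ᶠ[𝓝 0] g) :
    (scaledDeriv Φ)^[n] f =ᶠ[𝓝 0] (scaledDeriv Φ)^[n] g := by
  induction n generalizing f g with
  | zero => exact h
  | succ n ih =>
    rw [Function.iterate_succ_apply, Function.iterate_succ_apply]
    exact ih (scaledDeriv_congr h)

lemma analyticAt_scaledDeriv (hΦ : AnalyticAt ℂ Φ 0) (hΦ0 : Φ 0 ≠ 0) (hf : AnalyticAt ℂ f 0) :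
    AnalyticAt ℂ (scaledDeriv Φ f) 0 :=
  hf.deriv.div hΦ hΦ0

lemma iterate_scaledDeriv_mul_add (hΦ : AnalyticAt ℂ Φ 0) (hΦ0 : Φ 0 ≠ 0) (n : ℕ) (a : ℂ)
    (hf : AnalyticAt ℂ f 0) (hg : AnalyticAt ℂ g 0) :
    (scaledDeriv Φ)^[n] (fun z => a * f z + g z) =ᶠ[𝓝 0]
      fun z => a * (scaledDeriv Φ)^[n] f z + (scaledDeriv Φ)^[n] g z := by
  induction n generalizing f g with
  | zero => exact EventuallyEq.rfl
  | succ n ih =>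
    simp only [Function.iterate_succ_apply]
    refine EventuallyEq.trans (iterate_scaledDeriv_congr n ?_)
      (ih (analyticAt_scaledDeriv hΦ hΦ0 hf) (analyticAt_scaledDeriv hΦ hΦ0 hg))
    filter_upwards [hf.eventually_analyticAt, hg.eventually_analyticAt] with z h1 h2
    simp only [scaledDeriv]
    rw [deriv_fun_add (h1.differentiableAt.const_mul a) h2.differentiableAt,
      deriv_const_mul a h1.differentiableAt]
    ring

/-- By the chain rule, `(deriv ψ)⁻¹ d/dz` is differentiation in the variable `l = ψ z`. Derivatives
in `l` are thus taken in the coordinate `z`, without inverting `ψ`. -/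
lemma iterate_scaledDeriv_comp {C ψ : ℂ → ℂ} (hψ : AnalyticAt ℂ ψ 0) (hψ0 : ψ 0 = 0)
    (hC : AnalyticAt ℂ C 0) (hψ' : deriv ψ 0 ≠ 0) (n : ℕ) :
    (scaledDeriv (deriv ψ))^[n] (fun z => C (ψ z)) =ᶠ[𝓝 0] fun z => iteratedDeriv n C (ψ z) := by
  induction n with
  | zero => simp
  | succ n ih =>
    rw [Function.iterate_succ_apply']
    refine (scaledDeriv_congr ih).trans ?_
    have h1 : AnalyticAt ℂ (iteratedDeriv n C) (ψ 0) := by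
      rw [hψ0, iteratedDeriv_eq_iterate]
      exact hC.iterated_deriv n
    have h2 : ∀ᶠ z in 𝓝 0, AnalyticAt ℂ (iteratedDeriv n C) (ψ z) :=
      hψ.continuousAt.eventually h1.eventually_analyticAt
    filter_upwards [h2, hψ.eventually_analyticAt, hψ.deriv.continuousAt.eventually_ne hψ']
      with z a1 a2 a3
    have hd := (a1.differentiableAt.hasDerivAt.comp z a2.differentiableAt.hasDerivAt).deriv
    simp only [scaledDeriv]
    rw [show (fun z => iteratedDeriv n C (ψ z)) = iteratedDeriv n C ∘ ψ from rfl, hd,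
      mul_div_cancel_right₀ _ a3, iteratedDeriv_succ]

/-- The derivatives of a real function that extends to a complex analytic one. -/
lemma iteratedDeriv_re_eventuallyEq {C : ℂ → ℂ} (hC : AnalyticAt ℂ C 0) (n : ℕ) :
    iteratedDeriv n (fun x : ℝ => (C x).re) =ᶠ[𝓝 0] fun x : ℝ => (iteratedDeriv n C x).re := by
  induction n with
  | zero => simp
  | succ n ih =>
    have h1 : AnalyticAt ℂ (iteratedDeriv n C) ((0 : ℝ) : ℂ) := by
      rw [Complex.ofReal_zero, iteratedDeriv_eq_iterate]
      exact hC.iterated_deriv n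
    have h2 : ∀ᶠ x : ℝ in 𝓝 0, AnalyticAt ℂ (iteratedDeriv n C) (x : ℂ) :=
      Complex.continuous_ofReal.continuousAt.eventually h1.eventually_analyticAt
    rw [iteratedDeriv_succ]
    filter_upwards [ih.deriv, h2] with x a1 a2
    rw [a1, a2.differentiableAt.hasDerivAt.real_of_complex.deriv, iteratedDeriv_succ]

end

/-- If a moment generating function is of the order of its saddle point value then the derivatives
of its logarithm agree with those of the saddle point exponent up to bounded terms. -/
theorem exists_norm_iteratedDeriv_log_sub_le {φ : ℂ → ℂ} {r : ℝ} (hr : 0 < r)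
    (hφ : DifferentiableOn ℂ φ (Metric.ball 0 r)) (h0 : φ 0 = 0) (h0' : deriv φ 0 = 0)
    (hne : deriv (deriv φ) 0 ≠ 0) (n : ℕ) {C : ℝ} :
    ∃ B, ∀ (T : ℝ) (M : ℂ → ℂ), Differentiable ℂ M → M 0 = 1 → (∀ ζ ∈ Metric.ball (0 : ℂ) r,
      ‖M (deriv φ ζ) * Complex.exp (-(T * (deriv φ ζ * ζ - φ ζ)))‖ ≤ C) →
      ‖iteratedDeriv n (fun l => Complex.log (M l)) 0 -
        T * (scaledDeriv (deriv (deriv φ)))^[n] (fun ζ => deriv φ ζ * ζ - φ ζ) 0‖ ≤ B := by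
  have hmem : Metric.ball (0 : ℂ) r ∈ 𝓝 (0 : ℂ) := Metric.ball_mem_nhds 0 hr
  have hφa : AnalyticAt ℂ φ 0 := hφ.analyticAt hmem
  have hφ' := hφ.deriv Metric.isOpen_ball
  have hφ'' := hφ'.deriv Metric.isOpen_ball
  have hEd : DifferentiableOn ℂ (fun ζ => deriv φ ζ * ζ - φ ζ) (Metric.ball 0 r) :=
    (hφ'.mul differentiableOn_id).sub hφ
  have hm : 0 < ‖deriv (deriv φ) 0‖ / 2 := by
    have := norm_pos_iff.2 hne
    positivity
  have hlow : ∀ᶠ z in 𝓝 (0 : ℂ), ‖deriv (deriv φ) 0‖ / 2 < ‖deriv (deriv φ) z‖ :=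
    hφa.deriv.deriv.continuousAt.norm.eventually_const_lt (by linarith)
  obtain ⟨r₁, hr₁, hball⟩ := Metric.eventually_nhds_iff_ball.1 hlow
  have hC1 : 0 < |C| + 1 := by positivity
  -- Schwarz radius: `F 0 = 1` and `‖F - 1‖ ≤ |C| + 1` on the ball of radius `r` force `‖F - 1‖ ≤ 1
  -- / 2` for `‖z‖ < s`, so `log F` is analytic and bounded by 1 there, uniformly in `T`.
  set s : ℝ := min r₁ (r / (2 * (|C| + 1))) with hs
  have hs0 : 0 < s := lt_min hr₁ (by positivity)
  have hsr : s ≤ r := by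
    refine (min_le_right _ _).trans (div_le_self hr.le ?_)
    linarith [abs_nonneg C]
  have hsub : Metric.ball (0 : ℂ) s ⊆ Metric.ball 0 r := Metric.ball_subset_ball hsr
  obtain ⟨B, hB⟩ := exists_norm_iterate_scaledDeriv_le (Φ := deriv (deriv φ)) n hm hs0
    (hφ''.mono hsub) (fun z hz => (hball z (Metric.ball_subset_ball (min_le_left _ _) hz)).le) 1
  refine ⟨B, fun T M hM hM0 hbound => ?_⟩
  let F : ℂ → ℂ := fun ζ => M (deriv φ ζ) * Complex.exp (-(T * (deriv φ ζ * ζ - φ ζ)))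
  have hF : DifferentiableOn ℂ F (Metric.ball 0 r) :=
    (hM.comp_differentiableOn hφ').mul (hEd.const_mul (T : ℂ)).neg.cexp
  have hF0 : F 0 = 1 := by simp [F, h0, h0', hM0]
  have hFs : ∀ z ∈ Metric.ball (0 : ℂ) s, ‖F z - 1‖ ≤ 1 / 2 := fun z hz => by
    have h1 := Complex.dist_le_div_mul_dist_of_mapsTo_ball (R₂ := |C| + 1) hF (fun w hw => ?_)
      (hsub hz)
    · rw [hF0, dist_eq_norm, dist_zero_right] at h1
      refine h1.trans ?_
      have h2 : ‖z‖ ≤ r / (2 * (|C| + 1)) :=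
        (mem_ball_zero_iff.1 hz).le.trans (min_le_right _ _)
      refine (mul_le_mul_of_nonneg_left h2 (by positivity)).trans_eq ?_
      field_simp
    · rw [hF0, Metric.mem_closedBall, dist_eq_norm]
      refine (norm_sub_le _ _).trans ?_
      rw [norm_one]
      exact add_le_add_left ((hbound w hw).trans (le_abs_self C)) 1
  have hslit : ∀ z ∈ Metric.ball (0 : ℂ) s, F z ∈ Complex.slitPlane := fun z hz => by
    refine Or.inl ?_
    have := (Complex.abs_re_le_norm _).trans (hFs z hz)
    rw [Complex.sub_re, Complex.one_re] at this
    linarith [(abs_le.1 this).1]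
  let L : ℂ → ℂ := fun z => Complex.log (F z)
  have hL : DifferentiableOn ℂ L (Metric.ball 0 s) := (hF.mono hsub).clog hslit
  have hLb : ∀ z ∈ Metric.ball (0 : ℂ) s, ‖L z‖ ≤ 1 := fun z hz => by
    have := Complex.norm_log_one_add_half_le_self (hFs z hz)
    rw [add_sub_cancel] at this
    exact this.trans (by linarith [hFs z hz])
  have hLa : AnalyticAt ℂ L 0 := hL.analyticAt (Metric.ball_mem_nhds 0 hs0)
  have hEa : AnalyticAt ℂ (fun ζ => deriv φ ζ * ζ - φ ζ) 0 := hEd.analyticAt hmem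
  have hCa : AnalyticAt ℂ (fun l => Complex.log (M l)) 0 :=
    (hM.analyticAt 0).clog (by rw [hM0]; exact Complex.one_mem_slitPlane)
  -- The principal logarithm is additive while the imaginary part stays in `(-π, π)`. The
  -- neighbourhood where this holds shrinks with `T`, which is harmless: derivatives at 0 only see
  -- the germ, and the bound on `L` holds on the fixed ball.
  have hgerm : (fun z => Complex.log (M (deriv φ z))) =ᶠ[𝓝 0]
      fun z => (T : ℂ) * (deriv φ z * z - φ z) + L z := by
    have hMd : ContinuousAt (fun z => M (deriv φ z)) 0 :=
      hM.continuous.continuousAt.comp hφa.deriv.continuousAt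
    have hval : M (deriv φ 0) = 1 := by rw [h0', hM0]
    have hlog : ContinuousAt (fun z => (Complex.log (M (deriv φ z)) -
        T * (deriv φ z * z - φ z)).im) 0 := by
      refine Complex.continuous_im.continuousAt.comp (ContinuousAt.sub (hMd.clog ?_)
        (hEa.continuousAt.const_mul _))
      rw [hval]
      exact Complex.one_mem_slitPlane
    have hat : (Complex.log (M (deriv φ 0)) - T * (deriv φ 0 * 0 - φ 0)).im = 0 := by
      rw [hval, h0]
      simp
    have hpi := Real.pi_pos
    filter_upwards [hlog.eventually_lt_const (u := Real.pi) (hat.trans_lt hpi),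
      hlog.eventually_const_lt (u := -Real.pi) ((neg_neg_of_pos hpi).trans_eq hat.symm),
      hMd.eventually_ne (by rw [hval]; exact one_ne_zero)] with z a1 a2 a3
    have h1 : F z = Complex.exp (Complex.log (M (deriv φ z)) - T * (deriv φ z * z - φ z)) := by
      rw [sub_eq_add_neg, Complex.exp_add, Complex.exp_log a3]
    simp only [L]
    rw [h1, Complex.log_exp a2 a1.le]
    ring
  have hcomp := iterate_scaledDeriv_comp hφa.deriv h0' hCa hne n
  have hadd := iterate_scaledDeriv_mul_add hφa.deriv.deriv hne n (T : ℂ) hEa hLa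
  have key := (hcomp.symm.trans ((iterate_scaledDeriv_congr n hgerm).trans hadd)).self_of_nhds
  simp only [h0'] at key
  rw [key, add_sub_cancel_left]
  exact hB L hL hLb

/-! ### The leading coefficients of the cumulants -/

section Taylor

lemma iteratedDeriv_mul_zero {f g : ℂ → ℂ} (hf : AnalyticAt ℂ f 0) (hg : AnalyticAt ℂ g 0)
    (n : ℕ) : iteratedDeriv n (fun z => f z * g z) 0 = ∑ i ∈ Finset.range (n + 1),
      n.choose i * iteratedDeriv i f 0 * iteratedDeriv (n - i) g 0 :=
  iteratedDeriv_fun_mul hf.contDiffAt hg.contDiffAt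

lemma iteratedDeriv_mul_deriv_zero {f g : ℂ → ℂ} (hf : AnalyticAt ℂ f 0)
    (hg : AnalyticAt ℂ g 0) (n : ℕ) : iteratedDeriv n (fun z => f z * deriv g z) 0 =
      ∑ i ∈ Finset.range (n + 1),
        n.choose i * iteratedDeriv i f 0 * iteratedDeriv (n - i + 1) g 0 := by
  rw [iteratedDeriv_mul_zero hf hg.deriv]
  simp only [iteratedDeriv_succ']

lemma iteratedDeriv_odd_eq_zero {f : ℂ → ℂ} (hf : ∀ z, f (-z) = f z) {n : ℕ} (hn : Odd n) :
    iteratedDeriv n f 0 = 0 := by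
  have h := iteratedDeriv_comp_neg n f 0
  simp only [hf, neg_zero, hn.neg_one_pow, neg_smul, one_smul] at h
  exact self_eq_neg.1 h

variable {φ ψ : ℂ → ℂ}

/-- The first two derivatives of the Legendre transform cost nothing and produce `ψ = 1 / φ''`, so
orders 4 and 6 are two and four applications of `ψ d/dz` to `ψ`. Evenness removes the odd terms. -/
lemma iterate_mul_deriv_zero (hψ : AnalyticAt ℂ ψ 0) (h1 : iteratedDeriv 1 ψ 0 = 0)
    (h3 : iteratedDeriv 3 ψ 0 = 0) :
    (fun f z => ψ z * deriv f z)^[2] ψ 0 = ψ 0 ^ 2 * iteratedDeriv 2 ψ 0 ∧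
    (fun f z => ψ z * deriv f z)^[4] ψ 0 = ψ 0 ^ 3 *
      (ψ 0 * iteratedDeriv 4 ψ 0 + 4 * iteratedDeriv 2 ψ 0 ^ 2) := by
  let e₁ : ℂ → ℂ := fun z => ψ z * deriv ψ z
  let e₂ : ℂ → ℂ := fun z => ψ z * deriv e₁ z
  let e₃ : ℂ → ℂ := fun z => ψ z * deriv e₂ z
  have a₁ : AnalyticAt ℂ e₁ 0 := hψ.mul hψ.deriv
  have a₂ : AnalyticAt ℂ e₂ 0 := hψ.mul a₁.deriv
  have a₃ : AnalyticAt ℂ e₃ 0 := hψ.mul a₂.deriv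
  have b11 : iteratedDeriv 1 e₁ 0 = ψ 0 * iteratedDeriv 2 ψ 0 := by
    have := iteratedDeriv_mul_deriv_zero hψ hψ 1
    simp only [Finset.sum_range_succ, Finset.sum_range_zero, h1, iteratedDeriv_zero] at this
    simpa [h1] using this
  have b13 : iteratedDeriv 3 e₁ 0 = ψ 0 * iteratedDeriv 4 ψ 0 + 3 * iteratedDeriv 2 ψ 0 ^ 2 := by
    have := iteratedDeriv_mul_deriv_zero hψ hψ 3
    simp only [Finset.sum_range_succ, Finset.sum_range_zero, h1, h3, iteratedDeriv_zero] at this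
    norm_num [h1, h3, Nat.choose] at this
    rw [this]
    ring
  have b22 : iteratedDeriv 2 e₂ 0 = iteratedDeriv 2 ψ 0 * (ψ 0 * iteratedDeriv 2 ψ 0) +
      ψ 0 * (ψ 0 * iteratedDeriv 4 ψ 0 + 3 * iteratedDeriv 2 ψ 0 ^ 2) := by
    have := iteratedDeriv_mul_deriv_zero hψ a₁ 2
    simp only [Finset.sum_range_succ, Finset.sum_range_zero, h1, iteratedDeriv_zero] at this
    norm_num [b11, b13, Nat.choose] at this
    rw [this]
    ring
  have b31 : iteratedDeriv 1 e₃ 0 = ψ 0 * iteratedDeriv 2 e₂ 0 := by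
    have := iteratedDeriv_mul_deriv_zero hψ a₂ 1
    simp only [Finset.sum_range_succ, Finset.sum_range_zero, h1, iteratedDeriv_zero] at this
    simpa [h1] using this
  rw [iteratedDeriv_one] at b11 b31
  refine ⟨?_, ?_⟩
  · change ψ 0 * deriv e₁ 0 = _
    rw [b11]
    ring
  · change ψ 0 * deriv e₃ 0 = _
    rw [b31, b22]
    ring

/-- The low order derivatives of the saddle point exponent as a function of the dual variable. -/
lemma iterate_scaledDeriv_exponent (hφ : AnalyticAt ℂ φ 0) (heven : ∀ z, φ (-z) = φ z)
    (hne : iteratedDeriv 2 φ 0 ≠ 0) :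
    (scaledDeriv (deriv (deriv φ)))^[2] (fun ζ => deriv φ ζ * ζ - φ ζ) 0 =
      (iteratedDeriv 2 φ 0)⁻¹ ∧
    (scaledDeriv (deriv (deriv φ)))^[4] (fun ζ => deriv φ ζ * ζ - φ ζ) 0 =
      -(iteratedDeriv 4 φ 0 / iteratedDeriv 2 φ 0 ^ 4) ∧
    (scaledDeriv (deriv (deriv φ)))^[6] (fun ζ => deriv φ ζ * ζ - φ ζ) 0 =
      (10 * iteratedDeriv 4 φ 0 ^ 2 - iteratedDeriv 2 φ 0 * iteratedDeriv 6 φ 0) /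
        iteratedDeriv 2 φ 0 ^ 7 := by
  set Φ := deriv (deriv φ) with hΦ
  have hΦi : ∀ n, iteratedDeriv n Φ 0 = iteratedDeriv (n + 2) φ 0 := fun n => by
    rw [iteratedDeriv_succ', iteratedDeriv_succ']
  have hΦ0 : Φ 0 = iteratedDeriv 2 φ 0 := by simpa using hΦi 0
  have hΦa : AnalyticAt ℂ Φ 0 := hφ.deriv.deriv
  have hΦne : Φ 0 ≠ 0 := hΦ0 ▸ hne
  let ψ : ℂ → ℂ := fun z => (Φ z)⁻¹
  have hψ : AnalyticAt ℂ ψ 0 := hΦa.inv hΦne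
  have hS : scaledDeriv Φ = fun f z => ψ z * deriv f z := by
    funext f z
    rw [scaledDeriv, div_eq_inv_mul]
  have hone : (fun z => ψ z * Φ z) =ᶠ[𝓝 0] fun _ => 1 := by
    filter_upwards [hΦa.continuousAt.eventually_ne hΦne] with z hz
    exact inv_mul_cancel₀ hz
  -- Leibniz applied to `ψ * Φ = 1`, to be solved recursively for the derivatives of `ψ`.
  have hmul : ∀ n, ∑ i ∈ Finset.range (n + 1), n.choose i * iteratedDeriv i ψ 0 *
      iteratedDeriv (n - i) Φ 0 = if n = 0 then 1 else 0 := fun n => by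
    rw [← iteratedDeriv_mul_zero hψ hΦa, hone.iteratedDeriv_eq, iteratedDeriv_const]
  have hodd3 : iteratedDeriv 3 φ 0 = 0 := iteratedDeriv_odd_eq_zero heven (by decide)
  have hodd5 : iteratedDeriv 5 φ 0 = 0 := iteratedDeriv_odd_eq_zero heven (by decide)
  have p0 : ψ 0 = (iteratedDeriv 2 φ 0)⁻¹ := by rw [← hΦ0]
  have p1 : iteratedDeriv 1 ψ 0 = 0 := by
    have := hmul 1
    simp only [Finset.sum_range_succ, Finset.sum_range_zero, hΦi] at this
    norm_num [hodd3] at this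
    simpa [hne] using this
  have p2 : iteratedDeriv 2 ψ 0 = -(iteratedDeriv 4 φ 0 / iteratedDeriv 2 φ 0 ^ 2) := by
    have := hmul 2
    simp only [Finset.sum_range_succ, Finset.sum_range_zero, hΦi, p1, iteratedDeriv_zero, p0]
      at this
    norm_num [Nat.choose] at this
    field_simp at this ⊢
    linear_combination this
  have p3 : iteratedDeriv 3 ψ 0 = 0 := by
    have := hmul 3
    simp only [Finset.sum_range_succ, Finset.sum_range_zero, hΦi, p1] at this
    norm_num [hodd3, hodd5] at this
    simpa [hne] using this
  have p4 : iteratedDeriv 4 ψ 0 = (6 * iteratedDeriv 4 φ 0 ^ 2 -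
      iteratedDeriv 2 φ 0 * iteratedDeriv 6 φ 0) / iteratedDeriv 2 φ 0 ^ 3 := by
    have := hmul 4
    simp only [Finset.sum_range_succ, Finset.sum_range_zero, hΦi, p1, p2, p3, iteratedDeriv_zero,
      p0] at this
    norm_num [Nat.choose] at this
    field_simp at this ⊢
    linear_combination this
  -- Legendre duality: the derivative of the exponent with respect to `l = φ' ζ` is `ζ` itself.
  have hE : scaledDeriv Φ (fun ζ => deriv φ ζ * ζ - φ ζ) =ᶠ[𝓝 0] id := by
    filter_upwards [hφ.eventually_analyticAt, hΦa.continuousAt.eventually_ne hΦne] with z h1 h2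
    have hd := ((h1.deriv.differentiableAt.hasDerivAt.mul (hasDerivAt_id z)).sub
      h1.differentiableAt.hasDerivAt).deriv
    rw [scaledDeriv, id_eq, div_eq_iff h2]
    refine Eq.trans hd ?_
    simp only [id_eq, hΦ]
    ring
  have hE2 : (scaledDeriv Φ)^[2] (fun ζ => deriv φ ζ * ζ - φ ζ) =ᶠ[𝓝 0] ψ := by
    refine (scaledDeriv_congr hE).trans (Eventually.of_forall fun z => ?_)
    rw [scaledDeriv, deriv_id, one_div]
  obtain ⟨q1, q2⟩ := iterate_mul_deriv_zero hψ p1 p3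
  rw [← hS] at q1 q2
  refine ⟨hE2.self_of_nhds.trans p0, ?_, ?_⟩
  · rw [show (4 : ℕ) = 2 + 2 from rfl, Function.iterate_add_apply,
      (iterate_scaledDeriv_congr 2 hE2).self_of_nhds, q1, p0, p2]
    field_simp
    ring
  · rw [show (6 : ℕ) = 4 + 2 from rfl, Function.iterate_add_apply,
      (iterate_scaledDeriv_congr 4 hE2).self_of_nhds, q2, p0, p2, p4]
    field_simp
    ring

end Taylor

section

variable {σ : ℝ}

/-- The second derivative of the sum of tails is twice the Gaussian density. Order 6 is not needed:
in the quadratic equation it is multiplied by `rateC σ 0 = 0`. -/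
lemma iteratedDeriv_tailSumC (hσ : 0 < σ) :
    iteratedDeriv 2 (tailSumC σ) 0 = (2 / (σ * √Real.pi) : ℝ) ∧
    iteratedDeriv 4 (tailSumC σ) 0 = (-(4 / (σ ^ 3 * √Real.pi)) : ℝ) := by
  have h1 : deriv (tailSumC σ) = fun z => gaussTailC σ (-z) - gaussTailC σ z :=
    funext fun z => (hasDerivAt_tailSumC hσ z).deriv
  have h2 : deriv (fun z => gaussTailC σ (-z) - gaussTailC σ z) = fun z => 2 * gaussDensC σ z := by
    funext z
    have := (((hasDerivAt_gaussTailC σ (-z)).comp z (hasDerivAt_neg z)).sub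
      (hasDerivAt_gaussTailC σ z)).deriv
    refine Eq.trans this ?_
    rw [gaussDensC_neg]
    ring
  have h3 : deriv (fun z => 2 * gaussDensC σ z) =
      fun z => z * (-(4 / σ ^ 2) * gaussDensC σ z) := by
    funext z
    rw [((hasDerivAt_gaussDensC σ z).const_mul 2).deriv]
    ring
  have h4 : deriv (fun z => z * (-(4 / σ ^ 2) * gaussDensC σ z)) 0 =
      -(4 / σ ^ 2) * gaussDensC σ 0 := by
    have := ((hasDerivAt_id (0 : ℂ)).mul ((hasDerivAt_gaussDensC σ 0).const_mul
      (-(4 / (σ : ℂ) ^ 2)))).deriv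
    refine Eq.trans this ?_
    simp
  have h5 : gaussDensC σ 0 = (1 / (σ * √Real.pi) : ℝ) := by
    rw [← Complex.ofReal_zero, gaussDensC_ofReal, gaussDens]
    simp
  have hσ' : (σ : ℂ) ≠ 0 := Complex.ofReal_ne_zero.2 hσ.ne'
  have hpi : ((√Real.pi : ℝ) : ℂ) ≠ 0 := Complex.ofReal_ne_zero.2 (by positivity)
  constructor
  · rw [iteratedDeriv_succ', iteratedDeriv_succ', h1, h2, iteratedDeriv_zero, h5]
    push_cast
    field_simp
  · rw [iteratedDeriv_succ', iteratedDeriv_succ', iteratedDeriv_succ', iteratedDeriv_succ', h1, h2,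
      h3, iteratedDeriv_zero, h4, h5]
    push_cast
    field_simp

lemma tailSumC_neg (σ : ℝ) (z : ℂ) : tailSumC σ (-z) = tailSumC σ z := by
  rw [tailSumC, tailSumC, neg_neg, add_comm]

/-- The Taylor coefficients of the large deviation function at the origin. -/
lemma iteratedDeriv_rateC (hσ : 0 < σ) {r : ℝ} (hr : 0 < r)
    (hd : DifferentiableOn ℂ (rateC σ) (Metric.ball 0 r))
    (heq : ∀ z ∈ Metric.ball (0 : ℂ) r, 2 * tailSumC σ z * rateC σ z = z ^ 2 + rateC σ z ^ 2) :
    iteratedDeriv 2 (rateC σ) 0 = (√Real.pi / σ : ℝ) ∧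
    iteratedDeriv 4 (rateC σ) 0 = (3 * √Real.pi * (Real.pi - 4) / σ ^ 3 : ℝ) ∧
    iteratedDeriv 6 (rateC σ) 0 =
      (15 * √Real.pi * (3 * Real.pi ^ 2 - 18 * Real.pi + 28) / σ ^ 5 : ℝ) := by
  have hmem := Metric.ball_mem_nhds (0 : ℂ) hr
  have hf : AnalyticAt ℂ (rateC σ) 0 := hd.analyticAt hmem
  have hh : AnalyticAt ℂ (tailSumC σ) 0 := (differentiable_tailSumC hσ).analyticAt 0
  have f0 := rateC_zero hσ
  have f1 : iteratedDeriv 1 (rateC σ) 0 = 0 := iteratedDeriv_odd_eq_zero (rateC_neg σ) (by decide)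
  have f3 : iteratedDeriv 3 (rateC σ) 0 = 0 := iteratedDeriv_odd_eq_zero (rateC_neg σ) (by decide)
  have f5 : iteratedDeriv 5 (rateC σ) 0 = 0 := iteratedDeriv_odd_eq_zero (rateC_neg σ) (by decide)
  have h0 := tailSumC_zero hσ
  have h1 : iteratedDeriv 1 (tailSumC σ) 0 = 0 :=
    iteratedDeriv_odd_eq_zero (tailSumC_neg σ) (by decide)
  have h3 : iteratedDeriv 3 (tailSumC σ) 0 = 0 :=
    iteratedDeriv_odd_eq_zero (tailSumC_neg σ) (by decide)
  have h5 : iteratedDeriv 5 (tailSumC σ) 0 = 0 :=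
    iteratedDeriv_odd_eq_zero (tailSumC_neg σ) (by decide)
  obtain ⟨h2, h4⟩ := iteratedDeriv_tailSumC hσ
  have hgerm : (fun z => tailSumC σ z * rateC σ z) =ᶠ[𝓝 0]
      fun z => 1 / 2 * (z ^ 2 + rateC σ z * rateC σ z) := by
    filter_upwards [hmem] with z hz
    linear_combination (1 / 2 : ℂ) * heq z hz
  -- Since `rateC σ 0 = 0` and `tailSumC σ 0 ≠ 0`, the identity of order `n` determines the `n`-th
  -- derivative of `rateC σ` from the lower ones.
  have key : ∀ n, ∑ i ∈ Finset.range (n + 1), n.choose i * iteratedDeriv i (tailSumC σ) 0 *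
      iteratedDeriv (n - i) (rateC σ) 0 = 1 / 2 * ((if n = 2 then 2 else 0) +
        ∑ i ∈ Finset.range (n + 1), n.choose i * iteratedDeriv i (rateC σ) 0 *
          iteratedDeriv (n - i) (rateC σ) 0) := fun n => by
    have hsq : AnalyticAt ℂ (fun z : ℂ => z ^ 2) 0 := analyticAt_id.pow 2
    have hff : AnalyticAt ℂ (fun z => rateC σ z * rateC σ z) 0 := hf.mul hf
    rw [← iteratedDeriv_mul_zero hh hf, ← iteratedDeriv_mul_zero hf hf, hgerm.iteratedDeriv_eq,
      iteratedDeriv_const_mul_field, iteratedDeriv_fun_add hsq.contDiffAt hff.contDiffAt,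
      iteratedDeriv_fun_pow_zero]
    simp
  have hσ' : (σ : ℂ) ≠ 0 := Complex.ofReal_ne_zero.2 hσ.ne'
  have hs : ((√Real.pi : ℝ) : ℂ) ≠ 0 := Complex.ofReal_ne_zero.2 (by positivity)
  have hs2 : ((Real.pi : ℝ) : ℂ) = ((√Real.pi : ℝ) : ℂ) ^ 2 := by
    rw [← Complex.ofReal_pow, Real.sq_sqrt Real.pi_pos.le]
  push_cast at h0 h2 h4
  push_cast
  rw [hs2]
  generalize ((√Real.pi : ℝ) : ℂ) = s at *
  have F2 : iteratedDeriv 2 (rateC σ) 0 = s / σ := by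
    have := key 2
    simp only [Finset.sum_range_succ, Finset.sum_range_zero, f0, f1, h0, h1, h2,
      iteratedDeriv_zero] at this
    norm_num [Nat.choose, f0, f1] at this
    field_simp at this ⊢
    linear_combination this
  have F4 : iteratedDeriv 4 (rateC σ) 0 = 3 * s * (s ^ 2 - 4) / σ ^ 3 := by
    have := key 4
    simp only [Finset.sum_range_succ, Finset.sum_range_zero, f0, f1, f3, h0, h1, h2, h3, h4,
      iteratedDeriv_zero] at this
    norm_num [Nat.choose, f0, f1, f3, F2] at this
    field_simp at this ⊢
    linear_combination (1 / 2 : ℂ) * this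
  refine ⟨F2, F4, ?_⟩
  have := key 6
  simp only [Finset.sum_range_succ, Finset.sum_range_zero, f0, f1, f3, f5, h0, h1, h2, h3, h4, h5,
    iteratedDeriv_zero] at this
  norm_num [Nat.choose, f0, f1, f3, f5, F2, F4] at this
  field_simp at this ⊢
  linear_combination (1 / 2 : ℂ) * this

end

/-- On the real axis the real part of the principal logarithm is the real logarithm of the moment
generating function, and taking real parts commutes with real differentiation. -/
lemma cumulant_eq_re_iteratedDeriv {Ω : Type*} [MeasurableSpace Ω] {P : Measure Ω} {Z : Ω → ℝ}
    (hM : Differentiable ℂ (complexMGF Z P)) (h0 : complexMGF Z P 0 = 1) (n : ℕ) :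
    cumulant n Z P = (iteratedDeriv n (fun l => Complex.log (complexMGF Z P l)) 0).re := by
  have hC : AnalyticAt ℂ (fun l => Complex.log (complexMGF Z P l)) 0 :=
    (hM.analyticAt 0).clog (by rw [h0]; exact Complex.one_mem_slitPlane)
  have hcgf : cgf Z P = fun x : ℝ => (Complex.log (complexMGF Z P x)).re := by
    funext x
    rw [complexMGF_ofReal, Complex.log_ofReal_re, cgf]
  rw [cumulant, hcgf, (iteratedDeriv_re_eventuallyEq hC n).self_of_nhds]
  simp only [Complex.ofReal_zero]

/-! ### Large time limits of the cumulants of the tracer -/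

section

variable {Ω : Type*} [MeasurableSpace Ω] {P : Measure Ω} [IsProbabilityMeasure P]
  {ρ σ : ℝ} {Y : ℤ → Ω → ℝ} {B X : ℤ → ℝ≥0 → Ω → ℝ}

/-- The cumulants of the tracer are, up to a bounded error, those of the saddle point. -/
theorem IsAnnealedSingleFile.exists_cumulant_sub_le (h : IsAnnealedSingleFile ρ σ Y B X P)
    (hρ : 0 < ρ) (hσ : 0 < σ) {φ : ℂ → ℂ} (hφ : φ = fun z => ρ * rateC σ z) (n : ℕ) :
    ∃ D, ∀ t : ℝ≥0, 1 ≤ t → |cumulant n (X 0 t) P - √(t : ℝ) *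
      ((scaledDeriv (deriv (deriv φ)))^[n] (fun ζ => deriv φ ζ * ζ - φ ζ) 0).re| ≤ D := by
  obtain ⟨r, hr, hd, heq, C₀, hC₀⟩ := exists_ball_rateC hσ hρ
  have hφd : DifferentiableOn ℂ φ (Metric.ball 0 r) := hφ ▸ hd.const_mul _
  have hφ0 : φ 0 = 0 := by simp [hφ, rateC_zero hσ]
  have heven : ∀ z, φ (-z) = φ z := fun z => by simp only [hφ, rateC_neg]
  have hφ1 : deriv φ 0 = 0 := by
    have := iteratedDeriv_odd_eq_zero heven odd_one
    rwa [iteratedDeriv_one] at this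
  have hφ2 : deriv (deriv φ) 0 = (ρ * (√Real.pi / σ) : ℝ) := by
    rw [← iteratedDeriv_one, ← iteratedDeriv_succ', hφ, iteratedDeriv_const_mul_field,
      (iteratedDeriv_rateC hσ hr hd heq).1, Complex.ofReal_mul]
  have hpos : 0 < ρ * (√Real.pi / σ) := by
    have := Real.pi_pos
    positivity
  have hφa : AnalyticAt ℂ φ 0 := hφd.analyticAt (Metric.ball_mem_nhds 0 hr)
  -- A quarter of `φ'' 0`, so that `2 c = φ'' 0 / 2` is still below `Re φ''` in a neighbourhood of
  -- 0.
  set c : ℝ := ρ * (√Real.pi / σ) / 4 with hc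
  have hlow : ∀ᶠ z in 𝓝 (0 : ℂ), 2 * c < (deriv (deriv φ) z).re := by
    refine (Complex.continuous_re.continuousAt.comp
      hφa.deriv.deriv.continuousAt).eventually_const_lt ?_
    rw [Function.comp_apply, hφ2, Complex.ofReal_re, hc]
    linarith
  obtain ⟨r₁, hr₁, hball⟩ := Metric.eventually_nhds_iff_ball.1 hlow
  set s : ℝ := min r r₁ with hs
  have hs0 : 0 < s := lt_min hr hr₁
  have hsr : Metric.ball (0 : ℂ) s ⊆ Metric.ball 0 r := Metric.ball_subset_ball (min_le_left _ _)
  have hsr₁ : Metric.ball (0 : ℂ) s ⊆ Metric.ball 0 r₁ :=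
    Metric.ball_subset_ball (min_le_right _ _)
  have hφs := hφd.mono hsr
  have hδ : 0 < s / 2 := by positivity
  obtain ⟨K, κ, hκ, htail⟩ := h.exists_uniform_tail_le hρ hσ hδ
  obtain ⟨r₀, hr₀, hr₀δ, C, hC⟩ := exists_norm_complexMGF_le (P := P) (C₀ := C₀) (K := K)
    (fun z hz => (hφs.differentiableAt (Metric.isOpen_ball.mem_nhds hz)).hasDerivAt)
    (fun z hz => ((hφs.deriv Metric.isOpen_ball).differentiableAt
      (Metric.isOpen_ball.mem_nhds hz)).hasDerivAt)
    (fun z hz => (hball z (hsr₁ hz)).le) (by positivity : 0 < c) hφ0 hφ1 hδ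
    (by linarith : 2 * (s / 2) ≤ s) hκ
  obtain ⟨D, hD⟩ := exists_norm_iteratedDeriv_log_sub_le hr₀
    (hφs.mono (Metric.ball_subset_ball (by linarith))) hφ0 hφ1
    (hφ2 ▸ Complex.ofReal_ne_zero.2 hpos.ne') n (C := C)
  refine ⟨D, fun t ht => ?_⟩
  have ht0 : 0 < t := one_pos.trans_le ht
  have hT : 1 ≤ √(t : ℝ) := Real.one_le_sqrt.2 (by exact_mod_cast ht)
  have hint := h.integrable_exp hρ hσ t
  have hset : integrableExpSet (X 0 t) P = Set.univ := Set.eq_univ_of_forall hint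
  have hM : Differentiable ℂ (complexMGF (X 0 t) P) := by
    have := differentiableOn_complexMGF (X := X 0 t) (μ := P)
    simpa [hset, differentiableOn_univ] using this
  have hM0 : complexMGF (X 0 t) P 0 = 1 := by simp [complexMGF]
  have hbound := hC √(t : ℝ) (X 0 t) (tracerDens ρ (σ * √(t : ℝ))) (prefactorC ρ σ √(t : ℝ)) hT
    (h.measurable 0 t) hint (continuous_tracerDens (by positivity) ρ)
    (fun x => (tracerDens_pos hρ (by positivity) x).le) (h.map_tracer hρ hσ ht0)
    ((hC₀ _ hT).1.mono hsr) (fun z hz => (hC₀ _ hT).2 z (hsr hz))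
    (fun u _ => by
      rw [tracerDens_eq_prefactorC hσ (by positivity) ρ u, hφ])
    (htail t ht0)
    (fun x hx => by
      refine Eq.trans_le ?_ (htail t ht0 x hx)
      rw [← h.left_tail_eq hρ hσ ht0 x]
      simp only [lt_neg])
  rw [cumulant_eq_re_iteratedDeriv hM hM0, ← Complex.re_ofReal_mul, ← Complex.sub_re]
  exact (Complex.abs_re_le_norm _).trans (hD _ _ hM hM0 fun ζ hζ =>
    hbound ζ (mem_ball_zero_iff.1 hζ))

/-- The error is bounded in `t`, hence `O(1 / √t)` after division. -/
lemma IsAnnealedSingleFile.tendsto_cumulant_div (h : IsAnnealedSingleFile ρ σ Y B X P)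
    (hρ : 0 < ρ) (hσ : 0 < σ) {φ : ℂ → ℂ} (hφ : φ = fun z => ρ * rateC σ z) (n : ℕ) :
    Tendsto (fun t : ℝ≥0 => cumulant n (X 0 t) P / √(t : ℝ)) atTop
      (𝓝 ((scaledDeriv (deriv (deriv φ)))^[n] (fun ζ => deriv φ ζ * ζ - φ ζ) 0).re) := by
  obtain ⟨D, hD⟩ := h.exists_cumulant_sub_le hρ hσ hφ n
  refine tendsto_iff_norm_sub_tendsto_zero.2 (squeeze_zero' (Eventually.of_forall fun _ =>
    norm_nonneg _) ?_ (tendsto_sqrt_coe_atTop.const_div_atTop D))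
  filter_upwards [eventually_ge_atTop 1] with t ht
  have ht0 : 0 < t := one_pos.trans_le ht
  have hT : 0 < √(t : ℝ) := by positivity
  rw [le_div_iff₀ hT, ← abs_of_pos hT, Real.norm_eq_abs, ← abs_mul, abs_of_pos hT, sub_mul,
    div_mul_cancel₀ _ hT.ne', mul_comm _ √(t : ℝ)]
  exact hD t ht

/-- The large time limits of the first even cumulants of the tracer. -/
theorem IsAnnealedSingleFile.tendsto_cumulants (h : IsAnnealedSingleFile ρ σ Y B X P)
    (hρ : 0 < ρ) (hσ : 0 < σ) :
    Tendsto (fun t : ℝ≥0 => cumulant 2 (X 0 t) P / √(t : ℝ)) atTop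
      (𝓝 (σ / (ρ * √Real.pi))) ∧
    Tendsto (fun t : ℝ≥0 => cumulant 4 (X 0 t) P / √(t : ℝ)) atTop
      (𝓝 (σ / ρ ^ 3 * (4 / Real.pi - 1) * (3 / √Real.pi))) ∧
    Tendsto (fun t : ℝ≥0 => cumulant 6 (X 0 t) P / √(t : ℝ)) atTop
      (𝓝 (σ / ρ ^ 5 * (68 / Real.pi ^ 2 - 30 / Real.pi + 3) * (15 / √Real.pi))) := by
  obtain ⟨r, hr, hd, heq, -⟩ := exists_ball_rateC hσ hρ
  obtain ⟨F2, F4, F6⟩ := iteratedDeriv_rateC hσ hr hd heq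
  have hs : 0 < √Real.pi := Real.sqrt_pos.2 Real.pi_pos
  have hs2 : Real.pi = √Real.pi ^ 2 := (Real.sq_sqrt Real.pi_pos.le).symm
  have hk : ∀ {k : ℕ} {a : ℝ}, iteratedDeriv k (rateC σ) 0 = a →
      iteratedDeriv k (fun z => ρ * rateC σ z) 0 = (ρ * a : ℝ) := fun ha => by
    rw [iteratedDeriv_const_mul_field, ha, Complex.ofReal_mul]
  have hφa : AnalyticAt ℂ (fun z => ρ * rateC σ z) 0 :=
    (hd.const_mul _).analyticAt (Metric.ball_mem_nhds 0 hr)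
  obtain ⟨E2, E4, E6⟩ := iterate_scaledDeriv_exponent hφa
    (fun z => by rw [rateC_neg])
    (by rw [hk F2]; exact Complex.ofReal_ne_zero.2 (by positivity))
  have L := h.tendsto_cumulant_div hρ hσ rfl
  refine ⟨?_, ?_, ?_⟩
  · convert L 2 using 2
    rw [E2, hk F2, ← Complex.ofReal_inv, Complex.ofReal_re]
    field_simp
  · convert L 4 using 2
    rw [E4, hk F2, hk F4, ← Complex.ofReal_pow, ← Complex.ofReal_div, ← Complex.ofReal_neg,
      Complex.ofReal_re, hs2, Real.sqrt_sq hs.le]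
    field_simp
    ring
  · convert L 6 using 2
    rw [E6, hk F2, hk F4, hk F6, ← Complex.ofReal_pow, ← Complex.ofReal_pow, ← Complex.ofReal_mul,
      ← Complex.ofReal_ofNat, ← Complex.ofReal_mul, ← Complex.ofReal_sub, ← Complex.ofReal_div,
      Complex.ofReal_re, hs2, Real.sqrt_sq hs.le]
    field_simp
    ring

end

end SingleFile

end

theorem mainTheorem1 {Ω : Type*} [MeasurableSpace Ω] (P : Measure Ω) [IsProbabilityMeasure P]
    (ρ σ : ℝ) (hρ : 0 < ρ) (hσ : 0 < σ)
    (Y : ℤ → Ω → ℝ) (B X : ℤ → ℝ≥0 → Ω → ℝ)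
    (hX : SingleFile.IsAnnealedSingleFile ρ σ Y B X P) :
    -- the density of the tracer position, and its large deviation form
    (∃ p : ℝ≥0 → ℝ → ℝ,
      (∀ t, 0 < t → Continuous (p t) ∧ (∀ x, 0 < p t x) ∧
        P.map (X 0 t) = volume.withDensity fun x => ENNReal.ofReal (p t x)) ∧
      (∀ ξ : ℝ, Tendsto (fun t : ℝ≥0 => Real.log (p t (ξ * √(t : ℝ))) / √(t : ℝ)) atTop
        (𝓝 (-SingleFile.phiA ρ σ ξ))) ∧
      (∀ ξ : ℝ, ξ ≠ 0 → SingleFile.LogEquiv (fun t => p t (ξ * √(t : ℝ)))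
        (fun t => Real.exp (-√(t : ℝ) * SingleFile.phiA ρ σ ξ)))) ∧
    -- the same for the tail probabilities
    (∀ ξ : ℝ, 0 < ξ →
      SingleFile.LogEquiv (fun t => P.real {ω | ξ * √(t : ℝ) < X 0 t ω})
        (fun t => Real.exp (-√(t : ℝ) * SingleFile.phiA ρ σ ξ))) ∧
    (∀ ξ : ℝ, ξ < 0 →
      SingleFile.LogEquiv (fun t => P.real {ω | X 0 t ω < ξ * √(t : ℝ)})
        (fun t => Real.exp (-√(t : ℝ) * SingleFile.phiA ρ σ ξ))) ∧
    -- growth of the large deviation function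
    (fun ξ : ℝ => SingleFile.phiA ρ σ ξ) ~[Bornology.cobounded ℝ] (fun ξ => ρ * |ξ|) ∧
    -- exponential moments and cumulants
    (∀ (t : ℝ≥0) (l : ℝ), Integrable (fun ω => Real.exp (l * X 0 t ω)) P) ∧
    (∀ (t : ℝ≥0) (n : ℕ), Odd n → SingleFile.cumulant n (X 0 t) P = 0) ∧
    Tendsto (fun t : ℝ≥0 => SingleFile.cumulant 2 (X 0 t) P / √(t : ℝ)) atTop
      (𝓝 (σ / (ρ * √Real.pi))) ∧
    Tendsto (fun t : ℝ≥0 => SingleFile.cumulant 4 (X 0 t) P / √(t : ℝ)) atTop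
      (𝓝 (σ / ρ ^ 3 * (4 / Real.pi - 1) * (3 / √Real.pi))) ∧
    Tendsto (fun t : ℝ≥0 => SingleFile.cumulant 6 (X 0 t) P / √(t : ℝ)) atTop
      (𝓝 (σ / ρ ^ 5 * (68 / Real.pi ^ 2 - 30 / Real.pi + 3) * (15 / √Real.pi))) := by
  exact ⟨⟨fun t x => SingleFile.tracerDens ρ (σ * √(t : ℝ)) x,
    fun t ht => ⟨SingleFile.continuous_tracerDens (by positivity) ρ,
      SingleFile.tracerDens_pos hρ (by positivity), hX.map_tracer hρ hσ ht⟩,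
    SingleFile.tendsto_log_tracerDens hρ hσ, fun ξ hξ => SingleFile.logEquiv_of_tendsto
      (SingleFile.phiA_pos hσ hρ hξ).ne' (SingleFile.tendsto_log_tracerDens hρ hσ ξ)⟩,
    fun ξ hξ => hX.logEquiv_tail hρ hσ hξ, fun ξ hξ => hX.logEquiv_left_tail hρ hσ hξ,
    SingleFile.isEquivalent_phiA hρ hσ, hX.integrable_exp hρ hσ,
    fun t _ hn => hX.cumulant_odd hρ hσ t hn, hX.tendsto_cumulants hρ hσ⟩
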